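/- Let $(a_j)_{j\ge 1}$ be independent real random variables on a probability space with $\mathbb E[a_j]=0$, $\mathbb E[|a_j|^2]=1$, $\mathbb E[|a_j|^4]=\kappa$ for all $j\ge 1$ and $\sup_{j\ge 1}\mathbb E[|a_j|^k]<\infty$ for every integer $k\ge 3$. Put $a_{-j}=a_j$ and $a_0\equiv 0$. Let $b_n<n$ be non-negative integers with $b_n\to\infty$ and $b_n/n\to b\in[0,1]$. Let $T_n=(\mathbf 1_{\{|i-j|\le b_n\}}\,a_{i-j})_{i,j=1}^n$ and $A_n=T_n/\sqrt{b_n}$. **Limiting covariances.** Let $p,q\ge 2$. A subset of $\{1,\dots,p+q\}$ is called *crossing* if it meets both $\{1,\dots,p\}$ and $\{p+1,\dots,p+q\}$. Let $\mathcal P_2(p,q)$ be the set of partitions of $\{1,\dots,p+q\}$ into pairs of which at least three are crossing. If $p$ and $q$ are even, let $\mathcal P_{2,4}(p,q)$ be the set of partitions of $\{1,\dots,p+q\}$ with one block of four elements, two of them in $\{1,\dots,p\}$ and two in $\{p+1,\dots,p+q\}$, all other blocks being pairs that are not crossing; otherwise let $\mathcal P_{2,4}(p,q)=\emptyset$. For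 such a partition $\pi$ introduce a variable $x_V$ for each block $V$, and for $i\in V$ put $y_i=x_V$ if $i$ is the smallest element of $V$, or if $|V|=4$ and $i$ is the largest element of $V$, and $y_i=-x_V$ otherwise. Put $$F^{\mp}_\pi=\prod_{j=1}^{p}\chi_{[0,1]}\Big(x_0+b\sum_{i=1}^{j}y_i\Big)\prod_{j=p+1}^{p+q}\chi_{[0,1]}\Big(y_0\pm b\sum_{i=p+1}^{j}y_i\Big),$$ where $\chi_{[0,1]}$ is the indicator function of $[0,1]$, and the upper sign in $\pm$ belongs to $F^-_\pi$, the lower one to $F^+_\pi$. Let $$f_I^{\mp}(\pi)=\int_{[0,1]^2\times[-1,1]^{(p+q)/2}}\delta\Big(\sum_{i=1}^p y_i\Big)F_\pi^{\mp}\,dx_0\,dy_0\prod_V dx_V\quad(\pi\in\mathcal P_2(p,q)),$$ $$f_{II}^{\mp}(\pi)=\int_{[0,1]^2\times[-1,1]^{(p+q)/2-1}}F_\pi^{\mp}\,dx_0\,dy_0\prod_V dx_V\quad(\pi\in\mathcal P_{2,4}(p,q)),$$ where $\delta$ is the Dirac function, and $$\sigma_{p,q}=\sum_{\pi\in\mathcal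 P_2(p,q)}\big(f_I^-(\pi)+f_I^+(\pi)\big)+(\kappa-1)\sum_{\pi\in\mathcal P_{2,4}(p,q)}\big(f_{II}^-(\pi)+f_{II}^+(\pi)\big)$$ (so $\sigma_{p,q}=0$ if $p+q$ is odd). **Theorem.** (1) For every integer $p\ge 2$, with $\sigma_p^2=\sigma_{p,p}\ge 0$, $$\omega_p=\frac{\sqrt{b_n}}{n}\Big(\mathrm{tr}(A_n^p)-\mathbb E[\mathrm{tr}(A_n^p)]\Big)\longrightarrow N(0,\sigma_p^2)\quad\text{in distribution as }n\to\infty.$$ (2) For every polynomial $Q(x)=\sum_{j=2}^p q_jx^j$ with real coefficients, $p\ge 2$, $$\omega_Q=\frac{\sqrt{b_n}}{n}\Big(\mathrm{tr}\,Q(A_n)-\mathbb E[\mathrm{tr}\,Q(A_n)]\Big)\longrightarrow N(0,\sigma_Q^2)\quad\text{in distribution as }n\to\infty,$$ where $\sigma_Q^2=\sum_{i=2}^p\sum_{j=2}^p q_iq_j\sigma_{i,j}\ge 0$. Here $N(0,0)$ is the point mass at $0$, and all the expectations exist. -/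

import Mathlib

open MeasureTheory ProbabilityTheory Filter Topology

noncomputable section

namespace ToeplitzBand

/-! ### The matrix model -/

/-- The `n × n` Toeplitz band matrix `T = (η_{ij} a_{i-j})`, where `η_{ij} = 1` if `|i - j| ≤ w`
and `η_{ij} = 0` otherwise. -/
def toeplitzBand (a : ℤ → ℝ) (w n : ℕ) : Matrix (Fin n) (Fin n) ℝ :=
  Matrix.of fun i j =>
    if |((i : ℕ) : ℤ) - ((j : ℕ) : ℤ)| ≤ (w : ℤ) then a (((i : ℕ) : ℤ) - ((j : ℕ) : ℤ)) else 0

/-- The rescaled random matrix `A_n = T_n / √b_n`, with bandwidth `b_n = bw n`. -/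
def scaledToeplitz {Ω : Type*} (a : ℤ → Ω → ℝ) (bw : ℕ → ℕ) (n : ℕ) (ω : Ω) :
    Matrix (Fin n) (Fin n) ℝ :=
  (√(bw n : ℝ))⁻¹ • toeplitzBand (fun j => a j ω) (bw n) n

/-- The rescaled centred random variable `(√b_n / n) (Y - E[Y])`. -/
def fluctuation {Ω : Type*} [MeasurableSpace Ω] (P : Measure Ω) (bw : ℕ → ℕ) (n : ℕ)
    (Y : Ω → ℝ) (ω : Ω) : ℝ :=
  √(bw n : ℝ) / (n : ℝ) * (Y ω - ∫ ω', Y ω' ∂P)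

/-! ### Partitions of `[p + q]`

The set `[p + q]` is `Fin (p + q)`; its first `p` elements are `Fin.castAdd q i`, `i : Fin p`, and
its last `q` elements are `Fin.natAdd p j`, `j : Fin q`. -/

/-- Partitions of `[m]`. -/
abbrev Partition (m : ℕ) : Type := Finpartition (Finset.univ : Finset (Fin m))

/-- The block of `π` that contains `i`. -/
def blockOf {m : ℕ} (π : Partition m) (i : Fin m) : π.parts :=
  ⟨π.part i, π.part_mem.2 (Finset.mem_univ i)⟩

/-- A block is crossing if it meets both `{1, …, p}` and `{p + 1, …, p + q}`. -/
def IsCrossing (p q : ℕ) (V : Finset (Fin (p + q))) : Prop :=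
  (∃ i : Fin p, Fin.castAdd q i ∈ V) ∧ ∃ j : Fin q, Fin.natAdd p j ∈ V

open Classical in
/-- Pair partitions of `[p + q]` with at least three crossing pairs. -/
def pairPartitions (p q : ℕ) : Finset (Partition (p + q)) :=
  Finset.univ.filter fun π =>
    (∀ V ∈ π.parts, V.card = 2) ∧ 3 ≤ (π.parts.filter fun V => IsCrossing p q V).card

open Classical in
/-- Partitions of `[p + q]`, with `p` and `q` even, that have one block `V` of four elements, two
of them in `{1, …, p}` and two in `{p + 1, …, p + q}`, all the other blocks being pairs
contained in `{1, …, p}` or in `{p + 1, …, p + q}`. -/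
def pairFourPartitions (p q : ℕ) : Finset (Partition (p + q)) :=
  Finset.univ.filter fun π =>
    Even p ∧ Even q ∧
      ∃ V ∈ π.parts,
        (Finset.univ.filter fun i : Fin p => Fin.castAdd q i ∈ V).card = 2 ∧
        (Finset.univ.filter fun j : Fin q => Fin.natAdd p j ∈ V).card = 2 ∧
        ∀ W ∈ π.parts, W ≠ V → W.card = 2 ∧ ¬ IsCrossing p q W

/-! ### Signs and the relation between the unknowns `y` and `x` -/

open Classical in
/-- `ε_π(i) = 1` if `i` is the smallest element of its block, `-1` otherwise. -/
def epsSign {m : ℕ} (π : Partition m) (i : Fin m) : ℝ :=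
  if ∀ j ∈ π.part i, i ≤ j then 1 else -1

open Classical in
/-- `τ_π(i) = ε_π(i)`, except that in a block of four elements both the smallest and the
largest element get the sign `1`. -/
def tauSign {m : ℕ} (π : Partition m) (i : Fin m) : ℝ :=
  if (∀ j ∈ π.part i, i ≤ j) ∨ ((π.part i).card = 4 ∧ ∀ j ∈ π.part i, j ≤ i) then 1 else -1

/-- The unknowns `y_i = ± x_V`, where `V` is the block of `i`. -/
def unknowns {m : ℕ} (π : Partition m) (sgn : Fin m → ℝ) (x : π.parts → ℝ) (i : Fin m) : ℝ :=
  sgn i * x (blockOf π i)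

/-! ### The integrals -/

/-- The indicator function of `[0, 1]`. -/
def chi (t : ℝ) : ℝ := (Set.Icc (0 : ℝ) 1).indicator 1 t

/-- The product
`∏_{j ≤ p} χ(x₀ + b ∑_{i ≤ j} y_i) · ∏_{p < j ≤ p + q} χ(y₀ + s b ∑_{p < i ≤ j} y_i)`. -/
def walkIndicator (p q : ℕ) (b s : ℝ) (y : Fin (p + q) → ℝ) (x₀ y₀ : ℝ) : ℝ :=
  (∏ j : Fin p, chi (x₀ + b * ∑ i ∈ Finset.Iic j, y (Fin.castAdd q i))) *
    ∏ j : Fin q, chi (y₀ + s * b * ∑ i ∈ Finset.Iic j, y (Fin.natAdd p i))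

open Classical in
/-- Given the coordinates `z` other than the one at `v`, the point `x` that has these coordinates
and lies on the hyperplane `∑ c_w x_w = 0` (for `c v ≠ 0`). -/
def hyperplanePoint {ι : Type*} [Fintype ι] (c : ι → ℝ) (v : ι) (z : {w : ι // w ≠ v} → ℝ) :
    ι → ℝ :=
  fun w => if h : w = v then -(∑ u : {w : ι // w ≠ v}, c u.1 * z u) / c v else z ⟨w, h⟩

open Classical in
/-- The integral `∫_{[-1,1]^ι} δ(∑ c_w x_w) G(x) dx` with the Dirac function `δ`, for a linear form
`c ≠ 0`: a coordinate `v` with `c v ≠ 0` is integrated out against `δ`, which leaves the factor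
`1 / |c v|` and an integral over the other coordinates, restricted to those points for which the
solved coordinate lies in `[-1, 1]`. By the change of variables formula the value does not depend
on the coordinate `v` chosen. -/
def deltaIntegral {ι : Type*} [Fintype ι] (c : ι → ℝ) (G : (ι → ℝ) → ℝ) : ℝ :=
  if h : ∃ v, c v ≠ 0 then
    |c h.choose|⁻¹ * ∫ z in Set.Icc (-1 : {w : ι // w ≠ h.choose} → ℝ) 1,
      (Set.Icc (-1 : ι → ℝ) 1).indicator G (hyperplanePoint c h.choose z)
  else 0

open Classical in
/-- The coefficient of `x_V` in `y_1 + ⋯ + y_p`. -/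
def halfSumCoeff {p q : ℕ} (π : Partition (p + q)) (sgn : Fin (p + q) → ℝ) (V : π.parts) : ℝ :=
  ∑ i : Fin p, if blockOf π (Fin.castAdd q i) = V then sgn (Fin.castAdd q i) else 0

/-- The coefficients above are those of `y_1 + ⋯ + y_p`. -/
theorem sum_halfSumCoeff {p q : ℕ} (π : Partition (p + q)) (sgn : Fin (p + q) → ℝ)
    (x : π.parts → ℝ) :
    ∑ V, halfSumCoeff π sgn V * x V = ∑ i : Fin p, unknowns π sgn x (Fin.castAdd q i) := by
  classical
  simp only [halfSumCoeff, unknowns, Finset.sum_mul]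
  rw [Finset.sum_comm]
  refine Finset.sum_congr rfl fun i _ => ?_
  simp [ite_mul]

/-- The integral of type I,
`∫_{[0,1]² × [-1,1]^{(p+q)/2}} δ(y_1 + ⋯ + y_p) ∏ χ(x₀ + b ∑ y_i) ∏ χ(y₀ + s b ∑ y_i) dy₀ dx₀ dx`;
`f_I^-` is the case `s = 1` and `f_I^+` is the case `s = -1`. -/
def typeOne (p q : ℕ) (b s : ℝ) (π : Partition (p + q)) : ℝ :=
  ∫ t in Set.Icc (0 : ℝ) 1 ×ˢ Set.Icc (0 : ℝ) 1,
    deltaIntegral (halfSumCoeff π (epsSign π)) fun x =>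
      walkIndicator p q b s (unknowns π (epsSign π) x) t.1 t.2

/-- The integral of type II,
`∫_{[0,1]² × [-1,1]^{(p+q)/2-1}} ∏ χ(x₀ + b ∑ y_i) ∏ χ(y₀ + s b ∑ y_i) dy₀ dx₀ dx`;
`f_II^-` is the case `s = 1` and `f_II^+` is the case `s = -1`. -/
def typeTwo (p q : ℕ) (b s : ℝ) (π : Partition (p + q)) : ℝ :=
  ∫ t in Set.Icc (0 : ℝ) 1 ×ˢ Set.Icc (0 : ℝ) 1,
    ∫ x in Set.Icc (-1 : π.parts → ℝ) 1,
      walkIndicator p q b s (unknowns π (tauSign π) x) t.1 t.2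

/-! ### The limiting covariances -/

/-- The limiting covariance `σ_{p,q}`. Both sums are empty when `p + q` is odd. -/
def sigma (κ b : ℝ) (p q : ℕ) : ℝ :=
  (∑ π ∈ pairPartitions p q, (typeOne p q b 1 π + typeOne p q b (-1) π)) +
    (κ - 1) * ∑ π ∈ pairFourPartitions p q, (typeTwo p q b 1 π + typeTwo p q b (-1) π)

/-- The limiting variance `σ_Q² = ∑_{i,j=2}^p q_i q_j σ_{i,j}` for `Q(x) = ∑_{j=2}^p q_j x^j`. -/
def sigmaPoly (κ b : ℝ) (p : ℕ) (c : ℕ → ℝ) : ℝ :=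
  ∑ i ∈ Finset.Icc 2 p, ∑ j ∈ Finset.Icc 2 p, c i * c j * sigma κ b i j

/-- The polynomial `Q(x) = ∑_{j=2}^p q_j x^j`. -/
def testPoly (p : ℕ) (c : ℕ → ℝ) : Polynomial ℝ :=
  ∑ j ∈ Finset.Icc 2 p, Polynomial.C (c j) * Polynomial.X ^ j

end ToeplitzBand

end

/-! The proof is the method of moments. Write `w` for the bandwidth. Expanding the trace over closed
walks turns the rescaled fluctuation of the `p`-th power into a linear combination of centred
products of `p` variables `a_{|J_t|}`, indexed by the step words `J` with letters in `[-w, w]` and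
sum zero. The coefficient is `w^{(1-p)/2}` times the proportion of starting points from which the
walk stays in `[0, n)`. A joint moment of `r` such sums is therefore a sum over families `K` of `r`
words, with `|T|` letters in all and weights of order `w^{(r-|T|)/2}`.

Fix the signs of the letters and the coincidences among their absolute values. The distinct absolute
values then satisfy `r` linear relations with matrix `coef`, and the number of free parameters is
the number of values minus the rank. The families in `Degenerate` have fewer than `(|T|-r)/2` free
parameters, so by `card_degenerate_le` they contribute only `O(w^{-1/2})`. The remaining families
with a possibly non-zero moment are rigid. This is the combinatorial core,
`Regular.exists_saturated`: a double counting of letters, vertices (that is, words) and values gives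
the inequality opposite to non-degeneracy, so every local inequality in the count is an equality. It
follows that each word shares letters with exactly one other word (`Regular.neighbour_unique`). By
independence the mixed moments of non-degenerate families satisfy the Wick recursion exactly, and
after summation it holds up to `O(w^{-1/2})` (`Noise.exists_wick_bound`). With convergent
covariances all moments become Gaussian, and `tendstoInDistribution_of_moments` passes from moments
to laws through characteristic functions.

For the covariances the same rigidity is applied to two words. Either the relation of the first word
is trivial: one value then occurs twice in each word, all other values form opposite pairs inside
one word, and the moment is `κ - 1` (`Regular.mem_pairFour`). Or the relation is not trivial: every
value then occurs twice, the crossing values once in each word, and the moment is `1`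
(`Regular.mem_pair`). In the second case two crossing values would be forced to coincide, hence at
least three crossing pairs. The two relations are proportional with a factor `±1`, and this sign `s`
separates `f^-` from `f^+`.

For a fixed partition and sign, the sum over block values is a Riemann sum (`tendsto_sum_boxWords`),
with the proportion of admissible starting points converging to a length (`tendsto_stayCount`). In
type I one linear relation remains. Solving it for a block value with coefficient `1` is the
discrete counterpart of integrating out the Dirac function. In type II no relation remains. -/

namespace ToeplitzBand

set_option linter.unusedSectionVars false

/-! ### Families of words: linear relations, degeneracy and the saturated double count. -/

section Combinatorics

open Finset

variable {T ι : Type*} [Fintype T] [Fintype ι] [DecidableEq ι]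
  (vt : T → ι) (K : T → ℤ)

/-- The sum of the signs of the entries of absolute value `v` at the vertex `i`. -/
def coef (i : ι) (v : ℕ) : ℤ := ∑ t with vt t = i ∧ (K t).natAbs = v, (K t).sign

/-- The number of entries of absolute value `v` at the vertex `i`. -/
def mult (i : ι) (v : ℕ) : ℕ := #{t | vt t = i ∧ (K t).natAbs = v}

/-- The number of entries of absolute value `v`. -/
def tot (v : ℕ) : ℕ := #{t | (K t).natAbs = v}

/-- The absolute values of the entries. -/
def absValues : Finset ℕ := univ.image fun t => (K t).natAbs

/-- The entries at each vertex sum to zero. -/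
def ZeroSum : Prop := ∀ i, ∑ t with vt t = i, K t = 0

/-- The columns `v ∈ S` of the matrix `coef` are linearly independent. -/
def ColIndep (S : Finset ℕ) : Prop :=
  ∀ d : ℕ → ℤ, (∀ i, ∑ v ∈ S, coef vt K i v * d v = 0) → ∀ v ∈ S, d v = 0

/-- The entries satisfy more relations than the generic ones. -/
def Degenerate : Prop :=
  ∃ S ⊆ absValues K, ColIndep vt K S ∧
    2 * #(absValues K) + Fintype.card ι + 1 ≤ Fintype.card T + 2 * #S

variable {vt K}

lemma natAbs_mem_absValues (t : T) : (K t).natAbs ∈ absValues K :=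
  mem_image_of_mem _ (mem_univ t)

lemma tot_eq_sum_mult (v : ℕ) : tot K v = ∑ i, mult vt K i v := by
  rw [tot, card_eq_sum_card_fiberwise (f := vt) (t := univ) (by simp)]
  refine sum_congr rfl fun i _ => ?_
  rw [mult, filter_filter]
  simp only [and_comm]

lemma card_eq_sum_tot : Fintype.card T = ∑ v ∈ absValues K, tot K v := by
  rw [← card_univ, card_eq_sum_card_fiberwise (f := fun t => (K t).natAbs) (t := absValues K)
    (fun t _ => natAbs_mem_absValues t)]
  rfl

lemma mult_pos_of_coef_ne_zero {i : ι} {v : ℕ} (h : coef vt K i v ≠ 0) : 0 < mult vt K i v := by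
  rw [mult, card_pos]
  by_contra h'
  rw [not_nonempty_iff_eq_empty] at h'
  exact h (by rw [coef, h', sum_empty])

lemma exists_of_mult_pos {i : ι} {v : ℕ} (h : 0 < mult vt K i v) :
    ∃ t, vt t = i ∧ (K t).natAbs = v := by
  obtain ⟨t, ht⟩ := card_pos.1 h
  exact ⟨t, by simpa using ht⟩

lemma mult_pos (t : T) : 0 < mult vt K (vt t) (K t).natAbs :=
  card_pos.2 ⟨t, by simp⟩

lemma mem_absValues_of_mult_pos {i : ι} {v : ℕ} (h : 0 < mult vt K i v) : v ∈ absValues K := by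
  obtain ⟨t, -, rfl⟩ := exists_of_mult_pos h
  exact natAbs_mem_absValues t

lemma coef_of_mult_eq_one (h0 : ∀ t, K t ≠ 0) {i : ι} {v : ℕ} (h : mult vt K i v = 1) :
    coef vt K i v = 1 ∨ coef vt K i v = -1 := by
  obtain ⟨t, ht⟩ := card_eq_one.1 h
  rw [coef, ht, sum_singleton]
  rcases lt_or_gt_of_ne (h0 t) with h | h
  · right; exact Int.sign_eq_neg_one_of_neg h
  · left; exact Int.sign_eq_one_of_pos h

lemma sum_coef_mul (d : ℕ → ℤ) (i : ι) :
    ∑ v ∈ absValues K, coef vt K i v * d v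
      = ∑ t with vt t = i, (K t).sign * d (K t).natAbs := by
  rw [← sum_fiberwise_of_maps_to (g := fun t => (K t).natAbs) (t := absValues K)
    (fun t _ => natAbs_mem_absValues t)]
  refine sum_congr rfl fun v _ => ?_
  rw [coef, sum_mul, filter_filter]
  refine sum_congr rfl fun t ht => ?_
  rw [(mem_filter.1 ht).2.2]

/-- Writing each entry as sign times absolute value turns the zero-sum condition into a linear
relation between the distinct absolute values. -/
lemma ZeroSum.sum_coef (h : ZeroSum vt K) (i : ι) :
    ∑ v ∈ absValues K, coef vt K i v * (v : ℤ) = 0 := by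
  rw [sum_coef_mul, ← h i]
  exact sum_congr rfl fun t _ => Int.sign_mul_natAbs _

lemma ColIndep.empty : ColIndep vt K ∅ := fun _ _ _ h => absurd h (notMem_empty _)

/-- Row `i` sees only the new column, so it forces the new coefficient to vanish. Independent sets
are built in this triangular way. -/
lemma ColIndep.insert {S : Finset ℕ} (hS : ColIndep vt K S) {i : ι} {v : ℕ}
    (hv : coef vt K i v ≠ 0) (hi : ∀ u ∈ S, mult vt K i u = 0) :
    ColIndep vt K (insert v S) := by
  have hvS : v ∉ S := fun h => (mult_pos_of_coef_ne_zero hv).ne' (hi v h)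
  intro d hd
  have h0 : d v = 0 := by
    have h1 := hd i
    rw [sum_insert hvS, sum_eq_zero, add_zero] at h1
    · exact (mul_eq_zero.1 h1).resolve_left hv
    · intro u hu
      by_contra h2
      exact (mult_pos_of_coef_ne_zero (left_ne_zero_of_mul h2)).ne' (hi u hu)
  have h2 := hS d fun j => by
    have h1 := hd j
    rwa [sum_insert hvS, h0, mul_zero, zero_add] at h1
  intro u hu
  rcases mem_insert.1 hu with rfl | hu
  · exact h0
  · exact h2 u hu

lemma ColIndep.pair {i j : ι} {v w : ℕ} (hvw : v ≠ w)
    (h : coef vt K i v * coef vt K j w ≠ coef vt K i w * coef vt K j v) :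
    ColIndep vt K {v, w} := by
  intro d hd
  have h1 := hd i
  have h2 := hd j
  rw [sum_pair hvw] at h1 h2
  have h3 : coef vt K i v * coef vt K j w - coef vt K i w * coef vt K j v ≠ 0 := sub_ne_zero.2 h
  have hv : d v = 0 := (mul_eq_zero.1 (show (coef vt K i v * coef vt K j w
    - coef vt K i w * coef vt K j v) * d v = 0 by
      linear_combination coef vt K j w * h1 - coef vt K i w * h2)).resolve_left h3
  have hw : d w = 0 := (mul_eq_zero.1 (show (coef vt K i v * coef vt K j w
    - coef vt K i w * coef vt K j v) * d w = 0 by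
      linear_combination coef vt K i v * h2 - coef vt K j v * h1)).resolve_left h3
  intro u hu
  rcases mem_insert.1 hu with rfl | hu
  · exact hv
  · rw [mem_singleton.1 hu]; exact hw

variable (vt K) in
/-- A family of words, one for each vertex, that has the generic number of relations and may
contribute to a mixed moment. -/
structure Regular : Prop where
  ne_zero : ∀ t, K t ≠ 0
  zeroSum : ZeroSum vt K
  two_le : ∀ v ∈ absValues K, 2 ≤ tot K v
  shared : ∀ i, ∃ t t', vt t = i ∧ vt t' ≠ i ∧ (K t).natAbs = (K t').natAbs
  not_degenerate : ¬ Degenerate vt K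

variable (vt K) in
/-- The absolute value `v` occurs at two different vertices. -/
def Crosses (v : ℕ) : Prop := ∃ i j, i ≠ j ∧ 0 < mult vt K i v ∧ 0 < mult vt K j v

variable (vt K) in
/-- The relation at the vertex `i` is trivial. -/
def IsTrivialAt (i : ι) : Prop := ∀ v, coef vt K i v = 0

namespace Regular

variable (h : Regular vt K)
include h

lemma coef_ne_zero_of_mult {i : ι} {v : ℕ} (h1 : mult vt K i v = 1) : coef vt K i v ≠ 0 := by
  rcases coef_of_mult_eq_one h.ne_zero h1 with h2 | h2 <;> simp [h2]

open Classical in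
-- Each vertex touched by `v` carries an entry, and a trivial one carries at least two, because a
-- single entry would have coefficient `±1`. A crossing value touches at least two vertices.
lemma card_trivial_add_two_le {v : ℕ} (hv : Crosses vt K v) :
    #{i | IsTrivialAt vt K i ∧ 0 < mult vt K i v} + 2 ≤ tot K v := by
  obtain ⟨i, j, hij, hi, hj⟩ := hv
  have h2 : 2 ≤ #{i | 0 < mult vt K i v} := by
    rw [← card_pair hij]
    exact card_le_card (by intro k; simp only [mem_insert, mem_singleton]; rintro (rfl | rfl) <;> simpa)
  calc _ ≤ #{i | IsTrivialAt vt K i ∧ 0 < mult vt K i v} + #{i | 0 < mult vt K i v} := by omega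
    _ ≤ tot K v := by
      rw [tot_eq_sum_mult (vt := vt), card_filter, card_filter, ← sum_add_distrib]
      refine sum_le_sum fun k _ => ?_
      by_cases h1 : 0 < mult vt K k v
      · by_cases h3 : IsTrivialAt vt K k
        · have : mult vt K k v ≠ 1 := fun h4 => h.coef_ne_zero_of_mult h4 (h3 v)
          simp only [h1, h3]; simp; omega
        · simp [h3, h1]; omega
      · simp [h1]

open Classical in
/-- Every independent set of columns extends to one for which the weight inequality is an
equality vertex by vertex and block by block. -/
lemma exists_saturated {S₀ : Finset ℕ} (h0 : S₀ ⊆ absValues K) (hS₀ : ColIndep vt K S₀) :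
    ∃ S, S₀ ⊆ S ∧ S ⊆ absValues K ∧
      (∀ i, ∑ v ∈ S, mult vt K i v + (if IsTrivialAt vt K i then
        #{v ∈ absValues K \ S | Crosses vt K v ∧ 0 < mult vt K i v} else 0) = 1) ∧
      ∀ v ∈ absValues K \ S, tot K v = (if Crosses vt K v then
        #{i | IsTrivialAt vt K i ∧ 0 < mult vt K i v} else 0) + 2 := by
  let F : Finset (Finset ℕ) := {S ∈ (absValues K).powerset | S₀ ⊆ S ∧ ColIndep vt K S}
  obtain ⟨S, hSF, hmax⟩ := F.exists_max_image card ⟨S₀, by simp [F, h0, hS₀]⟩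
  obtain ⟨hSb, hSS, hSi⟩ : S ⊆ absValues K ∧ S₀ ⊆ S ∧ ColIndep vt K S := by simpa [F] using hSF
  -- By maximality of `S`: if `S` missed a non-trivial vertex, a live column there could be added
  -- with `ColIndep.insert`.
  have htouch : ∀ i, ¬ IsTrivialAt vt K i → 0 < ∑ v ∈ S, mult vt K i v := by
    intro i hi
    by_contra h1
    have h2 : ∀ v ∈ S, mult vt K i v = 0 := by
      intro v hv
      have := sum_eq_zero_iff.1 (Nat.eq_zero_of_not_pos h1) v hv
      exact this
    obtain ⟨v, hv⟩ := not_forall.1 hi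
    have hvS : v ∉ S := fun h3 => (mult_pos_of_coef_ne_zero hv).ne' (h2 v h3)
    have := hmax (insert v S) (by
      simp only [F, mem_filter, mem_powerset]
      exact ⟨insert_subset (mem_absValues_of_mult_pos (mult_pos_of_coef_ne_zero hv)) hSb,
        hSS.trans (subset_insert _ _), hSi.insert hv h2⟩)
    rw [card_insert_of_notMem hvS] at this
    omega
  refine ⟨S, hSS, hSb, ?_⟩
  -- The charge `g i` collects the entries at `i` with value in `S` and, at a trivial vertex, the
  -- crossing values outside `S` that touch it. The charge `r v` counts the same incidences from the
  -- side of the values, plus the two entries that every value has.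
  set g : ι → ℕ := fun i => ∑ v ∈ S, mult vt K i v + (if IsTrivialAt vt K i then
        #{v ∈ absValues K \ S | Crosses vt K v ∧ 0 < mult vt K i v} else 0) with hg
  set r : ℕ → ℕ := fun v => (if Crosses vt K v then
        #{i | IsTrivialAt vt K i ∧ 0 < mult vt K i v} else 0) + 2 with hr
  have hg1 : ∀ i ∈ univ, 1 ≤ g i := by
    intro i _
    by_cases hi : IsTrivialAt vt K i
    · obtain ⟨t, t', rfl, ht', htt⟩ := h.shared i
      by_cases hv : (K t).natAbs ∈ S
      · have := single_le_sum (f := fun v => mult vt K (vt t) v) (fun _ _ => Nat.zero_le _) hv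
        have h2 := mult_pos (vt := vt) (K := K) t
        simp only [hg]; omega
      · have : 0 < #{v ∈ absValues K \ S | Crosses vt K v ∧ 0 < mult vt K (vt t) v} := by
          refine card_pos.2 ⟨(K t).natAbs, ?_⟩
          simp only [mem_filter, Finset.mem_sdiff]
          refine ⟨⟨natAbs_mem_absValues t, hv⟩, ⟨vt t, vt t', ht'.symm, mult_pos t, ?_⟩, mult_pos t⟩
          rw [htt]; exact mult_pos t'
        simp only [hg, hi, if_true]; omega
    · have := htouch i hi
      simp only [hg]; omega
  have hr1 : ∀ v ∈ absValues K \ S, r v ≤ tot K v := by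
    intro v hv
    by_cases hc : Crosses vt K v
    · simp only [hr, hc, if_true]; exact h.card_trivial_add_two_le hc
    · simp only [hr, hc, if_false]; exact h.two_le v (Finset.mem_sdiff.1 hv).1
  -- Double counting of the pairs of a trivial vertex and a crossing value outside `S` touching it.
  have hsum : ∑ i, g i + ∑ v ∈ absValues K \ S, 2 = ∑ v ∈ S, tot K v + ∑ v ∈ absValues K \ S, r v := by
    simp only [hg, hr, sum_add_distrib]
    have e1 : ∑ i, ∑ v ∈ S, mult vt K i v = ∑ v ∈ S, tot K v := by
      rw [sum_comm]; exact sum_congr rfl fun v _ => (tot_eq_sum_mult v).symm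
    have e2 : (∑ i, if IsTrivialAt vt K i then
        #{v ∈ absValues K \ S | Crosses vt K v ∧ 0 < mult vt K i v} else 0)
        = ∑ v ∈ absValues K \ S, (if Crosses vt K v then
        #{i | IsTrivialAt vt K i ∧ 0 < mult vt K i v} else 0) := by
      simp only [card_filter]
      calc _ = ∑ i, ∑ v ∈ absValues K \ S, if IsTrivialAt vt K i ∧ Crosses vt K v ∧
              0 < mult vt K i v then 1 else 0 := by
            refine sum_congr rfl fun i _ => ?_
            by_cases hi : IsTrivialAt vt K i <;> simp [hi]
        _ = _ := by
            rw [sum_comm]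
            refine sum_congr rfl fun v _ => ?_
            by_cases hv : Crosses vt K v <;> simp [hv]
    rw [e1, e2]; ring
  have hcard : Fintype.card T = ∑ v ∈ S, tot K v + ∑ v ∈ absValues K \ S, tot K v := by
    rw [card_eq_sum_tot (K := K), add_comm, sum_sdiff hSb]
  -- Non-degeneracy tested on `S` bounds the number of letters from above, while `g ≥ 1` and `tot ≥
  -- r` bound it from below by the same quantity. Hence both are equalities termwise.
  have hnd : Fintype.card T + 2 * #S ≤ 2 * #(absValues K) + Fintype.card ι := by
    by_contra h1
    exact h.not_degenerate ⟨S, hSb, hSi, by omega⟩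
  have hc2 : ∑ v ∈ absValues K \ S, 2 + 2 * #S = 2 * #(absValues K) := by
    rw [sum_const, smul_eq_mul, card_sdiff_of_subset hSb]
    have := card_le_card hSb
    omega
  have hgs : ∑ i : ι, 1 ≤ ∑ i, g i := sum_le_sum hg1
  have hrs := sum_le_sum hr1
  have hι : ∑ i : ι, 1 = Fintype.card ι := by simp
  constructor
  · intro i
    exact ((sum_eq_sum_iff_of_le hg1).1 (by omega) i (mem_univ i)).symm
  · intro v hv
    exact ((sum_eq_sum_iff_of_le hr1).1 (by omega) v hv).symm

end Regular

end Combinatorics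

end ToeplitzBand

namespace ToeplitzBand

set_option linter.unusedSectionVars false

/-! ### The rigid structure of regular families. -/

section Structure

open Finset

variable {T ι : Type*} [Fintype T] [Fintype ι] [DecidableEq ι] {vt : T → ι} {K : T → ℤ}

lemma mult_eq_zero_of_not_crosses {v : ℕ} (hv : ¬ Crosses vt K v) {i : ι} (hi : 0 < mult vt K i v)
    {j : ι} (hj : j ≠ i) : mult vt K j v = 0 := by
  by_contra h1
  exact hv ⟨j, i, hj, Nat.pos_of_ne_zero h1, hi⟩

lemma Crosses.two_le_card {v : ℕ} (hv : Crosses vt K v) : 2 ≤ #{i | 0 < mult vt K i v} := by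
  obtain ⟨i, j, hij, hi, hj⟩ := hv
  rw [← card_pair hij]
  exact card_le_card (by intro k; simp only [mem_insert, mem_singleton]; rintro (rfl | rfl) <;> simpa)

namespace Regular

variable (h : Regular vt K)
include h

/-- A non-zero column alone is independent, so some saturated `S` contains `v`. The charge of `j` is
then `1` and includes all entries of value `v`. -/
lemma mult_le_one {i : ι} {v : ℕ} (hv : coef vt K i v ≠ 0) (j : ι) : mult vt K j v ≤ 1 := by
  have hvb := mem_absValues_of_mult_pos (mult_pos_of_coef_ne_zero hv)
  obtain ⟨S, hS, -, hg, -⟩ := h.exists_saturated (S₀ := {v}) (by simpa using hvb)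
    (by simpa using ColIndep.empty.insert hv (by simp))
  have := single_le_sum (f := fun v => mult vt K j v) (fun _ _ => Nat.zero_le _)
    (hS (mem_singleton_self v))
  have := hg j
  omega

lemma coef_ne_zero_of_live {i j : ι} {v : ℕ} (hv : coef vt K i v ≠ 0) (hj : 0 < mult vt K j v) :
    coef vt K j v ≠ 0 :=
  h.coef_ne_zero_of_mult (by have := h.mult_le_one hv j; omega)

lemma crosses_of_live {i : ι} {v : ℕ} (hv : coef vt K i v ≠ 0) : Crosses vt K v := by
  by_contra hc
  have hi := mult_pos_of_coef_ne_zero hv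
  have h2 := h.two_le v (mem_absValues_of_mult_pos hi)
  rw [tot_eq_sum_mult (vt := vt), sum_eq_single i
    (fun j _ hj => mult_eq_zero_of_not_crosses hc hi hj) (by simp)] at h2
  have := h.mult_le_one hv i
  omega

/-- With zero coefficients every touched vertex has at least two entries, so `v` lies outside `S`
and `tot` is at least twice the number `m` of touched vertices. Saturation gives `tot ≤ m + 2`,
while `m ≥ 2`; so `m = 2` and equality holds throughout. -/
lemma of_crosses_dead {v : ℕ} (hv : Crosses vt K v) (hd : ∀ i, coef vt K i v = 0) :
    tot K v = 4 ∧ #{i | 0 < mult vt K i v} = 2 ∧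
      ∀ i, 0 < mult vt K i v → mult vt K i v = 2 ∧ IsTrivialAt vt K i := by
  classical
  have hne : ∀ i, mult vt K i v ≠ 1 := fun i h1 => h.coef_ne_zero_of_mult h1 (hd i)
  obtain ⟨S, -, -, hg, ht⟩ := h.exists_saturated (S₀ := ∅) (by simp) ColIndep.empty
  have h2 := hv.two_le_card
  obtain ⟨i, -, -, hi, -⟩ := id hv
  have hvS : v ∉ S := by
    intro hvS
    have := single_le_sum (f := fun v => mult vt K i v) (fun _ _ => Nat.zero_le _) hvS
    have := hg i
    have := hne i
    omega
  have h3 := ht v (Finset.mem_sdiff.2 ⟨mem_absValues_of_mult_pos hi, hvS⟩)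
  rw [if_pos hv] at h3
  have hsub : ({i | IsTrivialAt vt K i ∧ 0 < mult vt K i v} : Finset ι)
      ⊆ ({i | 0 < mult vt K i v} : Finset ι) := by
    intro k; simp only [mem_filter]; tauto
  have h4 := card_le_card hsub
  have hle : ∀ i ∈ ({i | 0 < mult vt K i v} : Finset ι), 2 ≤ mult vt K i v := by
    intro k hk
    have := hne k
    have := (mem_filter.1 hk).2
    omega
  have h5 := sum_le_sum hle
  have h6 : ∑ i with 0 < mult vt K i v, mult vt K i v = tot K v := by
    rw [tot_eq_sum_mult (vt := vt), sum_filter]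
    refine sum_congr rfl fun k _ => ?_
    split_ifs <;> omega
  rw [sum_const, smul_eq_mul] at h5
  have hcard : #{i | 0 < mult vt K i v} = 2 := by omega
  refine ⟨by omega, hcard, fun k hk => ?_⟩
  have hk' : k ∈ ({i | 0 < mult vt K i v} : Finset ι) := by simpa using hk
  constructor
  · refine ((sum_eq_sum_iff_of_le hle).1 ?_ k hk').symm
    rw [sum_const, smul_eq_mul]; omega
  · rw [← eq_of_subset_of_card_le hsub (by omega)] at hk'
    exact (mem_filter.1 hk').2.1

/-- A live value crosses, so the coefficients vanish. The value is not in `S`, where its single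
vertex would get a charge of at least two; saturation outside `S` then leaves exactly two entries.
-/
lemma of_not_crosses {v : ℕ} (hv : v ∈ absValues K) (hc : ¬ Crosses vt K v) :
    tot K v = 2 ∧ ∀ i, coef vt K i v = 0 := by
  classical
  obtain ⟨S, -, -, hg, ht⟩ := h.exists_saturated (S₀ := ∅) (by simp) ColIndep.empty
  refine ⟨?_, fun i => by_contra fun h1 => hc (h.crosses_of_live h1)⟩
  have hvS : v ∉ S := by
    intro hvS
    obtain ⟨t, -, rfl⟩ := mem_image.1 hv
    have h2 := h.two_le _ hv
    rw [tot_eq_sum_mult (vt := vt), sum_eq_single (vt t)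
      (fun j _ hj => mult_eq_zero_of_not_crosses hc (mult_pos t) hj) (by simp)] at h2
    have := single_le_sum (f := fun v => mult vt K (vt t) v) (fun _ _ => Nat.zero_le _) hvS
    have := hg (vt t)
    omega
  simpa [hc] using ht v (Finset.mem_sdiff.2 ⟨hv, hvS⟩)

/-- No value at a trivial vertex lies in `S`, since it would occur there once and have coefficient
`±1`. So the charge `1` of the vertex counts exactly its crossing values. -/
lemma crosses_unique {i : ι} (hi : IsTrivialAt vt K i) {v w : ℕ}
    (hv : Crosses vt K v) (hw : Crosses vt K w) (hiv : 0 < mult vt K i v)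
    (hiw : 0 < mult vt K i w) : v = w := by
  classical
  obtain ⟨S, -, -, hg, -⟩ := h.exists_saturated (S₀ := ∅) (by simp) ColIndep.empty
  have key : ∀ u, 0 < mult vt K i u → u ∉ S := by
    intro u hu huS
    have := single_le_sum (f := fun v => mult vt K i v) (fun _ _ => Nat.zero_le _) huS
    have := hg i
    exact h.coef_ne_zero_of_mult (i := i) (v := u) (by omega) (hi u)
  have h1 := hg i
  rw [if_pos hi] at h1
  refine card_le_one.1 (show #{v ∈ absValues K \ S | Crosses vt K v ∧ 0 < mult vt K i v} ≤ 1 by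
    omega) v ?_ w ?_
  · simp [hv, hiv, key v hiv, mem_absValues_of_mult_pos hiv]
  · simp [hw, hiw, key w hiw, mem_absValues_of_mult_pos hiw]

/-- A relation with a single non-zero coefficient would force `v = 0`, but the entries are non-zero.
-/
lemma exists_other_live {i : ι} {v : ℕ} (hv : coef vt K i v ≠ 0) :
    ∃ w, w ≠ v ∧ coef vt K i w ≠ 0 := by
  by_contra! hw
  have h1 := h.zeroSum.sum_coef i
  rw [sum_eq_single v (fun w _ hwv => by rw [hw w hwv, zero_mul])
    (fun h2 => absurd (mem_absValues_of_mult_pos (mult_pos_of_coef_ne_zero hv)) h2)] at h1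
  obtain ⟨t, -, ht⟩ := exists_of_mult_pos (mult_pos_of_coef_ne_zero hv)
  have := h.ne_zero t
  rcases mul_eq_zero.1 h1 with h2 | h2
  · exact hv h2
  · omega

/-- If independent, both columns could be put into a saturated `S`, giving the vertex `i` a charge
of at least two. -/
lemma not_colIndep {i : ι} {v w : ℕ} (hvw : v ≠ w) (hv : coef vt K i v ≠ 0)
    (hw : coef vt K i w ≠ 0) : ¬ ColIndep vt K {v, w} := by
  intro hc
  have hmv := mult_pos_of_coef_ne_zero hv
  have hmw := mult_pos_of_coef_ne_zero hw
  obtain ⟨S, hS, -, hg, -⟩ := h.exists_saturated (S₀ := {v, w}) (by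
    intro u; simp only [mem_insert, mem_singleton]
    rintro (rfl | rfl)
    · exact mem_absValues_of_mult_pos hmv
    · exact mem_absValues_of_mult_pos hmw) hc
  have := sum_le_sum_of_subset (f := fun v => mult vt K i v) hS
  rw [sum_pair hvw] at this
  have := hg i
  omega

/-- The columns are dependent, so the `2 × 2` minors vanish. For two words this makes the two
relations proportional and yields one common sign for all crossing pairs. -/
lemma coef_mul_coef {i j : ι} {v w : ℕ} (hv : coef vt K i v ≠ 0) (hw : coef vt K i w ≠ 0) :
    coef vt K i v * coef vt K j w = coef vt K i w * coef vt K j v := by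
  by_cases hvw : v = w
  · rw [hvw]
  · by_contra h1
    exact h.not_colIndep hvw hv hw (ColIndep.pair hvw h1)

/-- If `v` missed `j`, then `w`, live at `j`, would be independent of `v`. Values live at a common
vertex thus touch the same vertices. -/
lemma mult_pos_of_live {i j : ι} {v w : ℕ} (hv : coef vt K i v ≠ 0) (hw : coef vt K i w ≠ 0)
    (hj : 0 < mult vt K j w) : 0 < mult vt K j v := by
  by_contra h1
  have h2 : v ≠ w := by rintro rfl; exact h1 hj
  have h3 := h.coef_ne_zero_of_live hw hj
  refine h.not_colIndep h2 hv hw ?_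
  rw [pair_comm]
  have h4 : ColIndep vt K {v} := by simpa using ColIndep.empty.insert hv (by simp)
  exact h4.insert h3 (by simpa using h1)

/-- Saturate around another value `w` live at `i`: then `v` is outside `S`, and no vertex it touches
is trivial, so only the constant `2` remains. -/
lemma tot_of_live {i : ι} {v : ℕ} (hv : coef vt K i v ≠ 0) : tot K v = 2 := by
  classical
  obtain ⟨w, hwv, hw⟩ := h.exists_other_live hv
  have hmv := mult_pos_of_coef_ne_zero hv
  have hmw := mult_pos_of_coef_ne_zero hw
  obtain ⟨S, hS, -, hg, ht⟩ := h.exists_saturated (S₀ := {w})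
    (by simpa using mem_absValues_of_mult_pos hmw)
    (by simpa using ColIndep.empty.insert hw (by simp))
  have hvS : v ∉ S := by
    intro hvS
    have := sum_le_sum_of_subset (f := fun v => mult vt K i v)
      (show {v, w} ⊆ S by intro u; simp only [mem_insert, mem_singleton]; rintro (rfl | rfl);
                          exacts [hvS, hS (mem_singleton_self _)])
    rw [sum_pair hwv.symm] at this
    have := hg i
    omega
  rw [ht v (Finset.mem_sdiff.2 ⟨mem_absValues_of_mult_pos hmv, hvS⟩)]
  rw [if_pos (h.crosses_of_live hv), Nat.add_eq_right, card_eq_zero, filter_eq_empty_iff]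
  rintro j - ⟨hj, hj'⟩
  exact h.coef_ne_zero_of_live hv hj' (hj v)

lemma card_touch {v : ℕ} (hv : Crosses vt K v) : #{i | 0 < mult vt K i v} = 2 := by
  by_cases hd : ∀ i, coef vt K i v = 0
  · exact (h.of_crosses_dead hv hd).2.1
  · obtain ⟨i, hi⟩ := not_forall.1 hd
    refine le_antisymm ?_ hv.two_le_card
    rw [← h.tot_of_live hi, tot_eq_sum_mult (vt := vt), card_filter]
    refine sum_le_sum fun k _ => ?_
    split_ifs <;> omega

lemma live_of_crosses {i : ι} (hi : ¬ IsTrivialAt vt K i) {v : ℕ} (hv : Crosses vt K v)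
    (hiv : 0 < mult vt K i v) : coef vt K i v ≠ 0 := by
  by_cases hd : ∀ i, coef vt K i v = 0
  · exact absurd ((h.of_crosses_dead hv hd).2.2 i hiv).2 hi
  · obtain ⟨j, hj⟩ := not_forall.1 hd
    exact h.coef_ne_zero_of_live hj hiv

/-- Each vertex shares an absolute value with exactly one other vertex. -/
lemma neighbour_unique {s s' t t' : T} (hs : vt s ≠ vt s') (ht : vt t ≠ vt t') (hst : vt s = vt t)
    (hs' : (K s).natAbs = (K s').natAbs) (ht' : (K t).natAbs = (K t').natAbs) : vt s' = vt t' := by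
  have hm1 := mult_pos (vt := vt) (K := K) s
  have hm2 := mult_pos (vt := vt) (K := K) s'
  have hm3 := mult_pos (vt := vt) (K := K) t
  have hm4 := mult_pos (vt := vt) (K := K) t'
  rw [← hst] at hm3
  rw [← hs'] at hm2
  rw [← ht'] at hm4
  have hc1 : Crosses vt K (K s).natAbs := ⟨_, _, hs, hm1, hm2⟩
  have hc2 : Crosses vt K (K t).natAbs := ⟨_, _, hst ▸ ht, hm3, hm4⟩
  -- The value shared by `s` and `s'` also occurs at the vertex of `t'`: a trivial vertex has only
  -- one crossing value, and at a non-trivial one both crossing values are live. Since a crossing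
  -- value touches two vertices only, the two neighbours coincide.
  have hm5 : 0 < mult vt K (vt t') (K s).natAbs := by
    by_cases hi : IsTrivialAt vt K (vt s)
    · rw [h.crosses_unique hi hc1 hc2 hm1 hm3]; exact hm4
    · exact h.mult_pos_of_live (h.live_of_crosses hi hc1 hm1) (h.live_of_crosses hi hc2 hm3) hm4
  by_contra hne
  have h3 : #({vt s, vt s', vt t'} : Finset ι) = 3 := by
    rw [card_eq_three]
    exact ⟨_, _, _, hs, hst ▸ ht, hne, rfl⟩
  have h4 : ({vt s, vt s', vt t'} : Finset ι) ⊆ ({i | 0 < mult vt K i (K s).natAbs} : Finset ι) := by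
    intro k
    simp only [mem_insert, mem_singleton]
    rintro (rfl | rfl | rfl) <;> simpa
  have := card_le_card h4
  rw [h3, h.card_touch hc1] at this
  omega

end Regular

end Structure

end ToeplitzBand

noncomputable section

namespace ToeplitzBand

set_option linter.unusedSectionVars false

/-! ### Counting degenerate families. -/

section Counting

open Finset

variable {T ι : Type*} [Fintype T] [Fintype ι] [DecidableEq ι] {vt : T → ι}

/-- Words with the same signs and the same coincidences of absolute values. -/
def SameType (K K' : T → ℤ) : Prop :=
  (∀ t, (K t).sign = (K' t).sign) ∧
    ∀ s t, (K s).natAbs = (K t).natAbs ↔ (K' s).natAbs = (K' t).natAbs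

/-- The differences `d` of the absolute values satisfy the relations of `K₀`. If they vanish outside
`S`, independence of the columns in `S` makes them vanish everywhere: the values in `S` are
determined by the others. -/
lemma eq_of_sameType {K₀ K K' : T → ℤ} {S : Finset ℕ} (hS : S ⊆ absValues K₀)
    (hSi : ColIndep vt K₀ S) (hK : SameType K K₀) (hK' : SameType K' K₀) (hz : ZeroSum vt K)
    (hz' : ZeroSum vt K') (rep : ℕ → T) (hrep : ∀ v ∈ absValues K₀, (K₀ (rep v)).natAbs = v)
    (heq : ∀ v ∈ absValues K₀ \ S, K (rep v) = K' (rep v)) : K = K' := by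
  classical
  set d : ℕ → ℤ := fun v => ((K (rep v)).natAbs : ℤ) - (K' (rep v)).natAbs with hd
  have key : ∀ t, K t - K' t = (K₀ t).sign * d (K₀ t).natAbs := by
    intro t
    have h1 : (K₀ (rep (K₀ t).natAbs)).natAbs = (K₀ t).natAbs := hrep _ (natAbs_mem_absValues t)
    have h2 := (hK.2 _ _).2 h1
    have h3 := (hK'.2 _ _).2 h1
    simp only [hd]
    rw [h2, h3, mul_sub]
    nth_rw 1 [← hK.1 t]
    rw [← hK'.1 t, Int.sign_mul_natAbs, Int.sign_mul_natAbs]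
  have h0 : ∀ v ∈ absValues K₀ \ S, d v = 0 := by
    intro v hv
    simp only [hd, heq v hv, sub_self]
  have hS0 : ∀ v ∈ S, d v = 0 := by
    refine hSi d fun i => ?_
    have h1 : ∑ v ∈ absValues K₀, coef vt K₀ i v * d v = 0 := by
      rw [sum_coef_mul, sum_congr rfl fun t _ => (key t).symm, sum_sub_distrib, hz i, hz' i,
        sub_zero]
    rwa [← sum_sdiff hS, sum_eq_zero, zero_add] at h1
    intro v hv
    rw [h0 v hv, mul_zero]
  funext t
  have h1 : d (K₀ t).natAbs = 0 := by
    by_cases h : (K₀ t).natAbs ∈ S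
    · exact hS0 _ h
    · exact h0 _ (Finset.mem_sdiff.2 ⟨natAbs_mem_absValues t, h⟩)
  have := key t
  rw [h1, mul_zero] at this
  exact sub_eq_zero.1 this

/-- The finitely many invariants of a word under `SameType`. -/
def wordType (K : T → ℤ) : (T → SignType) × (T → T → Bool) :=
  (fun t => SignType.sign (K t), fun s t => decide ((K s).natAbs = (K t).natAbs))

lemma sameType_of_wordType_eq {K K' : T → ℤ} (h : wordType K = wordType K') : SameType K K' := by
  simp only [wordType, Prod.mk.injEq, funext_iff, decide_eq_decide] at h
  exact ⟨fun t => by rw [Int.sign_eq_sign, Int.sign_eq_sign, h.1 t], h.2⟩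

/-- The words with entries in `[-w, w]`. -/
def boxWords (T : Type*) [Fintype T] [DecidableEq T] (w : ℕ) : Finset (T → ℤ) :=
  Fintype.piFinset fun _ => Icc (-(w : ℤ)) w

open Classical in
-- A word is determined by one representative letter for each value outside `S`, so the exponent is
-- the number of those values. Degeneracy is exactly the stated bound on it.
lemma card_sameType_le [DecidableEq T] (vt : T → ι) (w : ℕ) (K₀ : T → ℤ)
    (hd : Degenerate vt K₀) :
    ∃ e : ℕ, 2 * e + Fintype.card ι + 1 ≤ Fintype.card T ∧
      #{K ∈ boxWords T w | ZeroSum vt K ∧ SameType K K₀} ≤ (2 * w + 1) ^ e := by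
  obtain ⟨S, hS, hSi, hcard⟩ := hd
  have hle := card_le_card hS
  refine ⟨#(absValues K₀ \ S), by rw [card_sdiff_of_subset hS]; omega, ?_⟩
  by_cases hT : Nonempty T
  swap
  · rw [not_nonempty_iff] at hT
    refine (card_le_one.2 fun a _ b _ => Subsingleton.elim a b).trans ?_
    exact Nat.one_le_pow _ _ (by omega)
  have hex : ∀ v, ∃ t, v ∈ absValues K₀ → (K₀ t).natAbs = v := by
    intro v
    by_cases hv : v ∈ absValues K₀
    · obtain ⟨t, -, ht⟩ := mem_image.1 hv
      exact ⟨t, fun _ => ht⟩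
    · exact ⟨hT.some, fun h => absurd h hv⟩
  choose rep hrep using hex
  have : (2 * w + 1) ^ #(absValues K₀ \ S)
      = #(boxWords ↥(absValues K₀ \ S) w) := by
    rw [boxWords, Fintype.card_piFinset]
    simp only [Int.card_Icc, prod_const, card_univ, Fintype.card_coe]
    congr 1
    omega
  rw [this]
  refine card_le_card_of_injOn (fun K v => K (rep v)) ?_ ?_
  · intro K hK
    simp only [boxWords, coe_filter, Fintype.mem_piFinset, Set.mem_ofPred_eq, mem_coe] at hK ⊢
    exact fun v => hK.1 _
  · intro K hK K' hK' heq
    simp only [coe_filter, Set.mem_ofPred_eq] at hK hK'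
    exact eq_of_sameType hS hSi hK.2.2 hK'.2.2 hK.2.1 hK'.2.1 rep hrep
      fun v hv => congrFun heq ⟨v, hv⟩

open Classical in
-- There are finitely many types, independently of `w`, and each is counted by `card_sameType_le`
-- with `2w + 1 ≤ 3w`. Powers of `√w` are used since `|T| - |ι|` may be odd.
lemma card_degenerate_le [DecidableEq T] (vt : T → ι) :
    ∃ C : ℝ, 0 ≤ C ∧ ∀ w : ℕ, 1 ≤ w →
      (#{K ∈ boxWords T w | ZeroSum vt K ∧ Degenerate vt K} : ℝ) * √(w : ℝ) ^ (Fintype.card ι + 1)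
        ≤ C * √(w : ℝ) ^ Fintype.card T := by
  refine ⟨3 ^ Fintype.card T * Fintype.card ((T → SignType) × (T → T → Bool)), by positivity, ?_⟩
  intro w hw
  have hw1 : (1 : ℝ) ≤ w := by exact_mod_cast hw
  have hs1 : 1 ≤ √(w : ℝ) := by rw [Real.one_le_sqrt]; exact hw1
  set D := {K ∈ boxWords T w | ZeroSum vt K ∧ Degenerate vt K} with hD
  rw [← card_univ (α := (T → SignType) × (T → T → Bool)),
    card_eq_sum_card_fiberwise (f := wordType) (s := D) (t := univ) (by simp)]
  push_cast
  rw [sum_mul, mul_comm (3 ^ Fintype.card T : ℝ), mul_assoc, ← nsmul_eq_mul, ← sum_const]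
  refine sum_le_sum fun τ _ => ?_
  by_cases hne : ({K ∈ D | wordType K = τ}).Nonempty
  · obtain ⟨K₀, hK₀⟩ := hne
    obtain ⟨hK₀D, rfl⟩ := mem_filter.1 hK₀
    obtain ⟨e, he, hc⟩ := card_sameType_le vt w K₀ (mem_filter.1 hK₀D).2.2
    have h1 : #{K ∈ D | wordType K = wordType K₀} ≤ (2 * w + 1) ^ e := by
      refine (card_le_card ?_).trans hc
      intro K hK
      simp only [hD, mem_filter] at hK ⊢
      exact ⟨hK.1.1, hK.1.2.1, sameType_of_wordType_eq hK.2⟩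
    have h2 : (#{K ∈ D | wordType K = wordType K₀} : ℝ) ≤ (3 * w) ^ e := by
      calc (#{K ∈ D | wordType K = wordType K₀} : ℝ) ≤ ((2 * w + 1) ^ e : ℕ) := by exact_mod_cast h1
        _ = (2 * w + 1 : ℝ) ^ e := by push_cast; rfl
        _ ≤ (3 * w) ^ e := by gcongr; linarith
    calc (#{K ∈ D | wordType K = wordType K₀} : ℝ) * √(w : ℝ) ^ (Fintype.card ι + 1)
        ≤ (3 * w) ^ e * √(w : ℝ) ^ (Fintype.card ι + 1) := by gcongr
      _ = 3 ^ e * √(w : ℝ) ^ (2 * e + Fintype.card ι + 1) := by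
        rw [mul_pow, add_assoc, pow_add _ (2 * e), pow_mul, Real.sq_sqrt (by positivity)]; ring
      _ ≤ 3 ^ Fintype.card T * √(w : ℝ) ^ Fintype.card T := by
        gcongr
        · norm_num
        · omega
  · rw [not_nonempty_iff_eq_empty.1 hne]
    simp only [card_empty, Nat.cast_zero, zero_mul]
    positivity

end Counting

end ToeplitzBand

end

noncomputable section

namespace ToeplitzBand

set_option linter.unusedSectionVars false

/-! ### Independent variables and the mixed moments of centred words. -/

section Noise

open Finset

variable {Ω : Type*} [MeasurableSpace Ω] {P : Measure Ω} [IsProbabilityMeasure P]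

/-- A sequence of independent centred random variables with uniformly bounded moments, the one
with index `0` being zero. -/
structure Noise (P : Measure Ω) (A : ℕ → Ω → ℝ) : Prop where
  meas : ∀ v, Measurable (A v)
  indep : iIndepFun A P
  zero : ∀ ω, A 0 ω = 0
  mean : ∀ v, ∫ ω, A v ω ∂P = 0
  moment : ∀ k : ℕ, ∃ C : ℝ, ∀ v, Integrable (fun ω => |A v ω| ^ k) P ∧ ∫ ω, |A v ω| ^ k ∂P ≤ C

variable {A : ℕ → Ω → ℝ} (hA : Noise P A)

variable {T ι : Type*} [Fintype T] [Fintype ι] [DecidableEq ι] (vt : T → ι) (K : T → ℤ)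

include hA in
lemma Noise.integral_mul_of_disjoint {S S' : Finset ℕ} (hS : Disjoint S S')
    {F G : (ℕ → ℝ) → ℝ} (hF : Measurable F) (hG : Measurable G) (hFS : DependsOn F S)
    (hGS : DependsOn G S') :
    ∫ ω, F (fun v => A v ω) * G (fun v => A v ω) ∂P
      = (∫ ω, F (fun v => A v ω) ∂P) * ∫ ω, G (fun v => A v ω) ∂P := by
  -- Padding by zero turns a functional depending only on the coordinates in `R` into a function of
  -- finitely many variables, to which independence of the two finite subfamilies applies.
  let ext : ∀ R : Finset ℕ, (R → ℝ) → ℕ → ℝ := fun R y v => if h : v ∈ R then y ⟨v, h⟩ else 0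
  have hext : ∀ R, Measurable (ext R) := by
    intro R
    refine measurable_pi_lambda _ fun v => ?_
    by_cases h : v ∈ R
    · simp only [ext, h, dif_pos]; exact measurable_pi_apply _
    · simp only [ext, h, dif_neg, not_false_eq_true]; exact measurable_const
  have hi := hA.indep.indepFun_finset S S' hS hA.meas
  have eF : ∀ ω, F (fun v => A v ω) = (F ∘ ext S) (fun i : S => A i ω) := by
    intro ω
    exact hFS fun v hv => by simp only [ext]; rw [dif_pos (by simpa using hv)]
  have eG : ∀ ω, G (fun v => A v ω) = (G ∘ ext S') (fun i : S' => A i ω) := by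
    intro ω
    exact hGS fun v hv => by simp only [ext]; rw [dif_pos (by simpa using hv)]
  simp_rw [eF, eG]
  exact hi.integral_fun_comp_mul_comp
    (measurable_pi_lambda _ fun i => hA.meas _).aemeasurable
    (measurable_pi_lambda _ fun i => hA.meas _).aemeasurable
    (hF.comp (hext S)).aestronglyMeasurable (hG.comp (hext S')).aestronglyMeasurable

/-- The product of the entries at the vertex `i`. -/
def wordProd (A : ℕ → Ω → ℝ) (i : ι) (ω : Ω) : ℝ := ∏ t with vt t = i, A (K t).natAbs ω

/-- The centred product of the entries at the vertex `i`. -/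
def centredWord (P : Measure Ω) (A : ℕ → Ω → ℝ) (i : ι) (ω : Ω) : ℝ :=
  wordProd vt K A i ω - ∫ ω', wordProd vt K A i ω' ∂P

/-- The mixed moment of the centred words at the vertices in `U`. -/
def mixedMoment (P : Measure Ω) (A : ℕ → Ω → ℝ) (U : Finset ι) : ℝ :=
  ∫ ω, ∏ i ∈ U, centredWord vt K P A i ω ∂P

variable {vt K}

lemma prod_abs_le_pow {s : Finset T} (x : T → ℝ) :
    ∏ t ∈ s, |x t| ≤ (1 + ∑ t, |x t|) ^ Fintype.card T := by
  have h1 : ∀ t, |x t| ≤ 1 + ∑ t, |x t| := fun t => by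
    have := single_le_sum (f := fun t => |x t|) (fun _ _ => abs_nonneg _) (mem_univ t)
    linarith
  have h0 : 1 ≤ 1 + ∑ t, |x t| := by
    have := sum_nonneg (s := univ) fun t _ => abs_nonneg (x t)
    linarith
  calc ∏ t ∈ s, |x t| ≤ ∏ t ∈ s, (1 + ∑ t, |x t|) :=
        prod_le_prod (fun _ _ => abs_nonneg _) fun t _ => h1 t
    _ = (1 + ∑ t, |x t|) ^ #s := by rw [prod_const]
    _ ≤ _ := pow_le_pow_right₀ h0 (card_le_univ s)

/-- Both sides are compared with the power of the largest of `1` and the `|x t|`; the extra point of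
`Option T` stands for the `1`. -/
lemma one_add_sum_pow_le (x : T → ℝ) (k : ℕ) :
    (1 + ∑ t, |x t|) ^ k ≤ (1 + Fintype.card T) ^ k * (1 + ∑ t, |x t| ^ k) := by
  obtain ⟨o, ho⟩ := Finite.exists_max (fun o : Option T => o.elim 1 fun t => |x t|)
  set m := o.elim 1 fun t => |x t| with hm
  have h1 : (1 : ℝ) ≤ m := ho none
  have h2 : ∀ t, |x t| ≤ m := fun t => ho (some t)
  have h3 : 1 + ∑ t, |x t| ≤ (1 + Fintype.card T) * m := by
    have : ∑ t, |x t| ≤ ∑ _t : T, m := sum_le_sum fun t _ => h2 t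
    rw [sum_const, card_univ, nsmul_eq_mul] at this
    nlinarith
  have h4 : m ^ k ≤ 1 + ∑ t, |x t| ^ k := by
    have hn := sum_nonneg (s := univ) fun t _ => pow_nonneg (abs_nonneg (x t)) k
    cases o with
    | none => simp only [hm, Option.elim]; rw [one_pow]; linarith
    | some t =>
      have := single_le_sum (f := fun t => |x t| ^ k) (fun _ _ => pow_nonneg (abs_nonneg _) k)
        (mem_univ t)
      simp only [hm, Option.elim]
      linarith
  calc (1 + ∑ t, |x t|) ^ k ≤ ((1 + Fintype.card T) * m) ^ k := by
        refine pow_le_pow_left₀ ?_ h3 k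
        have := sum_nonneg (s := univ) fun t _ => abs_nonneg (x t)
        linarith
    _ = (1 + Fintype.card T) ^ k * m ^ k := mul_pow _ _ _
    _ ≤ _ := by gcongr

include hA in
variable (T) in
lemma Noise.exists_bound (k : ℕ) : ∃ C : ℝ, 0 ≤ C ∧ ∀ K : T → ℤ,
    Integrable (fun ω => (1 + ∑ t, |A (K t).natAbs ω|) ^ k) P ∧
    ∫ ω, (1 + ∑ t, |A (K t).natAbs ω|) ^ k ∂P ≤ C := by
  obtain ⟨C, hC⟩ := hA.moment k
  have hC0 : 0 ≤ C := (integral_nonneg fun ω => by positivity).trans (hC 0).2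
  refine ⟨(1 + Fintype.card T) ^ k * (1 + Fintype.card T * C), by positivity, fun K => ?_⟩
  have hi : Integrable (fun ω => (1 + Fintype.card T : ℝ) ^ k *
      (1 + ∑ t, |A (K t).natAbs ω| ^ k)) P :=
    ((integrable_const _).add (integrable_finsetSum _ fun t _ => (hC _).1)).const_mul _
  have hm : Measurable (fun ω => (1 + ∑ t, |A (K t).natAbs ω|) ^ k) := by
    have := hA.meas
    fun_prop
  have hle : ∀ ω, (1 + ∑ t, |A (K t).natAbs ω|) ^ k ≤ (1 + Fintype.card T : ℝ) ^ k *
      (1 + ∑ t, |A (K t).natAbs ω| ^ k) := fun ω => one_add_sum_pow_le _ k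
  have h1 : Integrable (fun ω => (1 + ∑ t, |A (K t).natAbs ω|) ^ k) P := by
    refine hi.mono' hm.aestronglyMeasurable (ae_of_all _ fun ω => ?_)
    rw [Real.norm_of_nonneg (by positivity)]
    exact hle ω
  refine ⟨h1, (integral_mono h1 hi hle).trans ?_⟩
  rw [integral_const_mul, integral_add (integrable_const _)
    (integrable_finsetSum _ fun t _ => (hC _).1), integral_finsetSum _ fun t _ => (hC _).1]
  simp only [integral_const, probReal_univ, smul_eq_mul, mul_one]
  gcongr
  calc _ ≤ ∑ _t : T, C := sum_le_sum fun t _ => (hC _).2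
    _ = _ := by rw [sum_const, card_univ, nsmul_eq_mul]

include hA in
lemma Noise.measurable_wordProd (i : ι) : Measurable (wordProd vt K A i) := by
  have := hA.meas
  unfold wordProd
  fun_prop

include hA in
lemma Noise.integrable_wordProd (i : ι) : Integrable (wordProd vt K A i) P := by
  obtain ⟨C, -, hC⟩ := hA.exists_bound T (Fintype.card T)
  refine (hC K).1.mono' (hA.measurable_wordProd i).aestronglyMeasurable (ae_of_all _ fun ω => ?_)
  rw [wordProd, Real.norm_eq_abs, abs_prod]
  exact prod_abs_le_pow _

include hA in
variable (vt) in
-- Uniformity in `K` is the point: the set of words grows with the bandwidth, and only the number of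
-- letters and of vertices enters the constant.
lemma Noise.exists_mixedMoment_bound : ∃ C : ℝ, 0 ≤ C ∧ ∀ (K : T → ℤ) (U : Finset ι),
    Integrable (fun ω => ∏ i ∈ U, centredWord vt K P A i ω) P ∧
    |mixedMoment vt K P A U| ≤ C := by
  obtain ⟨C₁, hC₁0, hC₁⟩ := hA.exists_bound T (Fintype.card T)
  obtain ⟨C₂, hC₂0, hC₂⟩ := hA.exists_bound T (Fintype.card T * Fintype.card ι)
  refine ⟨(1 + C₁) ^ Fintype.card ι * C₂, by positivity, fun K U => ?_⟩
  have hw : ∀ i ω, |wordProd vt K A i ω| ≤ (1 + ∑ t, |A (K t).natAbs ω|) ^ Fintype.card T := by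
    intro i ω
    rw [wordProd, abs_prod]
    exact prod_abs_le_pow _
  have hM : ∀ ω, 1 ≤ 1 + ∑ t, |A (K t).natAbs ω| := fun ω => by
    have := sum_nonneg (s := univ) fun t _ => abs_nonneg (A (K t).natAbs ω)
    linarith
  have hc : ∀ i ω, |centredWord vt K P A i ω| ≤
      (1 + C₁) * (1 + ∑ t, |A (K t).natAbs ω|) ^ Fintype.card T := by
    intro i ω
    have h1 : |∫ ω', wordProd vt K A i ω' ∂P| ≤ C₁ := by
      refine (abs_integral_le_integral_abs).trans (le_trans ?_ (hC₁ K).2)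
      exact integral_mono (hA.integrable_wordProd i).abs (hC₁ K).1 fun ω => hw i ω
    have h2 := one_le_pow₀ (n := Fintype.card T) (hM ω)
    have h3 := abs_sub (wordProd vt K A i ω) (∫ ω', wordProd vt K A i ω' ∂P)
    have h4 := hw i ω
    rw [centredWord]
    nlinarith
  have hp : ∀ ω, ‖∏ i ∈ U, centredWord vt K P A i ω‖ ≤ (1 + C₁) ^ Fintype.card ι *
      (1 + ∑ t, |A (K t).natAbs ω|) ^ (Fintype.card T * Fintype.card ι) := by
    intro ω
    rw [Real.norm_eq_abs, abs_prod]
    calc _ ≤ ∏ i ∈ U, ((1 + C₁) * (1 + ∑ t, |A (K t).natAbs ω|) ^ Fintype.card T) :=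
          prod_le_prod (fun _ _ => abs_nonneg _) fun i _ => hc i ω
      _ = ((1 + C₁) * (1 + ∑ t, |A (K t).natAbs ω|) ^ Fintype.card T) ^ #U := prod_const _
      _ ≤ ((1 + C₁) * (1 + ∑ t, |A (K t).natAbs ω|) ^ Fintype.card T) ^ Fintype.card ι := by
        refine pow_le_pow_right₀ ?_ (card_le_univ U)
        have h2 := one_le_pow₀ (n := Fintype.card T) (hM ω)
        nlinarith
      _ = _ := by rw [mul_pow, pow_mul]
  have hmeas : Measurable (fun ω => ∏ i ∈ U, centredWord vt K P A i ω) := by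
    refine Finset.measurable_fun_prod _ fun i _ => ?_
    exact (hA.measurable_wordProd i).sub_const _
  have hdom : Integrable (fun ω => (1 + C₁) ^ Fintype.card ι *
      (1 + ∑ t, |A (K t).natAbs ω|) ^ (Fintype.card T * Fintype.card ι)) P := (hC₂ K).1.const_mul _
  refine ⟨hdom.mono' hmeas.aestronglyMeasurable (ae_of_all _ hp), ?_⟩
  rw [mixedMoment, ← Real.norm_eq_abs]
  refine (norm_integral_le_of_norm_le hdom (ae_of_all _ hp)).trans ?_
  rw [integral_const_mul]
  exact mul_le_mul_of_nonneg_left (hC₂ K).2 (by positivity)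

lemma mixedMoment_empty : mixedMoment vt K P A ∅ = 1 := by simp [mixedMoment]

include hA in
lemma Noise.mixedMoment_singleton (i : ι) : mixedMoment vt K P A {i} = 0 := by
  simp only [mixedMoment, prod_singleton, centredWord]
  rw [integral_sub (hA.integrable_wordProd i) (integrable_const _)]
  simp

include hA in
lemma Noise.mixedMoment_union {U U' : Finset ι} (hd : Disjoint U U')
    (hsh : ∀ t t', vt t ∈ U → vt t' ∈ U' → (K t).natAbs ≠ (K t').natAbs) :
    mixedMoment vt K P A (U ∪ U') = mixedMoment vt K P A U * mixedMoment vt K P A U' := by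
  let F : Finset ι → (ℕ → ℝ) → ℝ := fun U x =>
    ∏ i ∈ U, (∏ t with vt t = i, x (K t).natAbs - ∫ ω', wordProd vt K A i ω' ∂P)
  have hF : ∀ U, Measurable (F U) := by
    intro U; simp only [F]; fun_prop
  have hdep : ∀ U, DependsOn (F U)
      ((({t | vt t ∈ U} : Finset T).image fun t => (K t).natAbs : Finset ℕ) : Set ℕ) := by
    intro U x y hxy
    simp only [F]
    refine prod_congr rfl fun i hi => ?_
    congr 1
    refine prod_congr rfl fun t ht => hxy _ ?_
    rw [mem_coe]
    exact mem_image_of_mem _ (by simpa [(mem_filter.1 ht).2] using hi)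
  have := hA.integral_mul_of_disjoint (F := F U) (G := F U') ?_ (hF U) (hF U') (hdep U) (hdep U')
  · simp only [mixedMoment, prod_union hd]
    exact this
  · rw [Finset.disjoint_left]
    rintro v hv hv'
    obtain ⟨t, ht, rfl⟩ := mem_image.1 hv
    obtain ⟨t', ht', h⟩ := mem_image.1 hv'
    exact hsh t t' (mem_filter.1 ht).2 (mem_filter.1 ht').2 h.symm

include hA in
-- A letter occurring once is a mean-zero factor independent of everything else.
lemma Noise.mixedMoment_of_single {U : Finset ι} {t : T} (hU : vt t ∈ U)
    (ht : ∀ t', t' ≠ t → (K t').natAbs ≠ (K t).natAbs) : mixedMoment vt K P A U = 0 := by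
  classical
  have hmem : t ∈ ({t' | vt t' = vt t} : Finset T) := by simp
  have hF : Measurable fun x : ℕ → ℝ => x (K t).natAbs := measurable_pi_apply _
  have hFd : DependsOn (fun x : ℕ → ℝ => x (K t).natAbs) (({(K t).natAbs} : Finset ℕ) : Set ℕ) :=
    fun x y hxy => hxy _ (by simp)
  set S' : Finset ℕ := (univ.erase t).image fun t' => (K t').natAbs with hS'
  have hdisj : Disjoint {(K t).natAbs} S' := by
    rw [disjoint_singleton_left, hS', mem_image]
    rintro ⟨t', ht', h⟩
    exact ht t' (ne_of_mem_erase ht') h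
  have hmemS : ∀ t', t' ≠ t → (K t').natAbs ∈ S' := fun t' h =>
    mem_image_of_mem _ (mem_erase.2 ⟨h, mem_univ _⟩)
  have hsplit : ∀ x : ℕ → ℝ, ∏ t' with vt t' = vt t, x (K t').natAbs
      = x (K t).natAbs * ∏ t' ∈ ({t' | vt t' = vt t} : Finset T).erase t, x (K t').natAbs :=
    fun x => (mul_prod_erase _ (fun t' => x (K t').natAbs) hmem).symm
  -- The mean of the word through `t` vanishes too. There is thus nothing to subtract in that word,
  -- and the letter can be pulled out of the whole product.
  have h0 : ∫ ω, wordProd vt K A (vt t) ω ∂P = 0 := by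
    have := hA.integral_mul_of_disjoint hdisj hF
      (G := fun x => ∏ t' ∈ ({t' | vt t' = vt t} : Finset T).erase t, x (K t').natAbs)
      (by fun_prop) hFd (fun x y hxy => prod_congr rfl fun t' ht' =>
        hxy _ (hmemS t' (ne_of_mem_erase ht')))
    rw [hA.mean, zero_mul] at this
    rw [← this]
    exact integral_congr_ae (ae_of_all _ fun ω => hsplit fun v => A v ω)
  have := hA.integral_mul_of_disjoint hdisj hF
    (G := fun x => (∏ t' ∈ ({t' | vt t' = vt t} : Finset T).erase t, x (K t').natAbs) *
      ∏ i ∈ U.erase (vt t), (∏ t' with vt t' = i, x (K t').natAbs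
        - ∫ ω', wordProd vt K A i ω' ∂P)) (by fun_prop) hFd ?_
  · rw [hA.mean, zero_mul] at this
    rw [← this, mixedMoment]
    refine integral_congr_ae (ae_of_all _ fun ω => ?_)
    simp only
    rw [← mul_prod_erase _ _ hU, centredWord, h0, sub_zero, wordProd, hsplit fun v => A v ω,
      mul_assoc]
    rfl
  · intro x y hxy
    simp only
    congr 1
    · exact prod_congr rfl fun t' ht' => hxy _ (hmemS t' (ne_of_mem_erase ht'))
    · refine prod_congr rfl fun i hi => ?_
      congr 1
      refine prod_congr rfl fun t' ht' => hxy _ (hmemS t' ?_)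
      rintro rfl
      exact ne_of_mem_erase hi (mem_filter.1 ht').2.symm

include hA in
lemma Noise.mixedMoment_of_zero {U : Finset ι} {t : T} (hU : vt t ∈ U) (ht : K t = 0) :
    mixedMoment vt K P A U = 0 := by
  have h1 : ∀ ω, wordProd vt K A (vt t) ω = 0 := fun ω =>
    prod_eq_zero (i := t) (by simp) (by simp [ht, hA.zero])
  have h2 : ∀ ω, centredWord vt K P A (vt t) ω = 0 := fun ω => by simp [centredWord, h1]
  have h3 : ∀ ω, ∏ i ∈ U, centredWord vt K P A i ω = 0 := fun ω => prod_eq_zero hU (h2 ω)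
  simp [mixedMoment, h3]

end Noise

end ToeplitzBand

end

noncomputable section

namespace ToeplitzBand

set_option linter.unusedSectionVars false

/-! ### The Wick recursion for non-degenerate families. -/

section Wick

open Finset

variable {Ω : Type*} [MeasurableSpace Ω] {P : Measure Ω} [IsProbabilityMeasure P]
  {A : ℕ → Ω → ℝ} (hA : Noise P A)
  {T ι : Type*} [Fintype T] [Fintype ι] [DecidableEq ι] {vt : T → ι} {K : T → ℤ}

include hA in
-- A word sharing no value with the others is independent of them and contributes its own mean, zero
-- by centring.
lemma Noise.mixedMoment_of_isolated {U : Finset ι} {i : ι} (hi : i ∈ U)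
    (h : ∀ t t', vt t = i → vt t' ≠ i → (K t).natAbs ≠ (K t').natAbs) :
    mixedMoment vt K P A U = 0 := by
  rw [← insert_erase hi, insert_eq, hA.mixedMoment_union, hA.mixedMoment_singleton, zero_mul]
  · simp
  · intro t t' ht ht'
    exact h t t' (by simpa using ht) (ne_of_mem_erase ht')

include hA in
-- The vanishing is stated for all `U` containing one fixed `i`, because the recursion needs it both
-- for the full moment and for a factor of every product.
lemma Noise.mixedMoment_eq_zero_or_regular (hz : ZeroSum vt K) (hK : ¬ Degenerate vt K) :
    (∃ i, ∀ U : Finset ι, i ∈ U → mixedMoment vt K P A U = 0) ∨ Regular vt K := by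
  by_cases h0 : ∀ t, K t ≠ 0
  swap
  · obtain ⟨t, ht⟩ := not_forall.1 h0
    exact Or.inl ⟨vt t, fun U hU => hA.mixedMoment_of_zero hU (not_not.1 ht)⟩
  by_cases h1 : ∃ t, ∀ t', t' ≠ t → (K t').natAbs ≠ (K t).natAbs
  · obtain ⟨t, ht⟩ := h1
    exact Or.inl ⟨vt t, fun U hU => hA.mixedMoment_of_single hU ht⟩
  by_cases h2 : ∃ i, ∀ t t', vt t = i → vt t' ≠ i → (K t).natAbs ≠ (K t').natAbs
  · obtain ⟨i, hi⟩ := h2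
    exact Or.inl ⟨i, fun U hU => hA.mixedMoment_of_isolated hU hi⟩
  push Not at h1 h2
  refine Or.inr ⟨h0, hz, fun v hv => ?_, h2, hK⟩
  obtain ⟨t, -, rfl⟩ := mem_image.1 hv
  obtain ⟨t', ht', h⟩ := h1 t
  exact one_lt_card.2 ⟨t, by simp, t', by simpa using h, ht'.symm⟩

include hA in
/-- Off the degenerate words, mixed moments satisfy the recursion of Gaussian moments. -/
lemma Noise.wick_of_not_degenerate (hz : ZeroSum vt K) (hK : ¬ Degenerate vt K) (i₀ : ι) :
    mixedMoment vt K P A univ - ∑ j ∈ univ.erase i₀,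
      mixedMoment vt K P A {i₀, j} * mixedMoment vt K P A {i₀, j}ᶜ = 0 := by
  rcases hA.mixedMoment_eq_zero_or_regular hz hK with ⟨i, hi⟩ | h
  · rw [hi univ (mem_univ i), zero_sub, neg_eq_zero]
    -- The vertex `i` lies in `{i₀, j}` or in its complement, so one factor vanishes.
    refine sum_eq_zero fun j _ => ?_
    by_cases hij : i ∈ ({i₀, j} : Finset ι)
    · rw [hi _ hij, zero_mul]
    · rw [hi _ (mem_compl.2 hij), mul_zero]
  -- Only the neighbour of `i₀` contributes. This pair shares no value with the remaining words, so
  -- the moment factorises; for any other `j` the two words at `i₀` and `j` are independent.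
  obtain ⟨t, t', rfl, ht', htt⟩ := h.shared i₀
  rw [sum_eq_single (vt t'), sub_eq_zero, ← union_compl {vt t, vt t'}]
  · refine hA.mixedMoment_union disjoint_compl_right fun s s' hs hs' hss => ?_
    simp only [mem_compl, mem_insert, mem_singleton, not_or] at hs hs'
    rcases hs with hs | hs
    · exact hs'.2 (h.neighbour_unique (s := t) (t := s) (s' := t') (t' := s') ht'.symm
        (by rw [hs]; exact fun e => hs'.1 e.symm) hs.symm htt hss).symm
    · exact hs'.1 (h.neighbour_unique (s := t') (t := s) (s' := t) (t' := s') ht'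
        (by rw [hs]; exact fun e => hs'.2 e.symm) hs.symm htt.symm hss).symm
  · intro j hj hjt
    have hj' := ne_of_mem_erase hj
    rw [insert_eq, hA.mixedMoment_union, hA.mixedMoment_singleton, zero_mul, zero_mul]
    · simpa using hj'.symm
    · intro s s' hs hs' hss
      rw [mem_singleton] at hs hs'
      refine hjt ?_
      rw [← hs']
      exact (h.neighbour_unique (s := t) (t := s) (s' := t') (t' := s') ht'.symm
        (by rw [hs, hs']; exact hj'.symm) hs.symm htt hss).symm
  · intro hn
    exact absurd (mem_erase.2 ⟨ht', mem_univ _⟩) hn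

/-- Expansion of a product of two expectations of products of sums. -/
lemma integral_prod_sum_mul {κ : ι → Type*} (s : ∀ i, Finset (κ i)) (z : ∀ i, κ i → Ω → ℝ)
    (U : Finset ι) (hz : ∀ (V : Finset ι) (k : ∀ i, κ i),
      Integrable (fun ω => ∏ i ∈ V, z i (k i) ω) P) :
    (∫ ω, ∏ i ∈ U, ∑ k ∈ s i, z i k ω ∂P) * ∫ ω, ∏ i ∈ Uᶜ, ∑ k ∈ s i, z i k ω ∂P
      = ∑ k ∈ Fintype.piFinset s,
        (∫ ω, ∏ i ∈ U, z i (k i) ω ∂P) * ∫ ω, ∏ i ∈ Uᶜ, z i (k i) ω ∂P := by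
  -- A product of two expectations is an expectation over two independent copies. Reading the
  -- factors in `U` in the first copy and the others in the second gives one product over all `i`,
  -- which is expanded at once.
  have key : ∀ f : ι → Ω → ℝ, ∀ x : Ω × Ω, (∏ i ∈ U, f i x.1) * ∏ i ∈ Uᶜ, f i x.2
      = ∏ i, f i (if i ∈ U then x.1 else x.2) := by
    intro f x
    rw [← prod_mul_prod_compl U]
    congr 1
    · exact prod_congr rfl fun i hi => by rw [if_pos hi]
    · exact prod_congr rfl fun i hi => by rw [if_neg (mem_compl.1 hi)]
  simp_rw [← integral_prod_mul]
  rw [← integral_finsetSum]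
  · refine integral_congr_ae (ae_of_all _ fun x => ?_)
    simp only
    rw [key fun i ω => ∑ k ∈ s i, z i k ω, prod_univ_sum]
    exact sum_congr rfl fun k _ => (key (fun i ω => z i (k i) ω) x).symm
  · intro k _
    exact (hz U k).mul_prod (hz Uᶜ k)

lemma integral_prod_sum {κ : ι → Type*} (s : ∀ i, Finset (κ i)) (z : ∀ i, κ i → Ω → ℝ)
    (hz : ∀ (V : Finset ι) (k : ∀ i, κ i), Integrable (fun ω => ∏ i ∈ V, z i (k i) ω) P) :
    ∫ ω, ∏ i, ∑ k ∈ s i, z i k ω ∂P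
      = ∑ k ∈ Fintype.piFinset s, ∫ ω, ∏ i, z i (k i) ω ∂P := by
  simpa using integral_prod_sum_mul s z univ hz

end Wick

end ToeplitzBand

end

noncomputable section

namespace ToeplitzBand

set_option linter.unusedSectionVars false

/-! ### Linear combinations of centred words and their joint moments. -/

section WordSums

open Finset

variable {Ω : Type*} [MeasurableSpace Ω] {P : Measure Ω} [IsProbabilityMeasure P]
  {A : ℕ → Ω → ℝ} (hA : Noise P A)
  {T ι : Type*} [Fintype T] [Fintype ι] [DecidableEq ι]

/-- Degenerate words have a negligible contribution. -/
lemma exists_degenerate_sum_bound [DecidableEq T] (vt : T → ι) :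
    ∃ C : ℝ, 0 ≤ C ∧ ∀ w : ℕ, 1 ≤ w → ∀ (c g : (T → ℤ) → ℝ) (B : ℝ), 0 ≤ B →
      (∀ K, |g K| ≤ B) → (∀ K, c K ≠ 0 → ZeroSum vt K) →
      (∀ K, |c K| * √(w : ℝ) ^ Fintype.card T ≤ √(w : ℝ) ^ Fintype.card ι) →
      (∀ K, ZeroSum vt K → ¬ Degenerate vt K → g K = 0) →
      |∑ K ∈ boxWords T w, c K * g K| * √(w : ℝ) ≤ C * B := by
  classical
  obtain ⟨C, hC0, hC⟩ := card_degenerate_le vt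
  refine ⟨C, hC0, fun w hw c g B hB hg hc hcb hgd => ?_⟩
  have hw0 : 0 < √(w : ℝ) := Real.sqrt_pos.2 (by exact_mod_cast hw)
  have h1 : |∑ K ∈ boxWords T w, c K * g K| * √(w : ℝ) ^ Fintype.card T
      ≤ #{K ∈ boxWords T w | ZeroSum vt K ∧ Degenerate vt K} *
        (√(w : ℝ) ^ Fintype.card ι * B) := by
    -- The coefficient `c` removes the words that are not zero-sum, and `g` removes the
    -- non-degenerate ones.
    have h2 : ∑ K ∈ boxWords T w, c K * g K
        = ∑ K ∈ boxWords T w with ZeroSum vt K ∧ Degenerate vt K, c K * g K := by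
      symm
      refine sum_subset (filter_subset _ _) fun K hK hK' => ?_
      by_contra hne
      have hz := hc K (left_ne_zero_of_mul hne)
      refine hK' (mem_filter.2 ⟨hK, hz, ?_⟩)
      by_contra hd
      exact right_ne_zero_of_mul hne (hgd K hz hd)
    rw [h2]
    calc _ ≤ (∑ K ∈ boxWords T w with ZeroSum vt K ∧ Degenerate vt K, |c K * g K|)
          * √(w : ℝ) ^ Fintype.card T := by gcongr; exact abs_sum_le_sum_abs _ _
      _ = ∑ K ∈ boxWords T w with ZeroSum vt K ∧ Degenerate vt K,
          (|c K| * √(w : ℝ) ^ Fintype.card T) * |g K| := by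
        rw [sum_mul]; exact sum_congr rfl fun K _ => by rw [abs_mul]; ring
      _ ≤ ∑ K ∈ boxWords T w with ZeroSum vt K ∧ Degenerate vt K,
          √(w : ℝ) ^ Fintype.card ι * B := by
        refine sum_le_sum fun K _ => ?_
        exact mul_le_mul (hcb K) (hg K) (abs_nonneg _) (by positivity)
      _ = _ := by rw [sum_const, nsmul_eq_mul]
  have h3 := hC w hw
  rw [pow_succ] at h3
  refine le_of_mul_le_mul_right ?_ (pow_pos hw0 (Fintype.card T))
  calc |∑ K ∈ boxWords T w, c K * g K| * √(w : ℝ) * √(w : ℝ) ^ Fintype.card T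
      = |∑ K ∈ boxWords T w, c K * g K| * √(w : ℝ) ^ Fintype.card T * √(w : ℝ) := by ring
    _ ≤ (#{K ∈ boxWords T w | ZeroSum vt K ∧ Degenerate vt K} *
        (√(w : ℝ) ^ Fintype.card ι * B)) * √(w : ℝ) := by gcongr
    _ = (#{K ∈ boxWords T w | ZeroSum vt K ∧ Degenerate vt K} *
        (√(w : ℝ) ^ Fintype.card ι * √(w : ℝ))) * B := by ring
    _ ≤ (C * √(w : ℝ) ^ Fintype.card T) * B := by gcongr
    _ = C * B * √(w : ℝ) ^ Fintype.card T := by ring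

/-- The centred product `∏ A_{|J_t|} - E ∏ A_{|J_t|}`. -/
def centredProd (P : Measure Ω) (A : ℕ → Ω → ℝ) {p : ℕ} (J : Fin p → ℤ) (ω : Ω) : ℝ :=
  ∏ t, A (J t).natAbs ω - ∫ ω', ∏ t, A (J t).natAbs ω' ∂P

/-- A linear combination of the centred products over the words with letters in `[-w, w]`. -/
def wordSum (P : Measure Ω) (A : ℕ → Ω → ℝ) (w : ℕ) {p : ℕ} (c : (Fin p → ℤ) → ℝ) (ω : Ω) : ℝ :=
  ∑ J ∈ boxWords (Fin p) w, c J * centredProd P A J ω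

lemma prod_sigma_fiber {ℓ : ι → ℕ} (i : ι) (f : (Σ i, Fin (ℓ i)) → ℝ) :
    ∏ t with t.1 = i, f t = ∏ t : Fin (ℓ i), f ⟨i, t⟩ := by
  symm
  refine prod_bij (fun t _ => ⟨i, t⟩) (by simp) (by simp) ?_ (by simp)
  rintro ⟨j, t⟩ h
  obtain rfl : j = i := by simpa using h
  exact ⟨t, mem_univ _, rfl⟩

lemma centredWord_sigma {ℓ : ι → ℕ} (J : ∀ i, Fin (ℓ i) → ℤ) (i : ι) (ω : Ω) :
    centredWord Sigma.fst (fun t : Σ i, Fin (ℓ i) => J t.1 t.2) P A i ω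
      = centredProd P A (J i) ω := by
  simp only [centredWord, wordProd, centredProd, prod_sigma_fiber]

/-- The admissible coefficients of words at the scale `w`. -/
structure Admissible (w : ℕ) {p : ℕ} (c : (Fin p → ℤ) → ℝ) : Prop where
  sum_eq_zero : ∀ J, c J ≠ 0 → ∑ t, J t = 0
  bound : ∀ J, |c J| * √(w : ℝ) ^ p ≤ √(w : ℝ)

include hA in
lemma Noise.integrable_prod_centredProd {ℓ : ι → ℕ} (V : Finset ι) (J : ∀ i, Fin (ℓ i) → ℤ) :
    Integrable (fun ω => ∏ i ∈ V, centredProd P A (J i) ω) P := by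
  obtain ⟨C, -, hC⟩ := hA.exists_mixedMoment_bound (Sigma.fst : (Σ i, Fin (ℓ i)) → ι)
  simpa only [centredWord_sigma] using (hC (fun t => J t.1 t.2) V).1

include hA in
lemma Noise.integrable_prod_wordSum {ℓ : ι → ℕ} (w : ℕ) (c : ∀ i, (Fin (ℓ i) → ℤ) → ℝ)
    (V : Finset ι) : Integrable (fun ω => ∏ i ∈ V, wordSum P A w (c i) ω) P := by
  simp only [wordSum]
  have h1 : ∀ ω, ∏ i ∈ V, ∑ J ∈ boxWords (Fin (ℓ i)) w, c i J * centredProd P A J ω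
      = ∑ J ∈ V.pi fun i => boxWords (Fin (ℓ i)) w,
        ∏ i ∈ V.attach, c i (J i i.2) * centredProd P A (J i i.2) ω := fun ω => by rw [prod_sum]
  simp_rw [h1]
  refine integrable_finsetSum _ fun J _ => ?_
  simp_rw [prod_mul_distrib]
  refine Integrable.const_mul ?_ _
  exact hA.integrable_prod_centredProd (ℓ := fun i : V => ℓ i) V.attach fun i => J i i.2

include hA in
-- Families of words become single functions on the sigma type of all letters. Every term of the
-- recursion is expanded over the same index `K` with the same coefficient, so the terms can be
-- compared `K` by `K`.
lemma Noise.integral_prod_wordSum_mul {ℓ : ι → ℕ} (w : ℕ) (c : ∀ i, (Fin (ℓ i) → ℤ) → ℝ)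
    (U : Finset ι) :
    (∫ ω, ∏ i ∈ U, wordSum P A w (c i) ω ∂P) * ∫ ω, ∏ i ∈ Uᶜ, wordSum P A w (c i) ω ∂P
      = ∑ K ∈ boxWords (Σ i, Fin (ℓ i)) w, (∏ i, c i fun t => K ⟨i, t⟩) *
        (mixedMoment Sigma.fst K P A U * mixedMoment Sigma.fst K P A Uᶜ) := by
  simp only [wordSum]
  rw [integral_prod_sum_mul (fun i => boxWords (Fin (ℓ i)) w)
    (fun i J ω => c i J * centredProd P A J ω)]
  · refine sum_nbij' (fun J t => J t.1 t.2) (fun K i t => K ⟨i, t⟩) ?_ ?_ (fun _ _ => rfl)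
      (fun _ _ => rfl) ?_
    · intro J hJ
      simp only [boxWords, Fintype.mem_piFinset] at hJ ⊢
      exact fun t => hJ t.1 t.2
    · intro K hK
      simp only [boxWords, Fintype.mem_piFinset] at hK ⊢
      exact fun i t => hK ⟨i, t⟩
    · intro J _
      simp only [prod_mul_distrib, integral_const_mul, mixedMoment, centredWord_sigma]
      rw [← prod_mul_prod_compl U]
      ring
  · intro V J
    simp_rw [prod_mul_distrib]
    exact (hA.integrable_prod_centredProd V J).const_mul _

include hA in
/-- The mixed moments of word sums satisfy the recursion of Gaussian moments up to an error of the
order of `1 / √w`. -/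
lemma Noise.exists_wick_bound (ℓ : ι → ℕ) (i₀ : ι) : ∃ C : ℝ, ∀ w : ℕ, 1 ≤ w →
    ∀ c : ∀ i, (Fin (ℓ i) → ℤ) → ℝ, (∀ i, Admissible w (c i)) →
      |∫ ω, ∏ i, wordSum P A w (c i) ω ∂P - ∑ j ∈ univ.erase i₀,
        (∫ ω, ∏ i ∈ {i₀, j}, wordSum P A w (c i) ω ∂P) *
          ∫ ω, ∏ i ∈ {i₀, j}ᶜ, wordSum P A w (c i) ω ∂P| * √(w : ℝ) ≤ C := by
  obtain ⟨C₁, hC₁0, hC₁⟩ := hA.exists_mixedMoment_bound (Sigma.fst : (Σ i, Fin (ℓ i)) → ι)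
  obtain ⟨C₂, hC₂0, hC₂⟩ := exists_degenerate_sum_bound (Sigma.fst : (Σ i, Fin (ℓ i)) → ι)
  refine ⟨C₂ * (C₁ + Fintype.card ι * (C₁ * C₁)), fun w hw c hc => ?_⟩
  have h0 : ∫ ω, ∏ i, wordSum P A w (c i) ω ∂P
      = ∑ K ∈ boxWords (Σ i, Fin (ℓ i)) w, (∏ i, c i fun t => K ⟨i, t⟩) *
        mixedMoment Sigma.fst K P A univ := by
    simpa [mixedMoment_empty] using hA.integral_prod_wordSum_mul w c univ
  rw [h0]
  simp_rw [hA.integral_prod_wordSum_mul w c]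
  rw [sum_comm, ← sum_sub_distrib]
  simp_rw [← mul_sum, ← mul_sub]
  -- Here `g K` is the Wick defect of `K`, which vanishes unless `K` is degenerate.
  refine hC₂ w hw (fun K => ∏ i, c i fun t => K ⟨i, t⟩) _ _ (by positivity) ?_ ?_ ?_ ?_
  · intro K
    refine (abs_sub _ _).trans (add_le_add (hC₁ K _).2 ?_)
    refine (abs_sum_le_sum_abs _ _).trans ?_
    calc _ ≤ ∑ j ∈ univ.erase i₀, C₁ * C₁ := by
          refine sum_le_sum fun j _ => ?_
          rw [abs_mul]
          exact mul_le_mul (hC₁ K _).2 (hC₁ K _).2 (abs_nonneg _) hC₁0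
      _ ≤ _ := by
        rw [sum_const, nsmul_eq_mul]
        gcongr
        exact card_le_univ _
  · intro K hK i
    rw [← (hc i).sum_eq_zero _ (prod_ne_zero_iff.1 hK i (mem_univ i))]
    symm
    refine sum_bij (fun t _ => ⟨i, t⟩) (by simp) (by simp) ?_ (by simp)
    rintro ⟨j, t⟩ h
    obtain rfl : j = i := by simpa using h
    exact ⟨t, mem_univ _, rfl⟩
  · intro K
    rw [Fintype.card_sigma, ← prod_pow_eq_pow_sum, abs_prod, ← prod_mul_distrib]
    calc _ ≤ ∏ _i : ι, √(w : ℝ) := by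
          refine prod_le_prod (fun i _ => by positivity) fun i _ => ?_
          rw [Fintype.card_fin]
          exact (hc i).bound _
      _ = _ := by rw [prod_const, card_univ]
  · exact fun K hz hK => hA.wick_of_not_degenerate hz hK i₀

end WordSums

end ToeplitzBand

end

noncomputable section

namespace ToeplitzBand

set_option linter.unusedSectionVars false

/-! ### Convergence of moments to Gaussian moments implies convergence in law. -/

section MomentMethod

open Finset

/-- The moments of the centred Gaussian law with variance `v`. -/
def gaussMoment (v : ℝ) : ℕ → ℝ
  | 0 => 1
  | 1 => 0
  | k + 2 => (k + 1) * v * gaussMoment v k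

lemma gaussMoment_odd (v : ℝ) (l : ℕ) : gaussMoment v (2 * l + 1) = 0 := by
  induction l with
  | zero => rfl
  | succ l ih => rw [show 2 * (l + 1) + 1 = (2 * l + 1) + 2 by ring, gaussMoment, ih, mul_zero]

lemma gaussMoment_even (v : ℝ) (l : ℕ) :
    gaussMoment v (2 * l) / (2 * l).factorial = (v / 2) ^ l / l.factorial := by
  induction l with
  | zero => simp [gaussMoment]
  | succ l ih =>
    rw [show 2 * (l + 1) = 2 * l + 2 by ring, gaussMoment, Nat.factorial_succ (2 * l + 1),
      Nat.factorial_succ (2 * l), Nat.factorial_succ l, pow_succ]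
    push_cast
    rw [show ((v / 2) ^ l * (v / 2) / ((l + 1 : ℝ) * l.factorial) : ℝ)
      = (v / 2) ^ l / l.factorial * (v / (2 * (l + 1))) by field_simp, ← ih]
    field_simp
    ring

/-- The derivative of one Taylor remainder is `c` times the previous one, and `‖c‖ = 1`; the mean
value inequality on `[0, x]` closes the induction. The case `c = -I` provides the negative
arguments. -/
lemma norm_exp_sub_taylor_le_aux {c : ℂ} (hc : c = Complex.I ∨ c = -Complex.I) (n : ℕ) :
    ∀ x : ℝ, 0 ≤ x →
      ‖Complex.exp (c * x) - ∑ j ∈ range n, (c * x) ^ j / j.factorial‖ ≤ x ^ n / n.factorial := by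
  have hn : ‖c‖ = 1 := by rcases hc with rfl | rfl <;> simp
  induction n with
  | zero =>
    intro x _
    rcases hc with rfl | rfl
    · simp [mul_comm Complex.I, Complex.norm_exp_ofReal_mul_I]
    · have : -Complex.I * (x : ℂ) = ((-x : ℝ) : ℂ) * Complex.I := by push_cast; ring
      rw [this]
      simp only [range_zero, sum_empty, sub_zero, Complex.norm_exp_ofReal_mul_I]
      simp
  | succ n ih =>
    intro x hx
    have hexp : ∀ y : ℝ, HasDerivAt (fun y : ℝ => Complex.exp (c * y))
        (Complex.exp (c * y) * c) y := by
      intro y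
      have h1 : HasDerivAt (fun y : ℝ => c * (y : ℂ)) c y := by
        simpa using (Complex.ofRealCLM.hasDerivAt (x := y)).const_mul c
      exact h1.cexp
    have hpow : ∀ (j : ℕ) (y : ℝ), HasDerivAt (fun y : ℝ => (c * (y : ℂ)) ^ (j + 1) /
        ((j + 1).factorial : ℂ)) (c * ((c * y) ^ j / j.factorial)) y := by
      intro j y
      have h1 : HasDerivAt (fun y : ℝ => c * (y : ℂ)) c y := by
        simpa using (Complex.ofRealCLM.hasDerivAt (x := y)).const_mul c
      have h2 := (h1.pow (j + 1)).div_const ((j + 1).factorial : ℂ)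
      refine h2.congr_deriv ?_
      rw [Nat.factorial_succ]
      have : (j.factorial : ℂ) ≠ 0 := by exact_mod_cast j.factorial_ne_zero
      have : (j + 1 : ℂ) ≠ 0 := by exact_mod_cast j.succ_ne_zero
      push_cast
      field_simp
    have hderiv : ∀ y : ℝ, HasDerivAt (fun y : ℝ => Complex.exp (c * y) -
        ∑ j ∈ range (n + 1), (c * (y : ℂ)) ^ j / j.factorial)
        (c * (Complex.exp (c * y) - ∑ j ∈ range n, (c * (y : ℂ)) ^ j / j.factorial)) y := by
      intro y
      have h3 := ((HasDerivAt.fun_sum (u := range n) fun j _ => hpow j y).add_const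
        ((1 : ℂ)))
      have h4 := (hexp y).fun_sub h3
      have e : (fun y : ℝ => Complex.exp (c * y) -
          ∑ j ∈ range (n + 1), (c * (y : ℂ)) ^ j / j.factorial) = fun y : ℝ => Complex.exp (c * y) -
          (∑ j ∈ range n, (c * (y : ℂ)) ^ (j + 1) / (j + 1).factorial + 1) := by
        funext y
        rw [sum_range_succ' _ n]
        simp
      rw [e]
      refine h4.congr_deriv ?_
      rw [mul_sub, mul_sum, mul_comm c (Complex.exp _)]
    refine image_norm_le_of_norm_deriv_right_le_deriv_boundary (a := 0) (b := x)
      (f := fun y : ℝ => Complex.exp (c * y) - ∑ j ∈ range (n + 1), (c * (y : ℂ)) ^ j / j.factorial)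
      (f' := fun y : ℝ => c * (Complex.exp (c * y) -
        ∑ j ∈ range n, (c * (y : ℂ)) ^ j / j.factorial))
      (B := fun y => y ^ (n + 1) / (n + 1).factorial) (B' := fun y => y ^ n / n.factorial)
      (fun y _ => (hderiv y).continuousAt.continuousWithinAt)
      (fun y _ => (hderiv y).hasDerivWithinAt) ?_ ?_ ?_ ⟨hx, le_rfl⟩
    · simp only [sum_range_succ' _ n]; simp
    · intro y
      have h1 := (hasDerivAt_pow (n + 1) y).div_const ((n + 1).factorial : ℝ)
      refine h1.congr_deriv ?_
      rw [Nat.factorial_succ]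
      push_cast
      field_simp
    · intro y hy
      rw [norm_mul, hn, one_mul]
      exact ih y hy.1

lemma norm_exp_mul_I_sub_taylor_le (n : ℕ) (x : ℝ) :
    ‖Complex.exp (x * Complex.I) - ∑ j ∈ range n, (x * Complex.I) ^ j / j.factorial‖
      ≤ |x| ^ n / n.factorial := by
  rcases le_total 0 x with hx | hx
  · have := norm_exp_sub_taylor_le_aux (Or.inl rfl) n x hx
    rwa [abs_of_nonneg hx, mul_comm (x : ℂ)]
  · have := norm_exp_sub_taylor_le_aux (Or.inr rfl) n (-x) (by linarith)
    rw [abs_of_nonpos hx]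
    have e : -Complex.I * ((-x : ℝ) : ℂ) = x * Complex.I := by push_cast; ring
    rwa [e] at this

variable {Ω : Type*} [MeasurableSpace Ω] {P : Measure Ω} [IsProbabilityMeasure P]

/-- Truncating at an even order makes the remainder an ordinary moment rather than an absolute one.
-/
lemma norm_integral_exp_sub_le {X : Ω → ℝ} (hX : Measurable X)
    (hint : ∀ k : ℕ, Integrable (fun ω => X ω ^ k) P) (t : ℝ) (m : ℕ) :
    ‖∫ ω, Complex.exp ((t * X ω : ℝ) * Complex.I) ∂P -
      ∑ j ∈ range (2 * m), (t * Complex.I) ^ j / j.factorial * ((∫ ω, X ω ^ j ∂P : ℝ) : ℂ)‖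
      ≤ t ^ (2 * m) / (2 * m).factorial * ∫ ω, X ω ^ (2 * m) ∂P := by
  have hterm : ∀ j : ℕ, (t * Complex.I) ^ j / j.factorial * ((∫ ω, X ω ^ j ∂P : ℝ) : ℂ)
      = ∫ ω, (((t * X ω : ℝ) : ℂ) * Complex.I) ^ j / j.factorial ∂P := by
    intro j
    rw [← integral_complex_ofReal, ← integral_const_mul]
    refine integral_congr_ae (ae_of_all _ fun ω => ?_)
    simp only
    push_cast
    ring
  have hI : ∀ j : ℕ, Integrable
      (fun ω => (((t * X ω : ℝ) : ℂ) * Complex.I) ^ j / (j.factorial : ℂ)) P := by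
    intro j
    have h1 : Integrable (fun ω => ((X ω ^ j : ℝ) : ℂ)) P := (hint j).ofReal
    refine (h1.const_mul ((t * Complex.I) ^ j / j.factorial)).congr (ae_of_all _ fun ω => ?_)
    simp only
    push_cast
    ring
  have hE : Integrable (fun ω => Complex.exp ((t * X ω : ℝ) * Complex.I)) P := by
    refine (integrable_const (1 : ℝ)).mono' ?_ (ae_of_all _ fun ω => ?_)
    · have : Measurable fun ω => Complex.exp ((t * X ω : ℝ) * Complex.I) := by fun_prop
      exact this.aestronglyMeasurable
    · rw [Complex.norm_exp_ofReal_mul_I]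
  rw [sum_congr rfl fun j _ => hterm j, ← integral_finsetSum _ fun j _ => hI j,
    ← integral_sub hE (integrable_finsetSum _ fun j _ => hI j), ← integral_const_mul]
  refine norm_integral_le_of_norm_le ((hint (2 * m)).const_mul _) (ae_of_all _ fun ω => ?_)
  refine (norm_exp_mul_I_sub_taylor_le (2 * m) (t * X ω)).trans (le_of_eq ?_)
  rw [pow_mul, sq_abs, ← pow_mul, mul_pow]
  ring

lemma sum_gaussMoment (v t : ℝ) (m : ℕ) :
    ∑ j ∈ range (2 * m), (t * Complex.I) ^ j / j.factorial * (gaussMoment v j : ℂ)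
      = ∑ l ∈ range m, ((-(v * t ^ 2 / 2) : ℝ) : ℂ) ^ l / l.factorial := by
  induction m with
  | zero => simp
  | succ m ih =>
    rw [show 2 * (m + 1) = 2 * m + 1 + 1 by ring, sum_range_succ, sum_range_succ, ih,
      sum_range_succ, gaussMoment_odd, Complex.ofReal_zero, mul_zero, add_zero]
    congr 1
    have h : (((gaussMoment v (2 * m) / (2 * m).factorial : ℝ)) : ℂ)
        = (((v / 2) ^ m / m.factorial : ℝ) : ℂ) := by rw [gaussMoment_even]
    push_cast at h
    rw [div_mul_eq_mul_div, mul_div_assoc, h, mul_pow, pow_mul Complex.I, Complex.I_sq, pow_mul]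
    push_cast
    rw [show (-((v : ℂ) * t ^ 2 / 2)) = (t : ℂ) ^ 2 * (-1) * (v / 2) by ring, mul_pow, mul_pow]
    ring

/-- If the moments converge to those of a Gaussian law, then so do the laws. -/
lemma tendstoInDistribution_of_moments {X : ℕ → Ω → ℝ} (hX : ∀ n, Measurable (X n)) {v : ℝ}
    (hv : 0 ≤ v) (hint : ∀ n (k : ℕ), Integrable (fun ω => X n ω ^ k) P)
    (hmom : ∀ k : ℕ, Tendsto (fun n => ∫ ω, X n ω ^ k ∂P) atTop (𝓝 (gaussMoment v k))) :
    TendstoInDistribution X atTop (id : ℝ → ℝ) (fun _ => P) (gaussianReal 0 v.toNNReal) := by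
  refine ⟨fun n => (hX n).aemeasurable, by fun_prop, ?_⟩
  refine ProbabilityMeasure.tendsto_iff_tendsto_charFun.2 fun t => ?_
  simp only [ProbabilityMeasure.coe_mk, Measure.map_id, charFun_gaussianReal]
  have hchar : ∀ n, charFun (P.map (X n)) t = ∫ ω, Complex.exp ((t * X n ω : ℝ) * Complex.I) ∂P := by
    intro n
    rw [charFun_apply_real, integral_map (hX n).aemeasurable (by fun_prop)]
    push_cast
    rfl
  simp_rw [hchar]
  have hlim : Complex.exp (t * (0 : ℝ) * Complex.I - (v.toNNReal : ℝ) * t ^ 2 / 2)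
      = Complex.exp ((-(v * t ^ 2 / 2) : ℝ) : ℂ) := by
    rw [Real.coe_toNNReal v hv]; congr 1; push_cast; ring
  have hlim' := hlim
  push_cast at hlim hlim' ⊢
  rw [hlim]
  have hs1 : Tendsto (fun m => ∑ l ∈ range m, ((-(v * t ^ 2 / 2) : ℝ) : ℂ) ^ l / l.factorial) atTop
      (𝓝 (Complex.exp ((-(v * t ^ 2 / 2) : ℝ) : ℂ))) := by
    have := (NormedSpace.expSeries_div_hasSum_exp (𝔸 := ℂ) ((-(v * t ^ 2 / 2) : ℝ) : ℂ)).tendsto_sum_nat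
    rwa [← Complex.exp_eq_exp_ℂ] at this
  have hs2 : Tendsto (fun m : ℕ => (v * t ^ 2 / 2) ^ m / (m.factorial : ℝ)) atTop (𝓝 0) :=
    FloorSemiring.tendsto_pow_div_factorial_atTop _
  rw [Metric.tendsto_atTop]
  intro ε hε
  -- The truncation order is fixed before `n`: the limiting remainder `(v t² / 2)^m / m!` and the
  -- tail of the exponential series are both small for some `m`. After that only finitely many
  -- moments have to converge.
  obtain ⟨m, hm1, hm2⟩ := ((hs1.eventually (Metric.ball_mem_nhds _ (show 0 < ε / 4 by positivity))).and
    (hs2.eventually (gt_mem_nhds (show 0 < ε / 4 by positivity)))).exists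
  have hpoly : Tendsto (fun n => ∑ j ∈ range (2 * m), (t * Complex.I) ^ j / j.factorial *
      ((∫ ω, X n ω ^ j ∂P : ℝ) : ℂ)) atTop
      (𝓝 (∑ j ∈ range (2 * m), (t * Complex.I) ^ j / j.factorial * (gaussMoment v j : ℂ))) := by
    refine tendsto_finsetSum _ fun j _ => Tendsto.const_mul _ ?_
    exact (Complex.continuous_ofReal.tendsto _).comp (hmom j)
  have hrem : Tendsto (fun n => t ^ (2 * m) / (2 * m).factorial * ∫ ω, X n ω ^ (2 * m) ∂P) atTop
      (𝓝 ((v * t ^ 2 / 2) ^ m / m.factorial)) := by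
    have h1 := (hmom (2 * m)).const_mul (t ^ (2 * m) / (2 * m).factorial)
    have e : (v * t ^ 2 / 2) ^ m / (m.factorial : ℝ)
        = t ^ (2 * m) / (2 * m).factorial * gaussMoment v (2 * m) := by
      rw [div_mul_eq_mul_div, mul_div_assoc (t ^ (2 * m)), gaussMoment_even, pow_mul,
        show v * t ^ 2 / 2 = t ^ 2 * (v / 2) by ring, mul_pow]
      ring
    rwa [e]
  rw [sum_gaussMoment] at hpoly
  obtain ⟨N, hN⟩ := eventually_atTop.1 ((hpoly.eventually
    (Metric.ball_mem_nhds _ (show 0 < ε / 4 by positivity))).and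
    (hrem.eventually (gt_mem_nhds hm2)))
  refine ⟨N, fun n hn => ?_⟩
  obtain ⟨h1, h2⟩ := hN n hn
  have h3 := (norm_integral_exp_sub_le (hX n) (hint n) t m).trans_lt h2
  rw [← dist_eq_norm] at h3
  push_cast at h1 hm1 h3 ⊢
  refine (dist_triangle4 _ _ _ _).trans_lt ((add_lt_add (add_lt_add h3 h1) hm1).trans ?_)
  linarith

lemma tendsto_moments_of_recursion {X : ℕ → Ω → ℝ} {v : ℝ} (h1 : ∀ n, ∫ ω, X n ω ∂P = 0)
    (h2 : Tendsto (fun n => ∫ ω, X n ω ^ 2 ∂P) atTop (𝓝 v))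
    (hrec : ∀ k : ℕ, Tendsto (fun n => ∫ ω, X n ω ^ (k + 2) ∂P -
      (k + 1) * (∫ ω, X n ω ^ 2 ∂P) * ∫ ω, X n ω ^ k ∂P) atTop (𝓝 0)) (k : ℕ) :
    Tendsto (fun n => ∫ ω, X n ω ^ k ∂P) atTop (𝓝 (gaussMoment v k)) := by
  induction k using Nat.strong_induction_on with
  | _ k ih =>
    match k, ih with
    | 0, _ => simp [gaussMoment]
    | 1, _ => simp [gaussMoment, h1]
    | k + 2, ih =>
      have h3 := (hrec k).add (((tendsto_const_nhds (x := (k + 1 : ℝ))).mul h2).mul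
        (ih k (by omega)))
      simpa [gaussMoment] using h3

end MomentMethod

end ToeplitzBand

end

noncomputable section

namespace ToeplitzBand

set_option linter.unusedSectionVars false

/-! ### The central limit theorem for word sums. -/

section WordSumCLT

open Finset

variable {Ω : Type*} [MeasurableSpace Ω] {P : Measure Ω} [IsProbabilityMeasure P]
  {A : ℕ → Ω → ℝ} (hA : Noise P A)

include hA in
lemma Noise.measurable_wordSum (w : ℕ) {p : ℕ} (c : (Fin p → ℤ) → ℝ) :
    Measurable (wordSum P A w c) := by
  have := hA.meas
  unfold wordSum centredProd
  fun_prop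

include hA in
lemma Noise.integral_wordSum (w : ℕ) {p : ℕ} (c : (Fin p → ℤ) → ℝ) :
    ∫ ω, wordSum P A w c ω ∂P = 0 := by
  have h1 : ∀ J : Fin p → ℤ, Integrable (fun ω => centredProd P A J ω) P := fun J => by
    simpa using hA.integrable_prod_centredProd (ι := Unit) (ℓ := fun _ => p) univ fun _ => J
  simp only [wordSum]
  rw [integral_finsetSum _ fun J _ => (h1 J).const_mul _]
  refine sum_eq_zero fun J _ => ?_
  rw [integral_const_mul]
  have h2 : Integrable (fun ω => ∏ t, A (J t).natAbs ω) P := by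
    refine (hA.integrable_wordProd (vt := fun _ : Fin p => ()) (K := J) ()).congr
      (ae_of_all _ fun ω => ?_)
    simp [wordProd]
  simp only [centredProd]
  rw [integral_sub h2 (integrable_const _)]
  simp

/-- A linear combination of word sums of different lengths. -/
def polySum (P : Measure Ω) (A : ℕ → Ω → ℝ) (w : ℕ) (L : Finset ℕ) (q : ℕ → ℝ)
    (c : ∀ p, (Fin p → ℤ) → ℝ) (ω : Ω) : ℝ := ∑ p ∈ L, q p * wordSum P A w (c p) ω

variable (L : Finset ℕ) (q : ℕ → ℝ)

include hA in
lemma Noise.integrable_prod_mul_wordSum {ι : Type*} [Fintype ι] [DecidableEq ι] (w : ℕ)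
    (c : ∀ p, (Fin p → ℤ) → ℝ) (V : Finset ι) (ℓ : ι → ℕ) :
    Integrable (fun ω => ∏ i ∈ V, q (ℓ i) * wordSum P A w (c (ℓ i)) ω) P := by
  simp_rw [prod_mul_distrib]
  exact (hA.integrable_prod_wordSum w (fun i => c (ℓ i)) V).const_mul _

include hA in
lemma Noise.integrable_polySum_pow (w : ℕ) (c : ∀ p, (Fin p → ℤ) → ℝ) (k : ℕ) :
    Integrable (fun ω => polySum P A w L q c ω ^ k) P := by
  have h1 : ∀ ω, polySum P A w L q c ω ^ k
      = ∑ ℓ ∈ Fintype.piFinset fun _ : Fin k => L,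
        ∏ i, q (ℓ i) * wordSum P A w (c (ℓ i)) ω := fun ω => by
    rw [polySum, sum_pow']
  simp_rw [h1]
  exact integrable_finsetSum _ fun ℓ _ => hA.integrable_prod_mul_wordSum q w c univ ℓ

include hA in
lemma Noise.integral_polySum (w : ℕ) (c : ∀ p, (Fin p → ℤ) → ℝ) :
    ∫ ω, polySum P A w L q c ω ∂P = 0 := by
  simp only [polySum]
  rw [integral_finsetSum]
  · exact sum_eq_zero fun p _ => by rw [integral_const_mul, hA.integral_wordSum, mul_zero]
  · intro p _
    simpa using hA.integrable_prod_mul_wordSum q w c (univ : Finset Unit) fun _ => p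

include hA in
lemma Noise.integral_polySum_sq (w : ℕ) (c : ∀ p, (Fin p → ℤ) → ℝ) :
    ∫ ω, polySum P A w L q c ω ^ 2 ∂P
      = ∑ i ∈ L, ∑ j ∈ L, q i * q j * ∫ ω, wordSum P A w (c i) ω * wordSum P A w (c j) ω ∂P := by
  have hint : ∀ i j, Integrable (fun ω => q i * wordSum P A w (c i) ω *
      (q j * wordSum P A w (c j) ω)) P := by
    intro i j
    simpa [Fin.prod_univ_two] using
      hA.integrable_prod_mul_wordSum q w c (univ : Finset (Fin 2)) ![i, j]
  simp only [polySum, sq, sum_mul_sum]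
  rw [integral_finsetSum _ fun i _ => integrable_finsetSum _ fun j _ => hint i j]
  refine sum_congr rfl fun i _ => ?_
  rw [integral_finsetSum _ fun j _ => hint i j]
  refine sum_congr rfl fun j _ => ?_
  rw [← integral_const_mul]
  exact integral_congr_ae (ae_of_all _ fun ω => by ring)

include hA in
-- The power is expanded over the length chosen in each of the `k + 2` factors, and the Wick bound
-- is applied to each choice with `i₀ = 0`.
lemma Noise.exists_polySum_recursion_bound (k : ℕ) : ∃ C : ℝ, ∀ w : ℕ, 1 ≤ w →
    ∀ c : ∀ p, (Fin p → ℤ) → ℝ, (∀ p, Admissible w (c p)) →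
      |∫ ω, polySum P A w L q c ω ^ (k + 2) ∂P - (k + 1) *
        (∫ ω, polySum P A w L q c ω ^ 2 ∂P) * ∫ ω, polySum P A w L q c ω ^ k ∂P| * √(w : ℝ)
        ≤ C := by
  choose C hC using fun ℓ : Fin (k + 2) → ℕ => hA.exists_wick_bound ℓ 0
  refine ⟨∑ ℓ ∈ Fintype.piFinset fun _ : Fin (k + 2) => L, |∏ i, q (ℓ i)| * C ℓ,
    fun w hw c hc => ?_⟩
  set z : Fin (k + 2) → ℕ → Ω → ℝ := fun _ p ω => q p * wordSum P A w (c p) ω with hz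
  have hzi : ∀ (V : Finset (Fin (k + 2))) (ℓ : Fin (k + 2) → ℕ),
      Integrable (fun ω => ∏ i ∈ V, z i (ℓ i) ω) P :=
    fun V ℓ => hA.integrable_prod_mul_wordSum q w c V ℓ
  have hexp := fun U => integral_prod_sum_mul (P := P) (fun _ : Fin (k + 2) => L) z U hzi
  have h0 : ∫ ω, polySum P A w L q c ω ^ (k + 2) ∂P
      = ∑ ℓ ∈ Fintype.piFinset fun _ : Fin (k + 2) => L, (∏ i, q (ℓ i)) *
        ∫ ω, ∏ i, wordSum P A w (c (ℓ i)) ω ∂P := by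
    have := integral_prod_sum (P := P) (fun _ : Fin (k + 2) => L) z hzi
    simpa [hz, prod_mul_distrib, integral_const_mul, polySum] using this
  -- After summation over the lengths, each of the `k + 1` partners of `0` gives the same product of
  -- moments; this is the factor `k + 1`.
  have h1 : ∀ j ∈ univ.erase (0 : Fin (k + 2)),
      (∫ ω, polySum P A w L q c ω ^ 2 ∂P) * ∫ ω, polySum P A w L q c ω ^ k ∂P
      = ∑ ℓ ∈ Fintype.piFinset fun _ : Fin (k + 2) => L, (∏ i, q (ℓ i)) *
        ((∫ ω, ∏ i ∈ {0, j}, wordSum P A w (c (ℓ i)) ω ∂P) *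
          ∫ ω, ∏ i ∈ {0, j}ᶜ, wordSum P A w (c (ℓ i)) ω ∂P) := by
    intro j hj
    have hj0 : (0 : Fin (k + 2)) ≠ j := (ne_of_mem_erase hj).symm
    have h2 := hexp {0, j}
    have hcard : #({0, j} : Finset (Fin (k + 2))) = 2 := card_pair hj0
    have hcard' : #({0, j}ᶜ : Finset (Fin (k + 2))) = k := by
      rw [card_compl, hcard, Fintype.card_fin]; omega
    simp only [prod_const, hcard, hcard', hz] at h2
    simp only [polySum]
    rw [h2]
    refine sum_congr rfl fun ℓ _ => ?_
    simp only [prod_mul_distrib, integral_const_mul]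
    rw [← prod_mul_prod_compl {0, j}]
    ring
  have h2 : (k + 1) * (∫ ω, polySum P A w L q c ω ^ 2 ∂P) * ∫ ω, polySum P A w L q c ω ^ k ∂P
      = ∑ ℓ ∈ Fintype.piFinset fun _ : Fin (k + 2) => L, (∏ i, q (ℓ i)) *
        ∑ j ∈ univ.erase 0, (∫ ω, ∏ i ∈ {0, j}, wordSum P A w (c (ℓ i)) ω ∂P) *
          ∫ ω, ∏ i ∈ {0, j}ᶜ, wordSum P A w (c (ℓ i)) ω ∂P := by
    simp_rw [mul_sum]
    rw [sum_comm, ← sum_congr rfl h1, sum_const, card_erase_of_mem (mem_univ _), card_univ,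
      Fintype.card_fin, nsmul_eq_mul, mul_assoc]
    push_cast [Nat.add_sub_cancel]
    simp
  rw [h0, h2, ← sum_sub_distrib]
  simp_rw [← mul_sub]
  calc _ ≤ (∑ ℓ ∈ Fintype.piFinset fun _ : Fin (k + 2) => L, |(∏ i, q (ℓ i)) *
        (∫ ω, ∏ i, wordSum P A w (c (ℓ i)) ω ∂P - ∑ j ∈ univ.erase 0,
          (∫ ω, ∏ i ∈ {0, j}, wordSum P A w (c (ℓ i)) ω ∂P) *
          ∫ ω, ∏ i ∈ {0, j}ᶜ, wordSum P A w (c (ℓ i)) ω ∂P)|) * √(w : ℝ) := by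
        gcongr
        exact abs_sum_le_sum_abs _ _
    _ ≤ _ := by
      rw [sum_mul]
      refine sum_le_sum fun ℓ _ => ?_
      rw [abs_mul, mul_assoc]
      exact mul_le_mul_of_nonneg_left (hC ℓ w hw (fun i => c (ℓ i)) fun i => hc _) (abs_nonneg _)

include hA in
/-- The central limit theorem for sums of word sums with convergent covariances. -/
theorem Noise.tendstoInDistribution_polySum {bw : ℕ → ℕ} (hbw : Tendsto bw atTop atTop)
    {c : ℕ → ∀ p, (Fin p → ℤ) → ℝ} (hc : ∀ n, 1 ≤ n → ∀ p, Admissible (bw n) (c n p))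
    {s : ℕ → ℕ → ℝ} (hs : ∀ i ∈ L, ∀ j ∈ L, Tendsto (fun n => ∫ ω, wordSum P A (bw n) (c n i) ω *
      wordSum P A (bw n) (c n j) ω ∂P) atTop (𝓝 (s i j))) :
    0 ≤ ∑ i ∈ L, ∑ j ∈ L, q i * q j * s i j ∧
    TendstoInDistribution (fun n => polySum P A (bw n) L q (c n)) atTop (id : ℝ → ℝ) (fun _ => P)
      (gaussianReal 0 (∑ i ∈ L, ∑ j ∈ L, q i * q j * s i j).toNNReal) := by
  have hv : Tendsto (fun n => ∫ ω, polySum P A (bw n) L q (c n) ω ^ 2 ∂P) atTop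
      (𝓝 (∑ i ∈ L, ∑ j ∈ L, q i * q j * s i j)) := by
    simp_rw [hA.integral_polySum_sq]
    exact tendsto_finsetSum _ fun i hi => tendsto_finsetSum _ fun j hj =>
      (hs i hi j hj).const_mul _
  -- The limiting variance is non-negative as a limit of second moments.
  have h0 : 0 ≤ ∑ i ∈ L, ∑ j ∈ L, q i * q j * s i j :=
    ge_of_tendsto' hv fun n => integral_nonneg fun ω => sq_nonneg _
  refine ⟨h0, tendstoInDistribution_of_moments (fun n => ?_) h0
    (fun n k => hA.integrable_polySum_pow L q (bw n) (c n) k)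
    (tendsto_moments_of_recursion (fun n => hA.integral_polySum L q _ _) hv fun k => ?_)⟩
  · have := hA.measurable_wordSum
    unfold polySum
    fun_prop
  · obtain ⟨C, hC⟩ := hA.exists_polySum_recursion_bound L q k
    have hw : Tendsto (fun n => C / √(bw n : ℝ)) atTop (𝓝 0) := by
      refine Tendsto.const_div_atTop ?_ C
      exact Real.tendsto_sqrt_atTop.comp (tendsto_natCast_atTop_atTop.comp hbw)
    refine squeeze_zero_norm' ?_ hw
    filter_upwards [eventually_ge_atTop 1, hbw.eventually_ge_atTop 1] with n hn hn'
    rw [Real.norm_eq_abs, le_div_iff₀ (Real.sqrt_pos.2 (by exact_mod_cast hn'))]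
    exact hC (bw n) hn' (c n) (hc n hn)

end WordSumCLT

end ToeplitzBand

end

noncomputable section

namespace ToeplitzBand

set_option linter.unusedSectionVars false

/-! ### Traces as word sums, and the noise extracted from the matrix entries. -/

section Trace

open Finset

/-- The walk from `x` with steps `J` stays in `[0, n)`. -/
def StaysIn (n : ℕ) (x : ℤ) {p : ℕ} (J : Fin p → ℤ) : Prop :=
  ∀ j : Fin p, 0 ≤ x + ∑ l ∈ Iic j, J l ∧ x + ∑ l ∈ Iic j, J l < n

instance (n : ℕ) (x : ℤ) {p : ℕ} (J : Fin p → ℤ) : Decidable (StaysIn n x J) :=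
  inferInstanceAs (Decidable (∀ _, _))

lemma sum_Iic_succ_cons {p : ℕ} (x : ℤ) (J : Fin p → ℤ) (j : Fin p) :
    ∑ l ∈ Iic j.succ, (Fin.cons x J : Fin (p + 1) → ℤ) l = x + ∑ l ∈ Iic j, J l := by
  have h : ∀ {m : ℕ} (i : Fin m), Iic i = univ.filter (· ≤ i) := fun i => by ext; simp
  rw [h, h, sum_filter, sum_filter, Fin.sum_univ_succ]
  simp

lemma sum_Iic_zero_cons {p : ℕ} (x : ℤ) (J : Fin p → ℤ) :
    ∑ l ∈ Iic (0 : Fin (p + 1)), (Fin.cons x J : Fin (p + 1) → ℤ) l = x := by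
  have h : Iic (0 : Fin (p + 1)) = {0} := by ext; simp
  rw [h, sum_singleton, Fin.cons_zero]

lemma staysIn_cons {n : ℕ} {y : ℤ} {p : ℕ} {x : ℤ} {J : Fin p → ℤ} :
    StaysIn n y (Fin.cons x J : Fin (p + 1) → ℤ) ↔ (0 ≤ y + x ∧ y + x < n) ∧
      StaysIn n (y + x) J := by
  simp only [StaysIn, Fin.forall_fin_succ, sum_Iic_zero_cons, sum_Iic_succ_cons, add_assoc]

lemma sum_boxWords_succ {p : ℕ} (w : ℕ) (f : (Fin (p + 1) → ℤ) → ℝ) :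
    ∑ J ∈ boxWords (Fin (p + 1)) w, f J
      = ∑ x ∈ Icc (-(w : ℤ)) w, ∑ J ∈ boxWords (Fin p) w, f (Fin.cons x J) := by
  rw [← sum_product']
  refine sum_nbij' (fun J => (J 0, Fin.tail J)) (fun x => Fin.cons x.1 x.2) ?_ ?_ ?_ ?_ ?_
  · intro J hJ
    simp only [boxWords, Fintype.mem_piFinset, mem_product] at hJ ⊢
    exact ⟨hJ 0, fun i => hJ i.succ⟩
  · rintro ⟨x, J⟩ hJ
    simp only [boxWords, Fintype.mem_piFinset, mem_product] at hJ ⊢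
    exact fun i => Fin.cases hJ.1 hJ.2 i
  · intro J _
    exact Fin.cons_self_tail J
  · rintro ⟨x, J⟩ _
    simp
  · intro J _
    simp [Fin.cons_self_tail]

/-- Substitute the step `x = k - i`; symmetry turns the entry `a (i - k)` into `a x`. Taking `g` on
all of `ℤ` lets the inner walk start at `i + x` without a proof that this is an index. -/
lemma sum_toeplitzBand_mul (a : ℤ → ℝ) (ha : ∀ j, a (-j) = a j) (w n : ℕ) (i : Fin n)
    (g : ℤ → ℝ) :
    ∑ k, toeplitzBand a w n i k * g ((k : ℕ) : ℤ)
      = ∑ x ∈ Icc (-(w : ℤ)) w, if 0 ≤ ((i : ℕ) : ℤ) + x ∧ ((i : ℕ) : ℤ) + x < n then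
        a x * g (((i : ℕ) : ℤ) + x) else 0 := by
  simp only [toeplitzBand, Matrix.of_apply, ite_mul, zero_mul]
  rw [← sum_filter, ← sum_filter]
  refine sum_bij (fun k _ => ((k : ℕ) : ℤ) - ((i : ℕ) : ℤ)) ?_ ?_ ?_ ?_
  · intro k hk
    simp only [mem_filter, Finset.mem_univ, true_and, mem_Icc, abs_le] at hk ⊢
    omega
  · intro k _ k' _ h
    ext
    omega
  · intro x hx
    simp only [mem_filter, mem_Icc] at hx
    refine ⟨⟨(((i : ℕ) : ℤ) + x).toNat, by omega⟩, ?_, ?_⟩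
    · simp only [mem_filter, Finset.mem_univ, true_and, abs_le]; omega
    · simp only; omega
  · intro k _
    rw [← ha, neg_sub, add_sub_cancel]

lemma toeplitzBand_pow_apply (a : ℤ → ℝ) (ha : ∀ j, a (-j) = a j) (w n p : ℕ) (j : Fin n) :
    ∀ i : Fin n, (toeplitzBand a w n ^ p) i j
      = ∑ J ∈ boxWords (Fin p) w, if StaysIn n ((i : ℕ) : ℤ) J ∧
        ((i : ℕ) : ℤ) + ∑ t, J t = ((j : ℕ) : ℤ) then ∏ t, a (J t) else 0 := by
  induction p with
  | zero =>
    intro i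
    have h : boxWords (Fin 0) w = {fun _ => 0} := by
      ext J; simp [boxWords, eq_iff_true_of_subsingleton]
    rw [h, sum_singleton, pow_zero, Matrix.one_apply]
    simp [StaysIn, Fin.ext_iff]
  | succ p ih =>
    intro i
    rw [pow_succ', Matrix.mul_apply]
    simp_rw [ih]
    rw [sum_toeplitzBand_mul a ha w n i fun y => ∑ J ∈ boxWords (Fin p) w,
      if StaysIn n y J ∧ y + ∑ t, J t = ((j : ℕ) : ℤ) then ∏ t, a (J t) else 0, sum_boxWords_succ]
    refine sum_congr rfl fun x _ => ?_
    simp only [staysIn_cons, Fin.sum_univ_succ, Fin.prod_univ_succ, Fin.cons_zero, Fin.cons_succ,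
      add_assoc, and_assoc]
    split_ifs with h
    · rw [mul_sum]
      refine sum_congr rfl fun J _ => ?_
      simp [h]
    · symm
      refine sum_eq_zero fun J _ => if_neg ?_
      tauto

/-- The number of starting points in `[0, n)` from which the walk with steps `J` stays in
`[0, n)`. -/
def stayCount (n : ℕ) {p : ℕ} (J : Fin p → ℤ) : ℕ :=
  #{i : Fin n | StaysIn n ((i : ℕ) : ℤ) J}

/-- The coefficient of the word `J` in the trace of a power of the scaled Toeplitz matrix. -/
def bandCoeff (n w : ℕ) {p : ℕ} (J : Fin p → ℤ) : ℝ :=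
  if ∑ t, J t = 0 then (√(w : ℝ))⁻¹ ^ p * stayCount n J else 0

lemma trace_scaledToeplitz_pow {Ω : Type*} {a : ℤ → Ω → ℝ} (hsymm : ∀ j, a (-j) = a j)
    (bw : ℕ → ℕ) (n p : ℕ) (ω : Ω) :
    (scaledToeplitz a bw n ω ^ p).trace
      = ∑ J ∈ boxWords (Fin p) (bw n), bandCoeff n (bw n) J * ∏ t, a ((J t).natAbs : ℤ) ω := by
  have habs : ∀ x : ℤ, a x ω = a (x.natAbs : ℤ) ω := by
    intro x
    rcases Int.natAbs_eq x with h | h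
    · rw [← h]
    · conv_lhs => rw [h, hsymm]
  rw [scaledToeplitz, smul_pow, Matrix.trace_smul, Matrix.trace]
  simp only [Matrix.diag_apply, smul_eq_mul]
  simp_rw [toeplitzBand_pow_apply (fun j => a j ω) (fun j => by rw [hsymm])]
  rw [sum_comm, mul_sum]
  refine sum_congr rfl fun J _ => ?_
  simp only [add_eq_left, bandCoeff, stayCount]
  by_cases h : ∑ t, J t = 0
  · simp only [h, and_true, if_true]
    rw [← sum_filter, sum_const, nsmul_eq_mul, mul_assoc]
    simp_rw [fun t => habs (J t)]
  · simp [h]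

lemma stayCount_le (n : ℕ) {p : ℕ} (J : Fin p → ℤ) : stayCount n J ≤ n :=
  (card_le_univ _).trans (by simp)

/-- The coefficients of the words in the rescaled trace. -/
def fluctCoeff (n w p : ℕ) (J : Fin p → ℤ) : ℝ := √(w : ℝ) / n * bandCoeff n w J

/-- The coefficient is `√w · w^{-p/2}` times a proportion of starting points, which is at most `1`.
-/
lemma admissible_fluctCoeff {n : ℕ} (hn : 1 ≤ n) (w p : ℕ) : Admissible w (fluctCoeff n w p) := by
  have hn0 : (0 : ℝ) < n := by exact_mod_cast hn
  refine ⟨fun J hJ => ?_, fun J => ?_⟩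
  · by_contra h
    exact hJ (by simp [fluctCoeff, bandCoeff, h])
  · rcases eq_or_ne w 0 with rfl | hw
    · simp [fluctCoeff]
    have hw0 : 0 < √(w : ℝ) := Real.sqrt_pos.2 (by exact_mod_cast Nat.pos_of_ne_zero hw)
    rw [fluctCoeff, bandCoeff]
    split_ifs
    · have hle : (stayCount n J : ℝ) / n ≤ 1 := by
        rw [div_le_one hn0]; exact_mod_cast stayCount_le n J
      rw [abs_of_nonneg (by positivity)]
      calc _ = √(w : ℝ) * (stayCount n J / n) * ((√(w : ℝ))⁻¹ * √(w : ℝ)) ^ p := by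
            rw [mul_pow]; ring
        _ = √(w : ℝ) * (stayCount n J / n) := by rw [inv_mul_cancel₀ hw0.ne']; simp
        _ ≤ √(w : ℝ) := mul_le_of_le_one_right hw0.le hle
    · simp

variable {Ω : Type*} [MeasurableSpace Ω] {P : Measure Ω} [IsProbabilityMeasure P]

/-- Adjoining a constant keeps independence: its preimages are empty or the whole space. -/
lemma iIndepFun_of_shift {f : ℕ → Ω → ℝ} (hf : iIndepFun (fun j => f (j + 1)) P)
    (h0 : ∀ ω, f 0 ω = 0) : iIndepFun f P := by
  rw [iIndepFun_iff_measure_inter_preimage_eq_mul] at hf ⊢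
  intro S sets hsets
  set S₁ : Finset ℕ := S.preimage (· + 1) (fun _ _ _ _ h => Nat.succ_injective h) with hS₁
  have hmem : ∀ u, u ∈ S₁ ↔ u + 1 ∈ S := fun u => Finset.mem_preimage (f := (· + 1))
  have h1 := hf S₁ (sets := fun j => sets (j + 1)) fun j hj =>
    hsets (j + 1) ((hmem j).1 hj)
  have himg : S.erase 0 = S₁.image (· + 1) := by
    ext v
    simp only [mem_erase, mem_image, hmem]
    constructor
    · rintro ⟨hv, hvS⟩
      obtain ⟨u, rfl⟩ := Nat.exists_eq_succ_of_ne_zero hv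
      exact ⟨u, hvS, rfl⟩
    · rintro ⟨u, hu, rfl⟩
      exact ⟨u.succ_ne_zero, hu⟩
  have h2 : P (⋂ i ∈ S.erase 0, f i ⁻¹' sets i) = ∏ i ∈ S.erase 0, P (f i ⁻¹' sets i) := by
    rw [himg, prod_image (fun _ _ _ _ h => Nat.succ_injective h), ← h1]
    congr 1
    ext ω
    simp
  by_cases hS : 0 ∈ S
  swap
  · rwa [erase_eq_of_notMem hS] at h2
  rw [← insert_erase hS, prod_insert (notMem_erase _ _), ← h2, set_biInter_insert]
  by_cases hs : (0 : ℝ) ∈ sets 0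
  · have : f 0 ⁻¹' sets 0 = Set.univ := by ext ω; simp [h0, hs]
    rw [this, Set.univ_inter, measure_univ, one_mul]
  · have : f 0 ⁻¹' sets 0 = ∅ := by ext ω; simp [h0, hs]
    rw [this, Set.empty_inter, measure_empty, zero_mul]

lemma noise_of_hypotheses {a : ℤ → Ω → ℝ} (hmeas : ∀ j, Measurable (a j))
    (hzero : ∀ ω, a 0 ω = 0) (hindep : iIndepFun (fun j : ℕ => a ((j : ℤ) + 1)) P)
    (hmean : ∀ j : ℤ, 1 ≤ j → ∫ ω, a j ω ∂P = 0)
    (hbdd : ∀ k : ℕ, 3 ≤ k → ∃ C : ℝ, ∀ j : ℤ, 1 ≤ j →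
      Integrable (fun ω => |a j ω| ^ k) P ∧ ∫ ω, |a j ω| ^ k ∂P ≤ C) :
    Noise P fun v : ℕ => a (v : ℤ) where
  meas v := hmeas v
  indep := iIndepFun_of_shift (by simpa using hindep) (by simpa using hzero)
  zero ω := by simpa using hzero ω
  mean v := by
    rcases Nat.eq_zero_or_pos v with rfl | hv
    · simp [hzero]
    · exact hmean v (by exact_mod_cast hv)
  moment k := by
    -- The shift by `3` reaches the range of the moment hypothesis, and `|x| ^ k ≤ 1 + |x| ^ (k +
    -- 3)` then covers the low orders as well.
    obtain ⟨C, hC⟩ := hbdd (k + 3) (by omega)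
    have hle : ∀ x : ℝ, |x| ^ k ≤ 1 + |x| ^ (k + 3) := by
      intro x
      rcases le_total |x| 1 with h | h
      · have := pow_le_one₀ (abs_nonneg x) h (n := k)
        have := pow_nonneg (abs_nonneg x) (k + 3)
        linarith
      · have := pow_le_pow_right₀ h (show k ≤ k + 3 by omega)
        linarith
    refine ⟨1 + |C|, fun v => ?_⟩
    have h3 : Integrable (fun ω => |a v ω| ^ (k + 3)) P ∧ ∫ ω, |a v ω| ^ (k + 3) ∂P ≤ |C| := by
      rcases Nat.eq_zero_or_pos v with rfl | hv
      · simp [hzero]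
      · have := hC v (by exact_mod_cast hv)
        exact ⟨this.1, this.2.trans (le_abs_self C)⟩
    have hdom : Integrable (fun ω => 1 + |a v ω| ^ (k + 3)) P := (integrable_const _).add h3.1
    have hi : Integrable (fun ω => |a v ω| ^ k) P := by
      have hm := hmeas v
      refine hdom.mono' (by fun_prop) (ae_of_all _ fun ω => ?_)
      rw [Real.norm_of_nonneg (by positivity)]
      exact hle _
    refine ⟨hi, (integral_mono hi hdom fun ω => hle _).trans ?_⟩
    rw [integral_add (integrable_const _) h3.1]
    simpa using h3.2

variable {A : ℕ → Ω → ℝ} (hA : Noise P A)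

include hA in
lemma Noise.integrable_prod {p : ℕ} (J : Fin p → ℤ) :
    Integrable (fun ω => ∏ t, A (J t).natAbs ω) P := by
  refine (hA.integrable_wordProd (vt := fun _ : Fin p => ()) (K := J) ()).congr
    (ae_of_all _ fun ω => ?_)
  simp [wordProd]

lemma trace_aeval_testPoly {a : ℤ → Ω → ℝ} (hsymm : ∀ j, a (-j) = a j) (bw : ℕ → ℕ) (n p : ℕ)
    (c : ℕ → ℝ) (ω : Ω) :
    (Polynomial.aeval (scaledToeplitz a bw n ω) (testPoly p c)).trace
      = ∑ k ∈ Icc 2 p, c k * ∑ J ∈ boxWords (Fin k) (bw n),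
        bandCoeff n (bw n) J * ∏ t, a ((J t).natAbs : ℤ) ω := by
  simp only [testPoly, map_sum, map_mul, Polynomial.aeval_C, Polynomial.aeval_X, map_pow,
    Matrix.trace_sum]
  refine sum_congr rfl fun k _ => ?_
  rw [← trace_scaledToeplitz_pow hsymm, ← Algebra.smul_def, Matrix.trace_smul, smul_eq_mul]

lemma integrable_trace_aeval {a : ℤ → Ω → ℝ} (hA : Noise P fun v : ℕ => a (v : ℤ))
    (hsymm : ∀ j, a (-j) = a j) (bw : ℕ → ℕ) (n p : ℕ) (c : ℕ → ℝ) :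
    Integrable (fun ω => (Polynomial.aeval (scaledToeplitz a bw n ω) (testPoly p c)).trace) P := by
  simp_rw [trace_aeval_testPoly hsymm]
  exact integrable_finsetSum _ fun k _ => (integrable_finsetSum _ fun J _ =>
    (hA.integrable_prod J).const_mul _).const_mul _

lemma fluctuation_trace_aeval {a : ℤ → Ω → ℝ} (hA : Noise P fun v : ℕ => a (v : ℤ))
    (hsymm : ∀ j, a (-j) = a j) (bw : ℕ → ℕ) (n p : ℕ) (c : ℕ → ℝ) (ω : Ω) :
    fluctuation P bw n
      (fun ω => (Polynomial.aeval (scaledToeplitz a bw n ω) (testPoly p c)).trace) ω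
      = polySum P (fun v : ℕ => a (v : ℤ)) (bw n) (Icc 2 p) c (fluctCoeff n (bw n)) ω := by
  simp only [fluctuation]
  simp_rw [trace_aeval_testPoly hsymm]
  rw [integral_finsetSum _ fun k _ => (integrable_finsetSum _ fun J _ =>
    (hA.integrable_prod J).const_mul _).const_mul _, ← sum_sub_distrib, mul_sum, polySum]
  refine sum_congr rfl fun k _ => ?_
  rw [integral_const_mul, integral_finsetSum _ fun J _ => (hA.integrable_prod J).const_mul _,
    ← mul_sub, ← sum_sub_distrib, mul_left_comm, mul_sum, wordSum]
  congr 1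
  refine sum_congr rfl fun J _ => ?_
  rw [integral_const_mul, ← mul_sub, centredProd, fluctCoeff, mul_assoc]

end Trace

end ToeplitzBand

end

noncomputable section

namespace ToeplitzBand

set_option linter.unusedSectionVars false

/-! ### Exact values of the covariance of two words. -/

section PairMoments

open Finset

variable {Ω : Type*} [MeasurableSpace Ω] {P : Measure Ω} [IsProbabilityMeasure P]
  {A : ℕ → Ω → ℝ} (hA : Noise P A) {T : Type*} [Fintype T] {vt : T → Bool} {K : T → ℤ}

include hA in
lemma Noise.integral_prod_subset (U : Finset T) :
    ∫ ω, ∏ t ∈ U, A (K t).natAbs ω ∂P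
      = ∏ v ∈ absValues K, ∫ ω, A v ω ^ #{t ∈ U | (K t).natAbs = v} ∂P := by
  have h1 : ∀ ω, ∏ t ∈ U, A (K t).natAbs ω
      = ∏ v : ↥(absValues K), A v ω ^ #{t ∈ U | (K t).natAbs = v} := by
    intro ω
    rw [prod_coe_sort (absValues K) fun v => A v ω ^ #{t ∈ U | (K t).natAbs = v},
      ← prod_fiberwise_of_maps_to (g := fun t => (K t).natAbs) (t := absValues K)
      (fun t _ => natAbs_mem_absValues t)]
    refine prod_congr rfl fun v _ => ?_
    rw [← prod_const]
    exact prod_congr rfl fun t ht => by rw [(mem_filter.1 ht).2]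
  simp_rw [h1]
  have hi : iIndepFun (fun v : ↥(absValues K) => A v) P := hA.indep.precomp Subtype.val_injective
  have h2 := iIndepFun.integral_fun_prod_comp
    (X := fun v : ↥(absValues K) => A v) (f := fun v x => x ^ #{t ∈ U | (K t).natAbs = v})
    hi (fun v => (hA.meas v).aemeasurable)
    (fun v => (by fun_prop : Measurable fun x : ℝ => x ^ _).aestronglyMeasurable)
  rw [h2, prod_coe_sort (absValues K) fun v => ∫ ω, A v ω ^ #{t ∈ U | (K t).natAbs = v} ∂P]

include hA in
lemma Noise.integral_wordProd (i : Bool) :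
    ∫ ω, wordProd vt K A i ω ∂P = ∏ v ∈ absValues K, ∫ ω, A v ω ^ mult vt K i v ∂P := by
  simp only [wordProd]
  rw [hA.integral_prod_subset]
  simp only [filter_filter, mult]

include hA in
lemma Noise.mixedMoment_bool :
    mixedMoment vt K P A univ = ∏ v ∈ absValues K, ∫ ω, A v ω ^ tot K v ∂P -
      (∫ ω, wordProd vt K A true ω ∂P) * ∫ ω, wordProd vt K A false ω ∂P := by
  have h1 : ∀ ω, ∏ t, A (K t).natAbs ω = wordProd vt K A true ω * wordProd vt K A false ω := by
    intro ω
    rw [← prod_fiberwise univ vt, Fintype.prod_bool]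
    rfl
  have h2 : Integrable (fun ω => wordProd vt K A true ω * wordProd vt K A false ω) P := by
    refine (hA.integrable_wordProd (vt := fun _ : T => ()) (K := K) ()).congr
      (ae_of_all _ fun ω => ?_)
    simp only [← h1]
    simp [wordProd]
  have h3 := hA.integral_prod_subset (K := K) univ
  simp only [h1] at h3
  have ht := hA.integrable_wordProd (vt := vt) (K := K) true
  have hf := hA.integrable_wordProd (vt := vt) (K := K) false
  simp only [mixedMoment, Fintype.prod_bool, centredWord]
  rw [show (∏ v ∈ absValues K, ∫ ω, A v ω ^ tot K v ∂P)
    = ∫ ω, wordProd vt K A true ω * wordProd vt K A false ω ∂P from h3.symm]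
  set ct := ∫ ω, wordProd vt K A true ω ∂P with hct
  set cf := ∫ ω, wordProd vt K A false ω ∂P with hcf
  have h4 : ∀ ω, (wordProd vt K A true ω - ct) * (wordProd vt K A false ω - cf)
      = wordProd vt K A true ω * wordProd vt K A false ω - cf * wordProd vt K A true ω
        - ct * wordProd vt K A false ω + ct * cf := fun ω => by ring
  simp_rw [h4]
  have h5 : Integrable (fun ω => wordProd vt K A true ω * wordProd vt K A false ω
      - cf * wordProd vt K A true ω) P := h2.sub (ht.const_mul _)
  have h6 : Integrable (fun ω => wordProd vt K A true ω * wordProd vt K A false ω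
      - cf * wordProd vt K A true ω - ct * wordProd vt K A false ω) P := h5.sub (hf.const_mul _)
  rw [integral_add h6 (integrable_const _), integral_sub h5 (hf.const_mul _),
    integral_sub h2 (ht.const_mul _), integral_const_mul, integral_const_mul, ← hct, ← hcf]
  simp
  ring

variable (hvar : ∀ v, 1 ≤ v → ∫ ω, A v ω ^ 2 ∂P = 1)

lemma one_le_of_mem_absValues (h0 : ∀ t, K t ≠ 0) {v : ℕ} (hv : v ∈ absValues K) : 1 ≤ v := by
  obtain ⟨t, -, rfl⟩ := mem_image.1 hv
  have := h0 t
  omega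

include hA hvar in
-- The joint expectation is a product of second moments, while a value occurring once in the first
-- word makes that word's mean vanish.
lemma Noise.mixedMoment_of_pairs (h0 : ∀ t, K t ≠ 0) (h2 : ∀ v ∈ absValues K, tot K v = 2)
    {v : ℕ} (hv : mult vt K false v = 1) : mixedMoment vt K P A univ = 1 := by
  rw [hA.mixedMoment_bool, hA.integral_wordProd false, prod_eq_one, prod_eq_zero (i := v),
    mul_zero, sub_zero]
  · exact mem_absValues_of_mult_pos (vt := vt) (i := false) (by omega)
  · rw [hv]; simpa using hA.mean v
  · intro u hu
    rw [h2 u hu, hvar u (one_le_of_mem_absValues h0 hu)]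

include hA hvar in
-- Both words have mean `1`, being products of second moments, and the shared value contributes the
-- fourth moment to the joint expectation.
lemma Noise.mixedMoment_of_pairs_four {κ : ℝ} (hfourth : ∀ v, 1 ≤ v → ∫ ω, A v ω ^ 4 ∂P = κ)
    (h0 : ∀ t, K t ≠ 0) {v : ℕ} (hf : mult vt K false v = 2) (ht : mult vt K true v = 2)
    (h2 : ∀ u ∈ absValues K, u ≠ v → tot K u = 2 ∧ (mult vt K false u = 0 ∨ mult vt K true u = 0)) :
    mixedMoment vt K P A univ = κ - 1 := by
  have htot : ∀ u, tot K u = mult vt K true u + mult vt K false u := fun u => by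
    rw [tot_eq_sum_mult (vt := vt), Fintype.sum_bool]
  have h1 : ∀ i, ∫ ω, wordProd vt K A i ω ∂P = 1 := by
    intro i
    rw [hA.integral_wordProd]
    refine prod_eq_one fun u hu => ?_
    have hu1 := hvar u (one_le_of_mem_absValues h0 hu)
    have h02 : mult vt K i u = 0 ∨ mult vt K i u = 2 := by
      by_cases huv : u = v
      · subst huv; cases i <;> simp [hf, ht]
      · obtain ⟨h3, h4⟩ := h2 u hu huv
        have := htot u
        cases i <;> omega
    rcases h02 with h | h
    · simp [h]
    · rw [h, hu1]
  have hv : v ∈ absValues K := mem_absValues_of_mult_pos (vt := vt) (i := false) (by omega)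
  rw [hA.mixedMoment_bool, h1, h1, mul_one, prod_eq_single_of_mem v hv, htot, hf, ht,
    hfourth v (one_le_of_mem_absValues h0 hv)]
  intro u hu huv
  rw [(h2 u hu huv).1, hvar u (one_le_of_mem_absValues h0 hu)]

end PairMoments

/-! ### Partitions read off from words, and words assembled from block values. -/

section Partitions

open Finset

variable {p q : ℕ}

/-- The half of `[p + q]` that an element lies in. -/
def side (p q : ℕ) : Fin (p + q) → Bool := Fin.addCases (fun _ => false) fun _ => true

@[simp] lemma side_castAdd (i : Fin p) : side p q (Fin.castAdd q i) = false := by simp [side]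

@[simp] lemma side_natAdd (i : Fin q) : side p q (Fin.natAdd p i) = true := by simp [side]

lemma eq_castAdd_of_side {i : Fin (p + q)} (h : side p q i = false) :
    ∃ j, i = Fin.castAdd q j := by
  induction i using Fin.addCases with
  | left j => exact ⟨j, rfl⟩
  | right j => simp at h

lemma eq_natAdd_of_side {i : Fin (p + q)} (h : side p q i = true) : ∃ j, i = Fin.natAdd p j := by
  induction i using Fin.addCases with
  | left j => simp at h
  | right j => exact ⟨j, rfl⟩

lemma lt_of_side {i j : Fin (p + q)} (hi : side p q i = false) (hj : side p q j = true) :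
    i < j := by
  obtain ⟨i, rfl⟩ := eq_castAdd_of_side hi
  obtain ⟨j, rfl⟩ := eq_natAdd_of_side hj
  rw [Fin.lt_def]
  simp only [Fin.val_castAdd, Fin.val_natAdd]
  omega

/-- The partition `π` is the one given by the absolute values of the entries of `K`. -/
def Matches {m : ℕ} (π : Partition m) (K : Fin m → ℤ) : Prop :=
  ∀ i j, i ∈ π.part j ↔ (K i).natAbs = (K j).natAbs

lemma partition_ext {m : ℕ} {π π' : Partition m} (h : ∀ i, π.part i = π'.part i) : π = π' := by
  have key : ∀ {π π' : Partition m}, (∀ i, π.part i = π'.part i) → π.parts ⊆ π'.parts := by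
    intro π π' h V hV
    obtain ⟨i, hi⟩ := π.nonempty_of_mem_parts hV
    rw [← π.part_eq_of_mem hV hi, h i]
    exact π'.part_mem.2 (mem_univ i)
  exact Finpartition.ext (Subset.antisymm (key h) (key fun i => (h i).symm))

lemma Matches.unique {m : ℕ} {π π' : Partition m} {K : Fin m → ℤ} (h : Matches π K)
    (h' : Matches π' K) : π = π' :=
  partition_ext fun j => by ext i; rw [h i j, h' i j]

lemma exists_matches {m : ℕ} (K : Fin m → ℤ) : ∃ π : Partition m, Matches π K := by
  let s : Setoid (Fin m) := Setoid.ker fun i => (K i).natAbs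
  have : DecidableRel s.r := fun i j => inferInstanceAs (Decidable ((K i).natAbs = (K j).natAbs))
  exact ⟨Finpartition.ofSetoid s, fun i j => by
    rw [Finpartition.mem_part_ofSetoid_iff_rel]
    exact eq_comm⟩

lemma exists_part_eq {m : ℕ} {π : Partition m} {V : Finset (Fin m)} (hV : V ∈ π.parts) :
    ∃ i, V = π.part i := by
  obtain ⟨i, hi⟩ := π.nonempty_of_mem_parts hV
  exact ⟨i, (π.part_eq_of_mem hV hi).symm⟩

namespace Matches

variable {π : Partition (p + q)} {K : Fin (p + q) → ℤ} (h : Matches π K)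
include h

lemma tot_eq (j : Fin (p + q)) : tot K (K j).natAbs = #(π.part j) := by
  rw [tot]
  congr 1
  ext i
  rw [mem_filter, h i j]
  simp

lemma mult_false (j : Fin (p + q)) :
    mult (side p q) K false (K j).natAbs = #{i : Fin p | Fin.castAdd q i ∈ π.part j} := by
  rw [mult, card_filter, card_filter, Fin.sum_univ_add]
  simp [h _ j]

lemma mult_true (j : Fin (p + q)) :
    mult (side p q) K true (K j).natAbs = #{i : Fin q | Fin.natAdd p i ∈ π.part j} := by
  rw [mult, card_filter, card_filter, Fin.sum_univ_add]
  simp [h _ j]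

lemma isCrossing_iff (j : Fin (p + q)) :
    IsCrossing p q (π.part j) ↔ Crosses (side p q) K (K j).natAbs := by
  have h1 : Crosses (side p q) K (K j).natAbs ↔ 0 < mult (side p q) K false (K j).natAbs ∧
      0 < mult (side p q) K true (K j).natAbs := by
    constructor
    · rintro ⟨i, i', hne, hi, hi'⟩
      cases i <;> cases i' <;> first | exact absurd rfl hne | exact ⟨hi, hi'⟩ | exact ⟨hi', hi⟩
    · rintro ⟨h1, h2⟩
      exact ⟨false, true, by simp, h1, h2⟩
  rw [h1, h.mult_false, h.mult_true, IsCrossing, card_pos, card_pos]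
  simp [Finset.Nonempty]

end Matches

open Classical in
/-- The integer version of `epsSign`. -/
def epsInt {m : ℕ} (π : Partition m) (i : Fin m) : ℤ := if ∀ j ∈ π.part i, i ≤ j then 1 else -1

open Classical in
/-- The integer version of `tauSign`. -/
def tauInt {m : ℕ} (π : Partition m) (i : Fin m) : ℤ :=
  if (∀ j ∈ π.part i, i ≤ j) ∨ ((π.part i).card = 4 ∧ ∀ j ∈ π.part i, j ≤ i) then 1 else -1

lemma epsInt_cast {m : ℕ} (π : Partition m) (i : Fin m) : (epsInt π i : ℝ) = epsSign π i := by
  simp only [epsInt, epsSign]; split_ifs <;> simp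

lemma tauInt_cast {m : ℕ} (π : Partition m) (i : Fin m) : (tauInt π i : ℝ) = tauSign π i := by
  simp only [tauInt, tauSign]; split_ifs <;> simp

lemma epsInt_eq_or {m : ℕ} (π : Partition m) (i : Fin m) : epsInt π i = 1 ∨ epsInt π i = -1 := by
  simp only [epsInt]; split_ifs <;> simp

lemma tauInt_eq_or {m : ℕ} (π : Partition m) (i : Fin m) : tauInt π i = 1 ∨ tauInt π i = -1 := by
  simp only [tauInt]; split_ifs <;> simp

/-- The sign `1` on the first half and `s` on the second half of `[p + q]`. -/
def sideSign (p q : ℕ) (s : ℤ) (i : Fin (p + q)) : ℤ := if side p q i then s else 1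

/-- The word with the block values `x`, the signs `sgn`, and the additional sign `s` on the second
half. -/
def assemble (π : Partition (p + q)) (sgn : Fin (p + q) → ℤ) (s : ℤ) (x : π.parts → ℤ)
    (i : Fin (p + q)) : ℤ :=
  sideSign p q s i * (sgn i * x (blockOf π i))

/-- Block values that are non-zero and have distinct absolute values. -/
def IsGeneric {β : Type*} (x : β → ℤ) : Prop :=
  (∀ V, x V ≠ 0) ∧ ∀ V W, V ≠ W → (x V).natAbs ≠ (x W).natAbs

/-- The words assembled from generic block values. -/
def genericWords (π : Partition (p + q)) (sgn : Fin (p + q) → ℤ) (s : ℤ) :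
    Set (Fin (p + q) → ℤ) :=
  {K | ∃ x, IsGeneric x ∧ K = assemble π sgn s x}

lemma blockOf_eq_iff {m : ℕ} {π : Partition m} {i j : Fin m} :
    blockOf π i = blockOf π j ↔ i ∈ π.part j := by
  rw [π.mem_part_iff_part_eq_part (mem_univ i) (mem_univ j), blockOf, blockOf, Subtype.mk.injEq]

section Generic

variable {π : Partition (p + q)} {sgn : Fin (p + q) → ℤ} {s : ℤ}
  (hsgn : ∀ i, sgn i = 1 ∨ sgn i = -1) (hs : s = 1 ∨ s = -1)
include hsgn hs

lemma natAbs_assemble (x : π.parts → ℤ) (i : Fin (p + q)) :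
    (assemble π sgn s x i).natAbs = (x (blockOf π i)).natAbs := by
  have h1 : (sideSign p q s i).natAbs = 1 := by
    simp only [sideSign]; rcases hs with rfl | rfl <;> split_ifs <;> simp
  have h2 : (sgn i).natAbs = 1 := by rcases hsgn i with h | h <;> simp [h]
  rw [assemble, Int.natAbs_mul, Int.natAbs_mul, h1, h2, one_mul, one_mul]

lemma matches_of_mem_genericWords {K : Fin (p + q) → ℤ} (hK : K ∈ genericWords π sgn s) :
    Matches π K := by
  obtain ⟨x, hx, rfl⟩ := hK
  intro i j
  rw [natAbs_assemble hsgn hs, natAbs_assemble hsgn hs, ← blockOf_eq_iff]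
  exact ⟨fun h => by rw [h], fun h => by_contra fun h' => hx.2 _ _ h' h⟩

lemma ne_zero_of_mem_genericWords {K : Fin (p + q) → ℤ} (hK : K ∈ genericWords π sgn s)
    (i : Fin (p + q)) : K i ≠ 0 := by
  obtain ⟨x, hx, rfl⟩ := hK
  rw [← Int.natAbs_ne_zero, natAbs_assemble hsgn hs, Int.natAbs_ne_zero]
  exact hx.1 _

/-- A crossing block shows its value in the first half, where `s` does not enter, and `s` times its
value, up to a known sign, in the second half. The value is non-zero. -/
lemma sign_unique {s' : ℤ} {V : Finset (Fin (p + q))} (hV : V ∈ π.parts) (hc : IsCrossing p q V)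
    {K : Fin (p + q) → ℤ} (hK : K ∈ genericWords π sgn s) (hK' : K ∈ genericWords π sgn s') :
    s = s' := by
  obtain ⟨x, hx, rfl⟩ := hK
  obtain ⟨x', hx', h⟩ := hK'
  obtain ⟨⟨i, hi⟩, ⟨j, hj⟩⟩ := hc
  have h1 := congrFun h (Fin.castAdd q i)
  have h2 := congrFun h (Fin.natAdd p j)
  have hbi : blockOf π (Fin.castAdd q i) = ⟨V, hV⟩ := Subtype.ext (π.part_eq_of_mem hV hi)
  have hbj : blockOf π (Fin.natAdd p j) = ⟨V, hV⟩ := Subtype.ext (π.part_eq_of_mem hV hj)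
  simp only [assemble, sideSign, side_castAdd, side_natAdd, hbi, hbj, if_true, one_mul,
    Bool.false_eq_true, if_false] at h1 h2
  have hi0 : sgn (Fin.castAdd q i) ≠ 0 := by
    rcases hsgn (Fin.castAdd q i) with h | h <;> simp [h]
  have hj0 : sgn (Fin.natAdd p j) ≠ 0 := by
    rcases hsgn (Fin.natAdd p j) with h | h <;> simp [h]
  have hxx := mul_left_cancel₀ hi0 h1
  rw [← hxx] at h2
  exact mul_right_cancel₀ (mul_ne_zero hj0 (hx.1 _)) h2

end Generic

end Partitions

end ToeplitzBand

end

noncomputable section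

namespace ToeplitzBand

set_option linter.unusedSectionVars false

/-! ### Regular pairs of words are generic words of one of the two partition types. -/

section Classification

open Finset

variable {p q : ℕ} {π : Partition (p + q)} {K : Fin (p + q) → ℤ} {s : ℤ}

lemma mem_part_self' {m : ℕ} (π : Partition m) (i : Fin m) : i ∈ π.part i :=
  π.mem_part_self.2 (mem_univ i)

/-- The smallest element of the block of `i`. -/
def blockMin {m : ℕ} (π : Partition m) (i : Fin m) : Fin m :=
  (π.part i).min' ⟨i, mem_part_self' π i⟩

lemma blockMin_mem {m : ℕ} (π : Partition m) (i : Fin m) : blockMin π i ∈ π.part i := min'_mem _ _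

lemma blockMin_le {m : ℕ} {π : Partition m} {i j : Fin m} (h : j ∈ π.part i) : blockMin π i ≤ j :=
  min'_le _ _ h

lemma part_eq_of_mem_part {m : ℕ} {π : Partition m} {i j : Fin m} (h : i ∈ π.part j) :
    π.part i = π.part j :=
  (π.mem_part_iff_part_eq_part (mem_univ i) (mem_univ j)).1 h

lemma blockMin_congr {m : ℕ} {π : Partition m} {i j : Fin m} (h : i ∈ π.part j) :
    blockMin π i = blockMin π j := by
  simp only [blockMin, part_eq_of_mem_part h]

lemma isMin_iff {m : ℕ} {π : Partition m} {i : Fin m} :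
    (∀ j ∈ π.part i, i ≤ j) ↔ i = blockMin π i := by
  constructor
  · intro h
    exact le_antisymm (h _ (blockMin_mem π i)) (blockMin_le (mem_part_self' π i))
  · intro h j hj
    rw [h]
    exact blockMin_le hj

lemma epsInt_eq {m : ℕ} (π : Partition m) (i : Fin m) :
    epsInt π i = if i = blockMin π i then 1 else -1 := by
  simp only [epsInt, isMin_iff]

lemma tauInt_eq_of_card {m : ℕ} {π : Partition m} {i : Fin m} (h : #(π.part i) = 2) :
    tauInt π i = if i = blockMin π i then 1 else -1 := by
  simp only [tauInt, isMin_iff, h]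
  simp

lemma sideSign_mul_self (hs : s = 1 ∨ s = -1) (i : Fin (p + q)) :
    sideSign p q s i * sideSign p q s i = 1 := by
  simp only [sideSign]; rcases hs with rfl | rfl <;> split_ifs <;> simp

/-- The block value is read off at the smallest element, with the sign of its half undone.
Genericity is automatic from `Matches`, so only the signs within blocks remain to be checked. -/
lemma mem_genericWords_of (hπ : Matches π K) (h0 : ∀ t, K t ≠ 0) (hs : s = 1 ∨ s = -1)
    {sgn : Fin (p + q) → ℤ}
    (hK : ∀ i, K i = sideSign p q s i * (sgn i *
      (sideSign p q s (blockMin π i) * K (blockMin π i)))) :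
    K ∈ genericWords π sgn s := by
  have hne : ∀ W : π.parts, ∃ i, i ∈ (W : Finset (Fin (p + q))) := fun W =>
    π.nonempty_of_mem_parts W.2
  choose rep hrep using hne
  have hside : ∀ i, (sideSign p q s i).natAbs = 1 := fun i => by
    simp only [sideSign]; rcases hs with rfl | rfl <;> split_ifs <;> simp
  have hpart : ∀ W : π.parts, π.part (rep W) = W := fun W => π.part_eq_of_mem W.2 (hrep W)
  refine ⟨fun W => sideSign p q s (blockMin π (rep W)) * K (blockMin π (rep W)), ⟨?_, ?_⟩, ?_⟩
  · intro W
    refine mul_ne_zero (fun h => ?_) (h0 _)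
    have := hside (blockMin π (rep W))
    simp [h] at this
  · intro V W hVW h
    rw [Int.natAbs_mul, Int.natAbs_mul, hside, hside, one_mul, one_mul] at h
    refine hVW (Subtype.ext ?_)
    rw [← hpart V, ← hpart W, ← part_eq_of_mem_part (blockMin_mem π (rep V)),
      ← part_eq_of_mem_part (blockMin_mem π (rep W))]
    exact part_eq_of_mem_part ((hπ _ _).2 h)
  · funext i
    have hi : rep (blockOf π i) ∈ π.part i := hrep (blockOf π i)
    simp only [assemble]
    rw [blockMin_congr hi]
    exact hK i

lemma add_eq_zero_of_coef {T ι : Type*} [Fintype T] [DecidableEq T] [DecidableEq ι] {vt : T → ι}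
    {K : T → ℤ} {i : ι} {v : ℕ} (hc : coef vt K i v = 0) {a b : T} (hab : a ≠ b)
    (hf : ({t | vt t = i ∧ (K t).natAbs = v} : Finset T) = {a, b}) : K a = -K b := by
  have ha : (K a).natAbs = v := by
    have : a ∈ ({a, b} : Finset T) := by simp
    rw [← hf] at this; simpa using (mem_filter.1 this).2.2
  have hb : (K b).natAbs = v := by
    have : b ∈ ({a, b} : Finset T) := by simp
    rw [← hf] at this; simpa using (mem_filter.1 this).2.2
  rw [coef, hf, sum_pair hab] at hc
  rw [← Int.sign_mul_natAbs (K a), ← Int.sign_mul_natAbs (K b), ha, hb]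
  linear_combination (v : ℤ) * hc

lemma filter_eq_pair {T : Type*} [DecidableEq T] {F : Finset T} (hF : #F = 2) {a b : T}
    (ha : a ∈ F) (hb : b ∈ F) (hab : a ≠ b) : F = {a, b} :=
  (eq_of_subset_of_card_le (by intro x; simp only [mem_insert, mem_singleton];
                               rintro (rfl | rfl) <;> assumption)
    (by rw [hF, card_pair hab])).symm

/-- The entries of a pair within one half are opposite. -/
lemma pair_same_side {i j : Fin (p + q)} (hij : i ≠ j) (hv : (K i).natAbs = (K j).natAbs)
    (hside : side p q i = side p q j) (ht : tot K (K i).natAbs = 2)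
    (hc : coef (side p q) K (side p q i) (K i).natAbs = 0) : K i = -K j := by
  have h1 : ({t | (K t).natAbs = (K i).natAbs} : Finset (Fin (p + q))) = {i, j} :=
    filter_eq_pair ht (by simp) (by simp [hv]) hij
  refine add_eq_zero_of_coef hc hij ?_
  rw [← h1]
  ext t
  simp only [mem_filter, mem_univ, true_and, and_iff_right_iff_imp]
  intro htv
  have : t ∈ ({i, j} : Finset (Fin (p + q))) := by rw [← h1]; simpa using htv
  rcases mem_insert.1 this with rfl | h
  · rfl
  · rw [mem_singleton.1 h, hside]

lemma crosses_bool {v : ℕ} : Crosses (side p q) K v ↔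
    0 < mult (side p q) K false v ∧ 0 < mult (side p q) K true v := by
  constructor
  · rintro ⟨i, i', hne, hi, hi'⟩
    cases i <;> cases i' <;> first | exact absurd rfl hne | exact ⟨hi, hi'⟩ | exact ⟨hi', hi⟩
  · rintro ⟨h1, h2⟩
    exact ⟨false, true, by simp, h1, h2⟩

lemma card_side_eq (b : Bool) :
    #{t | side p q t = b} = ∑ v ∈ absValues K, mult (side p q) K b v := by
  rw [card_eq_sum_card_fiberwise (f := fun t => (K t).natAbs) (t := absValues K)
    (fun t _ => natAbs_mem_absValues t)]
  simp only [filter_filter, mult]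

lemma card_side_false : #{t | side p q t = false} = p := by
  rw [card_filter, Fin.sum_univ_add]; simp

lemma card_side_true : #{t | side p q t = true} = q := by
  rw [card_filter, Fin.sum_univ_add]; simp

lemma sideSign_of_false {i : Fin (p + q)} (h : side p q i = false) : sideSign p q s i = 1 := by
  simp [sideSign, h]

lemma sideSign_of_true {i : Fin (p + q)} (h : side p q i = true) : sideSign p q s i = s := by
  simp [sideSign, h]

lemma sideSign_congr {i j : Fin (p + q)} (h : side p q i = side p q j) :
    sideSign p q s i = sideSign p q s j := by
  simp [sideSign, h]

/-- The relation between the entries of a block of two elements in one half. -/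
lemma entry_of_pair_same_side (hs : s = 1 ∨ s = -1) {i : Fin (p + q)} {sg : ℤ}
    (hsg : sg = if i = blockMin π i then 1 else -1)
    (hrel : i ≠ blockMin π i → K i = -K (blockMin π i))
    (hside : side p q i = side p q (blockMin π i)) :
    K i = sideSign p q s i * (sg * (sideSign p q s (blockMin π i) * K (blockMin π i))) := by
  rw [← sideSign_congr (s := s) hside, hsg]
  have h1 := sideSign_mul_self hs i
  split_ifs with h
  · rw [← h]; linear_combination -K i * h1
  · rw [hrel h]; linear_combination K (blockMin π i) * h1

namespace Regular

variable (h : Regular (side p q) K) (hπ : Matches π K)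
include h hπ

lemma side_eq_of_not_crosses {i : Fin (p + q)} (hc : ¬ Crosses (side p q) K (K i).natAbs)
    {j : Fin (p + q)} (hj : j ∈ π.part i) : side p q i = side p q j := by
  by_contra hne
  refine hc ⟨_, _, hne, mult_pos i, ?_⟩
  rw [← (hπ j i).1 hj]
  exact mult_pos j

lemma entry_of_not_crosses (hs : s = 1 ∨ s = -1) {i : Fin (p + q)}
    (hc : ¬ Crosses (side p q) K (K i).natAbs) {sg : ℤ}
    (hsg : sg = if i = blockMin π i then 1 else -1) :
    K i = sideSign p q s i * (sg * (sideSign p q s (blockMin π i) * K (blockMin π i))) := by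
  obtain ⟨ht, hcoef⟩ := h.of_not_crosses (natAbs_mem_absValues i) hc
  have hside := h.side_eq_of_not_crosses hπ hc (blockMin_mem π i)
  exact entry_of_pair_same_side hs hsg (fun hne => pair_same_side hne
    ((hπ _ _).1 (blockMin_mem π i)).symm hside ht (hcoef _)) hside

/-- A value shared by the two words is dead, because it would otherwise be live in the first word.
The structure theory gives two entries in each word and makes this the only crossing value. -/
lemma mem_pairFour (hf : IsTrivialAt (side p q) K false) :
    π ∈ pairFourPartitions p q ∧
      ∃ s : ℤ, (s = 1 ∨ s = -1) ∧ K ∈ genericWords π (tauInt π) s := by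
  classical
  obtain ⟨t, t', htf, htt, hvv⟩ := h.shared false
  set v := (K t).natAbs with hv
  have hmt : 0 < mult (side p q) K false v := by rw [← htf]; exact mult_pos t
  have hc : Crosses (side p q) K v := ⟨false, side p q t', htt.symm, hmt, by
    rw [hvv]; exact mult_pos t'⟩
  have hd : ∀ i, coef (side p q) K i v = 0 := fun i => by
    by_contra h1
    exact h.coef_ne_zero_of_live h1 hmt (hf v)
  obtain ⟨h4, -, h2⟩ := h.of_crosses_dead hc hd
  have hmf := (h2 false hmt).1
  have hmtr := (h2 true (crosses_bool.1 hc).2).1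
  have hpair : ∀ b, mult (side p q) K b v = 2 → ∃ a c, a < c ∧
      ({t | side p q t = b ∧ (K t).natAbs = v} : Finset (Fin (p + q))) = {a, c} := by
    intro b hb
    obtain ⟨a, c, hac, he⟩ := card_eq_two.1 hb
    rcases lt_or_gt_of_ne hac with h1 | h1
    · exact ⟨a, c, h1, he⟩
    · exact ⟨c, a, h1, by rw [he, pair_comm]⟩
  obtain ⟨i₁, i₂, h12, e12⟩ := hpair false hmf
  obtain ⟨i₃, i₄, h34, e34⟩ := hpair true hmtr
  have hmem12 : ∀ i, side p q i = false ∧ (K i).natAbs = v ↔ i = i₁ ∨ i = i₂ := fun i => by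
    have := Finset.ext_iff.1 e12 i
    simpa using this
  have hmem34 : ∀ i, side p q i = true ∧ (K i).natAbs = v ↔ i = i₃ ∨ i = i₄ := fun i => by
    have := Finset.ext_iff.1 e34 i
    simpa using this
  obtain ⟨s1, k1⟩ := (hmem12 i₁).2 (Or.inl rfl)
  obtain ⟨s2, k2⟩ := (hmem12 i₂).2 (Or.inr rfl)
  obtain ⟨s3, k3⟩ := (hmem34 i₃).2 (Or.inl rfl)
  obtain ⟨s4, k4⟩ := (hmem34 i₄).2 (Or.inr rfl)
  have hall : ∀ i, (K i).natAbs = v → i = i₁ ∨ i = i₂ ∨ i = i₃ ∨ i = i₄ := by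
    intro i hi
    cases hsi : side p q i with
    | false => rcases (hmem12 i).1 ⟨hsi, hi⟩ with h | h <;> simp [h]
    | true => rcases (hmem34 i).1 ⟨hsi, hi⟩ with h | h <;> simp [h]
  have h23 := lt_of_side s2 s3
  have hK12 : K i₂ = -K i₁ := by
    rw [add_eq_zero_of_coef (hd false) h12.ne e12, neg_neg]
  have hK34 : K i₃ = -K i₄ := add_eq_zero_of_coef (hd true) h34.ne e34
  have hother : ∀ u ∈ absValues K, u ≠ v → ¬ Crosses (side p q) K u := by
    intro u _ huv hcu
    exact huv (h.crosses_unique hf hcu hc (crosses_bool.1 hcu).1 hmt)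
  have hmin : ∀ i, (K i).natAbs = v → blockMin π i = i₁ := by
    intro i hi
    refine le_antisymm (blockMin_le ((hπ _ _).2 (k1.trans hi.symm))) ?_
    have h5 := (hπ _ _).1 (blockMin_mem π i)
    rcases hall _ (h5.trans hi) with h6 | h6 | h6 | h6 <;> rw [h6]
    · exact h12.le
    · exact (h12.trans h23).le
    · exact (h12.trans (h23.trans h34)).le
  have hcard4 : ∀ i, (K i).natAbs = v → #(π.part i) = 4 := by
    intro i hi; rw [← hπ.tot_eq, hi, h4]
  have hin : ∀ {i j}, (K i).natAbs = v → (K j).natAbs = v → j ∈ π.part i :=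
    fun hi hj => (hπ _ _).2 (hj.trans hi.symm)
  have t1 : tauInt π i₁ = 1 := if_pos (Or.inl (isMin_iff.2 (hmin _ k1).symm))
  have t4 : tauInt π i₄ = 1 := by
    refine if_pos (Or.inr ⟨hcard4 _ k4, fun j hj => ?_⟩)
    rcases hall j (((hπ _ _).1 hj).trans k4) with h6 | h6 | h6 | h6 <;> rw [h6]
    · exact (h12.trans (h23.trans h34)).le
    · exact (h23.trans h34).le
    · exact h34.le
  have t2 : tauInt π i₂ = -1 := by
    refine if_neg ?_
    rintro (h6 | ⟨-, h6⟩)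
    · exact absurd (h6 _ (hin k2 k1)) (not_le.2 h12)
    · exact absurd (h6 _ (hin k2 k4)) (not_le.2 (h23.trans h34))
  have t3 : tauInt π i₃ = -1 := by
    refine if_neg ?_
    rintro (h6 | ⟨-, h6⟩)
    · exact absurd (h6 _ (hin k3 k1)) (not_le.2 (h12.trans h23))
    · exact absurd (h6 _ (hin k3 k4)) (not_le.2 h34)
  refine ⟨?_, ?_⟩
  -- Every value has multiplicity `0` or `2` in each half, which makes `p` and `q` even.
  · have heven : ∀ b, Even (∑ u ∈ absValues K, mult (side p q) K b u) := by
      intro b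
      refine even_sum _ fun u hu => ?_
      by_cases huv : u = v
      · rw [huv]; cases b
        · rw [hmf]; exact even_two
        · rw [hmtr]; exact even_two
      · have h5 := (h.of_not_crosses hu (hother u hu huv)).1
        rw [tot_eq_sum_mult (vt := side p q), Fintype.sum_bool] at h5
        have h6 := hother u hu huv
        rw [crosses_bool] at h6
        have h7 : mult (side p q) K b u = 0 ∨ mult (side p q) K b u = 2 := by
          cases b <;> omega
        rcases h7 with h7 | h7 <;> simp [h7]
    rw [pairFourPartitions, mem_filter]
    refine ⟨mem_univ _, ?_, ?_, π.part i₁, π.part_mem.2 (mem_univ _), ?_, ?_, ?_⟩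
    · have := heven false
      rwa [← card_side_eq, card_side_false] at this
    · have := heven true
      rwa [← card_side_eq, card_side_true] at this
    · rw [← hπ.mult_false, k1, hmf]
    · rw [← hπ.mult_true, k1, hmtr]
    · intro W hW hWV
      obtain ⟨j, rfl⟩ := exists_part_eq hW
      have hjv : (K j).natAbs ≠ v := fun hj =>
        hWV (part_eq_of_mem_part (hin k1 hj))
      have h5 := hother _ (natAbs_mem_absValues j) hjv
      rw [← hπ.tot_eq, hπ.isCrossing_iff]
      exact ⟨(h.of_not_crosses (natAbs_mem_absValues j) h5).1, h5⟩
  -- The smallest and the largest element of the block of four both carry the sign `1` and lie in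
  -- different halves, so their quotient is `s`.
  · have hs : ∃ s : ℤ, (s = 1 ∨ s = -1) ∧ K i₄ = s * K i₁ := by
      rcases Int.natAbs_eq_natAbs_iff.1 (k4.trans k1.symm) with h5 | h5
      · exact ⟨1, Or.inl rfl, by rw [h5, one_mul]⟩
      · exact ⟨-1, Or.inr rfl, by rw [h5]; ring⟩
    obtain ⟨s, hs, hK4⟩ := hs
    refine ⟨s, hs, mem_genericWords_of hπ h.ne_zero hs fun i => ?_⟩
    by_cases hi : (K i).natAbs = v
    · rw [hmin i hi, sideSign_of_false s1, one_mul]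
      rcases hall i hi with h6 | h6 | h6 | h6 <;> rw [h6]
      · rw [sideSign_of_false s1, t1, one_mul, one_mul]
      · rw [sideSign_of_false s2, t2, hK12]; ring
      · rw [sideSign_of_true s3, t3, hK34, hK4]; ring
      · rw [sideSign_of_true s4, t4, hK4]; ring
    · have h5 := hother _ (natAbs_mem_absValues i) hi
      refine h.entry_of_not_crosses hπ hs h5 (tauInt_eq_of_card ?_)
      rw [← hπ.tot_eq]
      exact (h.of_not_crosses (natAbs_mem_absValues i) h5).1

/-- Every crossing value is live, hence occurs exactly once in each word, and every value has
exactly two entries. -/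
lemma mem_pair (hf : ¬ IsTrivialAt (side p q) K false) :
    π ∈ pairPartitions p q ∧
      ∃ s : ℤ, (s = 1 ∨ s = -1) ∧ K ∈ genericWords π (epsInt π) s := by
  classical
  obtain ⟨v, hv⟩ := not_forall.1 hf
  have hlive : ∀ {u}, Crosses (side p q) K u → coef (side p q) K false u ≠ 0 := fun hu =>
    h.live_of_crosses hf hu (crosses_bool.1 hu).1
  have hmult : ∀ {u}, Crosses (side p q) K u → ∀ b, mult (side p q) K b u = 1 := by
    intro u hu b
    have h1 := h.mult_le_one (hlive hu) b
    have h2 := crosses_bool.1 hu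
    cases b <;> omega
  have hcoef : ∀ {u}, Crosses (side p q) K u → ∀ b,
      coef (side p q) K b u = 1 ∨ coef (side p q) K b u = -1 :=
    fun hu b => coef_of_mult_eq_one h.ne_zero (hmult hu b)
  have htot : ∀ u ∈ absValues K, tot K u = 2 := by
    intro u hu
    by_cases hc : Crosses (side p q) K u
    · exact h.tot_of_live (hlive hc)
    · exact (h.of_not_crosses hu hc).1
  have hcv := h.crosses_of_live hv
  -- With only two crossing values `u` and `v` the relation of the first word would read `±v ± u =
  -- 0`, impossible for distinct positive numbers.
  have hthree : ∃ u w, Crosses (side p q) K u ∧ Crosses (side p q) K w ∧ u ≠ v ∧ w ≠ v ∧ u ≠ w := by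
    obtain ⟨u, huv, hu⟩ := h.exists_other_live hv
    by_contra! hno
    have hcu := h.crosses_of_live hu
    have hw : ∀ w ∈ absValues K, w ∉ ({v, u} : Finset ℕ) → coef (side p q) K false w * (w : ℤ) = 0 := by
      intro w _ hw
      simp only [mem_insert, mem_singleton, not_or] at hw
      by_contra h1
      exact hw.2 (hno u w hcu (h.crosses_of_live (left_ne_zero_of_mul h1)) huv hw.1).symm
    have h1 := h.zeroSum.sum_coef false
    have hmv := mem_absValues_of_mult_pos (mult_pos_of_coef_ne_zero hv)
    have hmu := mem_absValues_of_mult_pos (mult_pos_of_coef_ne_zero hu)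
    rw [← sum_subset (s₁ := {v, u}) (by
      intro x; simp only [mem_insert, mem_singleton]; rintro (rfl | rfl) <;> assumption) hw,
      sum_pair huv.symm] at h1
    have hv1 := one_le_of_mem_absValues h.ne_zero hmv
    have hu1 := one_le_of_mem_absValues h.ne_zero hmu
    rcases hcoef hcv false with h5 | h5 <;> rcases hcoef hcu false with h6 | h6 <;>
      rw [h5, h6] at h1 <;> omega
  refine ⟨?_, ?_⟩
  · rw [pairPartitions, mem_filter]
    refine ⟨mem_univ _, fun V hV => ?_, ?_⟩
    · obtain ⟨j, rfl⟩ := exists_part_eq hV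
      rw [← hπ.tot_eq]
      exact htot _ (natAbs_mem_absValues j)
    · obtain ⟨u, w, hu, hw, huv, hwv, huw⟩ := hthree
      obtain ⟨a, -, ha⟩ := exists_of_mult_pos (crosses_bool.1 hcv).1
      obtain ⟨b, -, hb⟩ := exists_of_mult_pos (crosses_bool.1 hu).1
      obtain ⟨c, -, hc⟩ := exists_of_mult_pos (crosses_bool.1 hw).1
      have hne : ∀ {x y : Fin (p + q)}, (K x).natAbs ≠ (K y).natAbs → π.part x ≠ π.part y := by
        intro x y hxy he
        exact hxy ((hπ x y).1 (by rw [← he]; exact mem_part_self' π x))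
      have hmem : ∀ {x : Fin (p + q)}, Crosses (side p q) K (K x).natAbs →
          π.part x ∈ π.parts.filter fun V => IsCrossing p q V := by
        intro x hx
        rw [mem_filter]
        exact ⟨π.part_mem.2 (mem_univ x), (hπ.isCrossing_iff x).2 hx⟩
      refine two_lt_card.2 ⟨π.part a, hmem (ha ▸ hcv), π.part b, hmem (hb ▸ hu), π.part c,
        hmem (hc ▸ hw), hne ?_, hne ?_, hne ?_⟩
      · rw [ha, hb]; exact huv.symm
      · rw [ha, hc]; exact hwv.symm
      · rw [hb, hc]; exact huw
  -- The sign is read off at one crossing value. By `coef_mul_coef` the relation of the second word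
  -- is `-s` times that of the first, so the same `s` serves all crossing values.
  · set s : ℤ := -(coef (side p q) K false v * coef (side p q) K true v) with hsdef
    have hs : s = 1 ∨ s = -1 := by
      rcases hcoef hcv false with h5 | h5 <;> rcases hcoef hcv true with h6 | h6 <;>
        rw [hsdef, h5, h6] <;> norm_num
    refine ⟨s, hs, mem_genericWords_of hπ h.ne_zero hs fun i => ?_⟩
    by_cases hc : Crosses (side p q) K (K i).natAbs
    swap
    · exact h.entry_of_not_crosses hπ hs hc (epsInt_eq π i)
    set u := (K i).natAbs with hu
    obtain ⟨a, hsa, hka⟩ := exists_of_mult_pos (crosses_bool.1 hc).1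
    obtain ⟨b, hsb, hkb⟩ := exists_of_mult_pos (crosses_bool.1 hc).2
    have hab : a < b := lt_of_side hsa hsb
    have hset : ∀ {x}, (K x).natAbs = u →
        ({t | side p q t = side p q x ∧ (K t).natAbs = u} : Finset (Fin (p + q))) = {x} := by
      intro x hx
      refine (eq_of_subset_of_card_le (singleton_subset_iff.2 (by simp [hx])) ?_).symm
      rw [card_singleton]
      exact (hmult hc (side p q x)).le
    have hsingle : ∀ x, (K x).natAbs = u → K x = coef (side p q) K (side p q x) u * u := by
      intro x hx
      rw [coef, hset hx, sum_singleton]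
      conv_rhs => rw [← hx]
      exact (Int.sign_mul_natAbs (K x)).symm
    have hall : ∀ x, (K x).natAbs = u → x = a ∨ x = b := by
      intro x hx
      cases hsx : side p q x with
      | false =>
        left
        have := hset hka
        rw [hsa] at this
        exact mem_singleton.1 (this ▸ (by simp [hsx, hx]))
      | true =>
        right
        have := hset hkb
        rw [hsb] at this
        exact mem_singleton.1 (this ▸ (by simp [hsx, hx]))
    have hmin : blockMin π i = a := by
      refine le_antisymm (blockMin_le ((hπ _ _).2 hka)) ?_
      rcases hall _ ((hπ _ _).1 (blockMin_mem π i)) with h6 | h6 <;> rw [h6]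
      exact hab.le
    have hKb : K b = -s * K a := by
      rw [hsingle a hka, hsingle b hkb, hsa, hsb, hsdef]
      have h1 := h.coef_mul_coef (j := true) hv (hlive hc)
      have hsq : coef (side p q) K false v * coef (side p q) K false v = 1 := by
        rcases hcoef hcv false with h5 | h5 <;> rw [h5] <;> norm_num
      linear_combination (coef (side p q) K false v * (u : ℤ)) * h1
        - (coef (side p q) K true u * (u : ℤ)) * hsq
    rw [epsInt_eq, hmin, sideSign_of_false hsa, one_mul]
    rcases hall i rfl with h6 | h6
    · rw [h6, if_pos rfl, sideSign_of_false hsa, one_mul, one_mul]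
    · rw [h6, if_neg hab.ne', sideSign_of_true hsb, hKb]; ring

end Regular

end Classification

end ToeplitzBand

end

noncomputable section

namespace ToeplitzBand

set_option linter.unusedSectionVars false

/-! ### The covariance of two word sums, up to `O(w^{-1/2})`. -/

section Covariance

open Finset

variable {p q : ℕ}

lemma card_eq_add_halves (V : Finset (Fin (p + q))) :
    #V = #{i : Fin p | Fin.castAdd q i ∈ V} + #{j : Fin q | Fin.natAdd p j ∈ V} := by
  rw [card_filter, card_filter, ← Fin.sum_univ_add (f := fun i => if i ∈ V then 1 else 0)]
  simp

lemma isCrossing_iff_card {V : Finset (Fin (p + q))} : IsCrossing p q V ↔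
    0 < #{i : Fin p | Fin.castAdd q i ∈ V} ∧ 0 < #{j : Fin q | Fin.natAdd p j ∈ V} := by
  rw [IsCrossing, card_pos, card_pos]
  simp [Finset.Nonempty]

lemma card_of_mem_pairPartitions {π : Partition (p + q)} (h : π ∈ pairPartitions p q)
    {V : Finset (Fin (p + q))} (hV : V ∈ π.parts) : #V = 2 :=
  (mem_filter.1 h).2.1 V hV

lemma exists_crossing_of_mem_pairPartitions {π : Partition (p + q)} (h : π ∈ pairPartitions p q) :
    ∃ V ∈ π.parts, IsCrossing p q V := by
  classical
  have h3 := (mem_filter.1 h).2.2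
  obtain ⟨V, hV⟩ := card_pos.1 (lt_of_lt_of_le (by norm_num : 0 < 3) h3)
  exact ⟨V, (mem_filter.1 hV).1, (mem_filter.1 hV).2⟩

lemma exists_block_of_mem_pairFourPartitions {π : Partition (p + q)}
    (h : π ∈ pairFourPartitions p q) : ∃ V ∈ π.parts,
      #{i : Fin p | Fin.castAdd q i ∈ V} = 2 ∧ #{j : Fin q | Fin.natAdd p j ∈ V} = 2 ∧
        ∀ W ∈ π.parts, W ≠ V → #W = 2 ∧ ¬ IsCrossing p q W := by
  classical
  rw [pairFourPartitions, mem_filter] at h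
  obtain ⟨V, hV, h1, h2, h3⟩ := h.2.2.2
  exact ⟨V, hV, by convert h1, by convert h2, h3⟩

lemma exists_crossing_of_mem_pairFourPartitions {π : Partition (p + q)}
    (h : π ∈ pairFourPartitions p q) : ∃ V ∈ π.parts, IsCrossing p q V := by
  obtain ⟨V, hV, h1, h2, -⟩ := exists_block_of_mem_pairFourPartitions h
  exact ⟨V, hV, isCrossing_iff_card.2 ⟨by omega, by omega⟩⟩

lemma disjoint_pairPartitions : Disjoint (pairPartitions p q) (pairFourPartitions p q) := by
  rw [disjoint_left]
  intro π h h'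
  obtain ⟨V, hV, h1, h2, -⟩ := exists_block_of_mem_pairFourPartitions h'
  have h3 := card_of_mem_pairPartitions h hV
  rw [card_eq_add_halves] at h3
  omega

section Weight

variable {K : Fin (p + q) → ℤ}

open Classical in
/-- The number of generic assemblies of `K` from partitions in `S`. -/
def genericCount (S : Finset (Partition (p + q))) (sgn : Partition (p + q) → Fin (p + q) → ℤ)
    (K : Fin (p + q) → ℤ) : ℝ :=
  ∑ π ∈ S, ∑ s ∈ ({1, -1} : Finset ℤ), if K ∈ genericWords π (sgn π) s then 1 else 0

variable {S : Finset (Partition (p + q))} {sgn : Partition (p + q) → Fin (p + q) → ℤ}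
  (hsgn : ∀ π i, sgn π i = 1 ∨ sgn π i = -1)

lemma sign_of_mem {s : ℤ} (h : s ∈ ({1, -1} : Finset ℤ)) : s = 1 ∨ s = -1 := by simpa using h

include hsgn in
-- The word determines the partition through its coinciding absolute values, and then the sign
-- through a crossing block.
lemma genericCount_eq_one {π : Partition (p + q)} (hπ : π ∈ S)
    (hc : ∃ V ∈ π.parts, IsCrossing p q V) {s : ℤ} (hs : s ∈ ({1, -1} : Finset ℤ))
    (hK : K ∈ genericWords π (sgn π) s) : genericCount S sgn K = 1 := by
  have hm := matches_of_mem_genericWords (hsgn π) (sign_of_mem hs) hK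
  obtain ⟨V, hV, hVc⟩ := hc
  rw [genericCount, sum_eq_single_of_mem π hπ, sum_eq_single_of_mem s hs, if_pos hK]
  · intro s' hs' hne
    exact if_neg fun hK' => hne (sign_unique (hsgn π) (sign_of_mem hs') hV hVc hK' hK)
  · intro π' _ hne
    refine sum_eq_zero fun s' hs' => if_neg fun hK' => hne ?_
    exact (matches_of_mem_genericWords (hsgn π') (sign_of_mem hs') hK').unique hm

lemma genericCount_eq_zero
    (h : ∀ π ∈ S, ∀ s ∈ ({1, -1} : Finset ℤ), K ∉ genericWords π (sgn π) s) :
    genericCount S sgn K = 0 :=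
  sum_eq_zero fun π hπ => sum_eq_zero fun s hs => if_neg (h π hπ s hs)

open Classical in
lemma abs_genericCount_le (K : Fin (p + q) → ℤ) : |genericCount S sgn K| ≤ #S * 2 := by
  rw [genericCount]
  refine (abs_sum_le_sum_abs _ _).trans ?_
  rw [← nsmul_eq_mul]
  refine sum_le_card_nsmul _ _ _ fun π _ => (abs_sum_le_sum_abs _ _).trans ?_
  have : ∀ s ∈ ({1, -1} : Finset ℤ),
      |(if K ∈ genericWords π (sgn π) s then 1 else 0 : ℝ)| ≤ 1 := by
    intro s _; split_ifs <;> simp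
  refine (sum_le_card_nsmul _ _ _ this).trans ?_
  simp

end Weight

/-- The limiting weight of the word `K` in the covariance. -/
def limitWeight (κ : ℝ) (K : Fin (p + q) → ℤ) : ℝ :=
  genericCount (pairPartitions p q) epsInt K +
    (κ - 1) * genericCount (pairFourPartitions p q) tauInt K

section Moments

variable {Ω : Type*} [MeasurableSpace Ω] {P : Measure Ω} [IsProbabilityMeasure P]
  {A : ℕ → Ω → ℝ} (hA : Noise P A) {κ : ℝ}
  (hvar : ∀ v, 1 ≤ v → ∫ ω, A v ω ^ 2 ∂P = 1) (hfourth : ∀ v, 1 ≤ v → ∫ ω, A v ω ^ 4 ∂P = κ)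
  {K : Fin (p + q) → ℤ} {π : Partition (p + q)} {s : ℤ}

include hA hvar in
lemma Noise.mixedMoment_of_mem_pair (hπ : π ∈ pairPartitions p q) (hs : s = 1 ∨ s = -1)
    (hK : K ∈ genericWords π (epsInt π) s) : mixedMoment (side p q) K P A univ = 1 := by
  have hm := matches_of_mem_genericWords (epsInt_eq_or π) hs hK
  have h0 := ne_zero_of_mem_genericWords (epsInt_eq_or π) hs hK
  have hcard : ∀ j, #(π.part j) = 2 := fun j =>
    card_of_mem_pairPartitions hπ (π.part_mem.2 (mem_univ j))
  obtain ⟨V, hV, hc⟩ := exists_crossing_of_mem_pairPartitions hπ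
  obtain ⟨j, rfl⟩ := exists_part_eq hV
  refine hA.mixedMoment_of_pairs hvar h0 (fun v hv => ?_) (v := (K j).natAbs) ?_
  · obtain ⟨i, -, rfl⟩ := mem_image.1 hv
    rw [hm.tot_eq, hcard]
  · rw [hm.mult_false]
    have h1 := hcard j
    rw [card_eq_add_halves] at h1
    have h2 := isCrossing_iff_card.1 hc
    omega

include hA hvar hfourth in
lemma Noise.mixedMoment_of_mem_pairFour (hπ : π ∈ pairFourPartitions p q) (hs : s = 1 ∨ s = -1)
    (hK : K ∈ genericWords π (tauInt π) s) : mixedMoment (side p q) K P A univ = κ - 1 := by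
  have hm := matches_of_mem_genericWords (tauInt_eq_or π) hs hK
  have h0 := ne_zero_of_mem_genericWords (tauInt_eq_or π) hs hK
  obtain ⟨V, hV, h1, h2, h3⟩ := exists_block_of_mem_pairFourPartitions hπ
  obtain ⟨j, rfl⟩ := exists_part_eq hV
  refine hA.mixedMoment_of_pairs_four hvar hfourth h0 (v := (K j).natAbs) ?_ ?_ fun u hu huv => ?_
  · rw [hm.mult_false, h1]
  · rw [hm.mult_true, h2]
  · obtain ⟨i, -, rfl⟩ := mem_image.1 hu
    have hne : π.part i ≠ π.part j := fun h =>
      huv ((hm i j).1 (h ▸ mem_part_self' π i))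
    obtain ⟨h4, h5⟩ := h3 _ (π.part_mem.2 (mem_univ i)) hne
    rw [hm.tot_eq, hm.mult_false, hm.mult_true]
    rw [isCrossing_iff_card] at h5
    exact ⟨h4, by omega⟩

include hA hvar hfourth in
-- On generic words both sides are computed directly. On the others the weight is `0`, and so is the
-- moment, since a regular word would be generic by the classification.
lemma Noise.mixedMoment_eq_limitWeight (hz : ZeroSum (side p q) K)
    (hd : ¬ Degenerate (side p q) K) :
    mixedMoment (side p q) K P A univ = limitWeight κ K := by
  rw [limitWeight]
  by_cases h1 : ∃ π ∈ pairPartitions p q, ∃ s ∈ ({1, -1} : Finset ℤ),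
    K ∈ genericWords π (epsInt π) s
  · obtain ⟨π, hπ, s, hs, hK⟩ := h1
    rw [hA.mixedMoment_of_mem_pair hvar hπ (sign_of_mem hs) hK,
      genericCount_eq_one epsInt_eq_or hπ (exists_crossing_of_mem_pairPartitions hπ) hs hK,
      genericCount_eq_zero, mul_zero, add_zero]
    intro π' hπ' s' hs' hK'
    have h2 := matches_of_mem_genericWords (epsInt_eq_or π) (sign_of_mem hs) hK
    have h3 := matches_of_mem_genericWords (tauInt_eq_or π') (sign_of_mem hs') hK'
    rw [h2.unique h3] at hπ
    exact disjoint_left.1 disjoint_pairPartitions hπ hπ'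
  rw [genericCount_eq_zero fun π hπ s hs hK => h1 ⟨π, hπ, s, hs, hK⟩, zero_add]
  by_cases h2 : ∃ π ∈ pairFourPartitions p q, ∃ s ∈ ({1, -1} : Finset ℤ),
    K ∈ genericWords π (tauInt π) s
  · obtain ⟨π, hπ, s, hs, hK⟩ := h2
    rw [hA.mixedMoment_of_mem_pairFour hvar hfourth hπ (sign_of_mem hs) hK,
      genericCount_eq_one tauInt_eq_or hπ (exists_crossing_of_mem_pairFourPartitions hπ) hs hK,
      mul_one]
  rw [genericCount_eq_zero fun π hπ s hs hK => h2 ⟨π, hπ, s, hs, hK⟩, mul_zero]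
  rcases hA.mixedMoment_eq_zero_or_regular hz hd with ⟨i, h3⟩ | hr
  · exact h3 univ (mem_univ i)
  · obtain ⟨π, hπ⟩ := exists_matches K
    by_cases hf : IsTrivialAt (side p q) K false
    · obtain ⟨h4, s, hs, h5⟩ := hr.mem_pairFour hπ hf
      exact absurd ⟨π, h4, s, by simpa using hs, h5⟩ h2
    · obtain ⟨h4, s, hs, h5⟩ := hr.mem_pair hπ hf
      exact absurd ⟨π, h4, s, by simpa using hs, h5⟩ h1

/-- The coefficient of a pair of words in the covariance. -/
def pairCoeff (n w : ℕ) (K : Fin (p + q) → ℤ) : ℝ :=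
  fluctCoeff n w p (fun i => K (Fin.castAdd q i)) * fluctCoeff n w q (fun j => K (Fin.natAdd p j))

lemma centredWord_false (K : Fin (p + q) → ℤ) (ω : Ω) :
    centredWord (side p q) K P A false ω = centredProd P A (fun i => K (Fin.castAdd q i)) ω := by
  have h : ∀ ω, wordProd (side p q) K A false ω = ∏ i, A (K (Fin.castAdd q i)).natAbs ω := by
    intro ω
    rw [wordProd, prod_filter, Fin.prod_univ_add]
    simp
  simp only [centredWord, centredProd, h]

lemma centredWord_true (K : Fin (p + q) → ℤ) (ω : Ω) :
    centredWord (side p q) K P A true ω = centredProd P A (fun i => K (Fin.natAdd p i)) ω := by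
  have h : ∀ ω, wordProd (side p q) K A true ω = ∏ i, A (K (Fin.natAdd p i)).natAbs ω := by
    intro ω
    rw [wordProd, prod_filter, Fin.prod_univ_add]
    simp
  simp only [centredWord, centredProd, h]

lemma sum_boxWords_add (w : ℕ) (f : (Fin p → ℤ) → (Fin q → ℤ) → ℝ) :
    ∑ J ∈ boxWords (Fin p) w, ∑ J' ∈ boxWords (Fin q) w, f J J'
      = ∑ K ∈ boxWords (Fin (p + q)) w,
        f (fun i => K (Fin.castAdd q i)) (fun j => K (Fin.natAdd p j)) := by
  rw [← sum_product']
  refine sum_nbij' (fun J => Fin.append J.1 J.2)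
    (fun K => (fun i => K (Fin.castAdd q i), fun j => K (Fin.natAdd p j))) ?_ ?_ ?_ ?_ ?_
  · rintro ⟨J, J'⟩ h
    simp only [boxWords, Fintype.mem_piFinset, mem_product] at h ⊢
    intro i
    induction i using Fin.addCases with
    | left i => rw [Fin.append_left]; exact h.1 i
    | right i => rw [Fin.append_right]; exact h.2 i
  · intro K h
    simp only [boxWords, Fintype.mem_piFinset, mem_product] at h ⊢
    exact ⟨fun i => h _, fun i => h _⟩
  · rintro ⟨J, J'⟩ _
    simp
  · intro K _
    funext i
    induction i using Fin.addCases with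
    | left i => rw [Fin.append_left]
    | right i => rw [Fin.append_right]
  · rintro ⟨J, J'⟩ _
    simp

include hA in
lemma Noise.integral_wordSum_mul_wordSum (n w : ℕ) :
    ∫ ω, wordSum P A w (fluctCoeff n w p) ω * wordSum P A w (fluctCoeff n w q) ω ∂P
      = ∑ K ∈ boxWords (Fin (p + q)) w, pairCoeff n w K * mixedMoment (side p q) K P A univ := by
  obtain ⟨C, -, hC⟩ := hA.exists_mixedMoment_bound (side p q)
  have h1 : ∀ ω, wordSum P A w (fluctCoeff n w p) ω * wordSum P A w (fluctCoeff n w q) ω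
      = ∑ K ∈ boxWords (Fin (p + q)) w, pairCoeff n w K * ∏ i, centredWord (side p q) K P A i ω := by
    intro ω
    rw [wordSum, wordSum, sum_mul_sum, sum_boxWords_add w fun J J' =>
      fluctCoeff n w p J * centredProd P A J ω * (fluctCoeff n w q J' * centredProd P A J' ω)]
    refine sum_congr rfl fun K _ => ?_
    rw [Fintype.prod_bool, centredWord_true, centredWord_false, pairCoeff]
    ring
  simp_rw [h1]
  rw [integral_finsetSum _ fun K _ => ((hC K univ).1.const_mul _)]
  simp_rw [integral_const_mul]
  rfl

lemma pairCoeff_zeroSum {n w : ℕ} (h : pairCoeff n w K ≠ 0) : ZeroSum (side p q) K := by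
  have h1 := left_ne_zero_of_mul h
  have h2 := right_ne_zero_of_mul h
  simp only [fluctCoeff, bandCoeff] at h1 h2
  have h3 := (ite_ne_right_iff.1 (right_ne_zero_of_mul h1)).1
  have h4 := (ite_ne_right_iff.1 (right_ne_zero_of_mul h2)).1
  intro i
  rw [sum_filter, Fin.sum_univ_add]
  cases i <;> simpa

lemma abs_pairCoeff_mul_le {n w : ℕ} (hn : 1 ≤ n) (K : Fin (p + q) → ℤ) :
    |pairCoeff n w K| * √(w : ℝ) ^ (p + q) ≤ √(w : ℝ) ^ 2 := by
  have h1 := (admissible_fluctCoeff hn w p).bound fun i => K (Fin.castAdd q i)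
  have h2 := (admissible_fluctCoeff hn w q).bound fun i => K (Fin.natAdd p i)
  calc _ = (|fluctCoeff n w p fun i => K (Fin.castAdd q i)| * √(w : ℝ) ^ p) *
        (|fluctCoeff n w q fun i => K (Fin.natAdd p i)| * √(w : ℝ) ^ q) := by
        rw [pairCoeff, abs_mul]; ring
    _ ≤ √(w : ℝ) * √(w : ℝ) := mul_le_mul h1 h2 (by positivity) (by positivity)
    _ = _ := by ring

include hA hvar hfourth in
variable (p q) in
-- Moment and weight may differ only on degenerate words, where boundedness of both is enough.
lemma Noise.exists_covariance_bound : ∃ C : ℝ, ∀ n w : ℕ, 1 ≤ n → 1 ≤ w →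
    |∫ ω, wordSum P A w (fluctCoeff n w p) ω * wordSum P A w (fluctCoeff n w q) ω ∂P
      - ∑ K ∈ boxWords (Fin (p + q)) w, pairCoeff n w K * limitWeight κ K| * √(w : ℝ) ≤ C := by
  obtain ⟨C₁, hC₁0, hC₁⟩ := hA.exists_mixedMoment_bound (side p q)
  obtain ⟨C₂, hC₂0, hC₂⟩ := exists_degenerate_sum_bound (side p q)
  set D : ℝ := #(pairPartitions p q) * 2 + |κ - 1| * (#(pairFourPartitions p q) * 2) with hD
  have hD0 : 0 ≤ D := by positivity
  have hw : ∀ K : Fin (p + q) → ℤ, |limitWeight κ K| ≤ D := by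
    intro K
    refine (abs_add_le _ _).trans (add_le_add (abs_genericCount_le K) ?_)
    rw [abs_mul]
    exact mul_le_mul_of_nonneg_left (abs_genericCount_le K) (abs_nonneg _)
  refine ⟨C₂ * (C₁ + D), fun n w hn hw1 => ?_⟩
  have := hC₂ w hw1 (pairCoeff n w)
    (fun K => mixedMoment (side p q) K P A univ - limitWeight κ K) (C₁ + D) (by positivity)
    (fun K => (abs_sub _ _).trans (add_le_add (hC₁ K univ).2 (hw K)))
    (fun K => pairCoeff_zeroSum)
    (fun K => by simpa using abs_pairCoeff_mul_le hn K)
    (fun K hz hd => by rw [hA.mixedMoment_eq_limitWeight hvar hfourth hz hd, sub_self])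
  rw [hA.integral_wordSum_mul_wordSum, ← sum_sub_distrib]
  simpa only [mul_sub] using this

end Moments

end Covariance

end ToeplitzBand

end

noncomputable section

namespace ToeplitzBand

set_option linter.unusedSectionVars false

/-! ### Riemann sums over lattice boxes and the limiting proportion of starting points. -/

section Riemann

open Finset

lemma integral_comp_eq_sum {α β : Type*} [MeasurableSpace α] (μ : Measure α) (φ : α → β)
    (F : Finset β) (f : β → ℝ) (hφ : ∀ z ∈ F, MeasurableSet (φ ⁻¹' {z}))
    (hfin : ∀ z ∈ F, μ (φ ⁻¹' {z}) ≠ ⊤) (hf : ∀ z ∉ F, f z = 0) :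
    Integrable (fun x => f (φ x)) μ ∧ ∫ x, f (φ x) ∂μ = ∑ z ∈ F, f z * μ.real (φ ⁻¹' {z}) := by
  classical
  have h1 : ∀ x, f (φ x) = ∑ z ∈ F, (φ ⁻¹' {z}).indicator (fun _ => f z) x := by
    intro x
    by_cases hx : φ x ∈ F
    · rw [sum_eq_single_of_mem _ hx, Set.indicator_of_mem (by simp)]
      intro z _ hz
      exact Set.indicator_of_notMem (by simpa using hz.symm) _
    · rw [hf _ hx, sum_eq_zero]
      intro z hz
      refine Set.indicator_of_notMem ?_ _
      rintro rfl
      exact hx hz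
  have h2 : ∀ z ∈ F, Integrable ((φ ⁻¹' {z}).indicator fun _ => f z) μ := fun z hz =>
    (integrable_indicator_iff (hφ z hz)).2 (integrableOn_const (hfin z hz))
  simp_rw [h1]
  refine ⟨integrable_finsetSum _ h2, ?_⟩
  rw [integral_finsetSum _ h2]
  refine sum_congr rfl fun z hz => ?_
  rw [integral_indicator_const _ (hφ z hz), smul_eq_mul, mul_comm]

lemma preimage_floor_mul {m : ℕ} (hm : 1 ≤ m) (z : ℤ) :
    (fun x : ℝ => ⌊(m : ℝ) * x⌋) ⁻¹' {z} = Set.Ico ((z : ℝ) / m) ((z + 1) / m) := by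
  have hm0 : (0 : ℝ) < m := by exact_mod_cast hm
  ext x
  rw [Set.mem_preimage, Set.mem_singleton_iff, Int.floor_eq_iff, Set.mem_Ico, div_le_iff₀ hm0,
    lt_div_iff₀ hm0, mul_comm x]

lemma tendsto_floor_mul_div {m : ℕ → ℕ} (hm : Tendsto m atTop atTop) (x : ℝ) :
    Tendsto (fun n => (⌊(m n : ℝ) * x⌋ : ℝ) / m n) atTop (𝓝 x) := by
  have h1 : Tendsto (fun n => (m n : ℝ)) atTop atTop := tendsto_natCast_atTop_atTop.comp hm
  have h2 : Tendsto (fun n => x - (m n : ℝ)⁻¹) atTop (𝓝 x) := by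
    simpa using tendsto_const_nhds.sub (tendsto_inv_atTop_zero.comp h1)
  refine tendsto_of_tendsto_of_tendsto_of_le_of_le' h2 tendsto_const_nhds ?_ ?_
  · filter_upwards [hm.eventually_ge_atTop 1] with n hn
    have hn0 : (0 : ℝ) < m n := by exact_mod_cast hn
    rw [le_div_iff₀ hn0, sub_mul, inv_mul_cancel₀ hn0.ne']
    have := Int.lt_floor_add_one ((m n : ℝ) * x)
    linarith
  · filter_upwards [hm.eventually_ge_atTop 1] with n hn
    have hn0 : (0 : ℝ) < m n := by exact_mod_cast hn
    rw [div_le_iff₀ hn0, mul_comm x]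
    exact Int.floor_le _

/-- Riemann sums over the lattice points of a box. -/
lemma tendsto_sum_boxWords {ι : Type*} [Fintype ι] [DecidableEq ι] {w : ℕ → ℕ}
    (hw : Tendsto w atTop atTop) (G : ℕ → (ι → ℤ) → ℝ) (g : (ι → ℝ) → ℝ) (C : ℝ)
    (hG : ∀ n z, |G n z| ≤ C)
    (hlim : ∀ᵐ u : ι → ℝ, u ∈ Set.Icc (-1 : ι → ℝ) 1 →
      Tendsto (fun n => G n fun k => ⌊(w n : ℝ) * u k⌋) atTop (𝓝 (g u))) :
    Tendsto (fun n => (w n : ℝ)⁻¹ ^ Fintype.card ι * ∑ z ∈ boxWords ι (w n), G n z) atTop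
      (𝓝 (∫ u in Set.Icc (-1 : ι → ℝ) 1, g u)) := by
  have hC0 : 0 ≤ C := (abs_nonneg _).trans (hG 0 0)
  let f : ℕ → (ι → ℤ) → ℝ := fun n z => if z ∈ boxWords ι (w n) then G n z else 0
  let φ : ℕ → (ι → ℝ) → ι → ℤ := fun n u k => ⌊(w n : ℝ) * u k⌋
  have hpre : ∀ n, 1 ≤ w n → ∀ z, φ n ⁻¹' {z}
      = Set.univ.pi fun k => Set.Ico ((z k : ℝ) / w n) ((z k + 1) / w n) := by
    intro n hn z
    ext u
    have := fun k => Set.ext_iff.1 (preimage_floor_mul hn (z k)) (u k)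
    simp only [Set.mem_preimage, Set.mem_singleton_iff] at this
    simp only [φ, Set.mem_preimage, Set.mem_singleton_iff, Set.mem_univ_pi, ← this, funext_iff]
  have hint : ∀ n, 1 ≤ w n → Integrable (fun u => f n (φ n u)) ∧
      ∫ u, f n (φ n u) = (w n : ℝ)⁻¹ ^ Fintype.card ι * ∑ z ∈ boxWords ι (w n), G n z := by
    intro n hn
    have hn0 : (0 : ℝ) < w n := by exact_mod_cast hn
    obtain ⟨h1, h2⟩ := integral_comp_eq_sum volume (φ n) (boxWords ι (w n)) (f n)
      (fun z _ => by rw [hpre n hn]; exact MeasurableSet.univ_pi fun _ => measurableSet_Ico)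
      (fun z _ => by
        rw [hpre n hn, Real.volume_pi_Ico]; exact ENNReal.prod_ne_top fun _ _ => ENNReal.ofReal_ne_top)
      (fun z hz => if_neg hz)
    refine ⟨h1, h2.trans ?_⟩
    rw [mul_sum]
    refine sum_congr rfl fun z hz => ?_
    rw [hpre n hn, measureReal_def, Real.volume_pi_Ico_toReal
      (fun k => by simp only; gcongr; linarith)]
    have : ∀ k, ((z k : ℝ) + 1) / w n - z k / w n = (w n : ℝ)⁻¹ := fun k => by field_simp; ring
    simp only [this, prod_const, card_univ, f, if_pos hz]
    ring
  -- The cells of boundary lattice points stick out of the unit cube by `1 / w`; the cube of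
  -- half-width `2` contains them all and carries the dominating function.
  have hmem : ∀ n, 1 ≤ w n → ∀ u, φ n u ∈ boxWords ι (w n) → u ∈ Set.Icc (-2 : ι → ℝ) 2 := by
    intro n hn u hu
    have hn0 : (1 : ℝ) ≤ w n := by exact_mod_cast hn
    simp only [boxWords, Fintype.mem_piFinset, mem_Icc, φ, Int.le_floor] at hu
    rw [Set.mem_Icc, Pi.le_def, Pi.le_def]
    refine ⟨fun k => ?_, fun k => ?_⟩
    · have := (hu k).1
      push_cast at this
      simp only [Pi.neg_apply, Pi.ofNat_apply]
      nlinarith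
    · have h1 : (⌊(w n : ℝ) * u k⌋ : ℝ) ≤ w n := by exact_mod_cast (hu k).2
      have h2 := Int.lt_floor_add_one ((w n : ℝ) * u k)
      simp only [Pi.ofNat_apply]
      nlinarith
  have hev : ∀ᶠ n in atTop, 1 ≤ w n := hw.eventually_ge_atTop 1
  have key : Tendsto (fun n => ∫ u, f n (φ n u)) atTop
      (𝓝 (∫ u, (Set.Icc (-1 : ι → ℝ) 1).indicator g u)) := by
    refine tendsto_integral_filter_of_dominated_convergence
      ((Set.Icc (-2 : ι → ℝ) 2).indicator fun _ => C) ?_ ?_ ?_ ?_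
    · filter_upwards [hev] with n hn
      exact (hint n hn).1.aestronglyMeasurable
    · filter_upwards [hev] with n hn
      refine ae_of_all _ fun u => ?_
      simp only [f, Real.norm_eq_abs]
      split_ifs with h
      · rw [Set.indicator_of_mem (hmem n hn u h)]
        exact hG _ _
      · rw [abs_zero]
        exact Set.indicator_nonneg (fun _ _ => hC0) _
    · exact (integrable_indicator_iff measurableSet_Icc).2
        (integrableOn_const isCompact_Icc.measure_lt_top.ne)
    · filter_upwards [hlim] with u hu
      by_cases h : u ∈ Set.Icc (-1 : ι → ℝ) 1
      · rw [Set.indicator_of_mem h]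
        refine (hu h).congr fun n => ?_
        refine (if_pos ?_).symm
        simp only [boxWords, Fintype.mem_piFinset, mem_Icc, φ, Int.le_floor]
        intro k
        have h1 := h.1 k
        have h2 := h.2 k
        simp only [Pi.neg_apply, Pi.one_apply] at h1 h2
        have h0 : (0 : ℝ) ≤ w n := Nat.cast_nonneg _
        refine ⟨by push_cast; nlinarith, ?_⟩
        have : (⌊(w n : ℝ) * u k⌋ : ℝ) ≤ w n := (Int.floor_le _).trans (by nlinarith)
        exact_mod_cast this
      · rw [Set.indicator_of_notMem h]
        refine tendsto_const_nhds.congr' ?_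
        have h3 : ∃ k, u k < -1 ∨ 1 < u k := by
          by_contra! h3
          exact h ⟨fun k => (h3 k).1, fun k => (h3 k).2⟩
        obtain ⟨k, hk⟩ := h3
        have h4 := tendsto_floor_mul_div hw (u k)
        have h5 : ∀ᶠ n in atTop, (⌊(w n : ℝ) * u k⌋ : ℝ) / w n < -1 ∨
            1 < (⌊(w n : ℝ) * u k⌋ : ℝ) / w n := by
          rcases hk with hk | hk
          · exact (h4.eventually_lt_const hk).mono fun _ h => Or.inl h
          · exact (h4.eventually_const_lt hk).mono fun _ h => Or.inr h
        filter_upwards [h5, hev] with n hn hn1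
        have hn0 : (0 : ℝ) < w n := by exact_mod_cast hn1
        refine (if_neg fun hbox => ?_).symm
        simp only [boxWords, Fintype.mem_piFinset, mem_Icc, φ] at hbox
        obtain ⟨h6, h7⟩ := hbox k
        have h6' : (-(w n : ℝ)) ≤ ⌊(w n : ℝ) * u k⌋ := by exact_mod_cast h6
        have h7' : (⌊(w n : ℝ) * u k⌋ : ℝ) ≤ w n := by exact_mod_cast h7
        rw [div_lt_iff₀ hn0, lt_div_iff₀ hn0] at hn
        rcases hn with hn | hn <;> linarith
  rw [integral_indicator measurableSet_Icc] at key
  refine key.congr' ?_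
  filter_upwards [hev] with n hn
  exact (hint n hn).2

/-- A level set of a non-zero linear form is a proper affine subspace, hence null. -/
lemma ae_sum_mul_ne {ι : Type*} [Fintype ι] {m : ι → ℝ} (hm : m ≠ 0) (c : ℝ) :
    ∀ᵐ u : ι → ℝ, ∑ k, m k * u k ≠ c := by
  classical
  let s : AffineSubspace ℝ (ι → ℝ) :=
    { carrier := {u | ∑ k, m k * u k = c}
      smul_vsub_vadd_mem' := by
        intro a p₁ p₂ p₃ h₁ h₂ h₃
        simp only [Set.mem_ofPred_eq] at h₁ h₂ h₃ ⊢
        simp only [vsub_eq_sub, vadd_eq_add, Pi.add_apply, Pi.smul_apply, Pi.sub_apply, smul_eq_mul]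
        rw [← h₃]
        have : ∀ k, m k * (a * (p₁ k - p₂ k) + p₃ k)
            = a * (m k * p₁ k) - a * (m k * p₂ k) + m k * p₃ k := fun k => by ring
        simp only [this, sum_add_distrib, sum_sub_distrib, ← mul_sum, h₁, h₂]
        ring }
  have hs : s ≠ ⊤ := by
    intro h
    have hmem : ∀ u : ι → ℝ, ∑ k, m k * u k = c := fun u => by
      have : u ∈ s := h ▸ AffineSubspace.mem_top ℝ _ u
      exact this
    refine hm (funext fun k => ?_)
    have h0 := hmem 0
    have h1 := hmem (Pi.single k 1)
    simp at h0
    simpa [Pi.single_apply, ← h0] using h1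
  have h0 : volume {u : ι → ℝ | ∑ k, m k * u k = c} = 0 :=
    Measure.addHaar_affineSubspace (volume : Measure (ι → ℝ)) s hs
  rw [ae_iff]
  simpa using h0

/-- The length of the set of starting points in `[0, 1]` from which the walk with the steps `b * y`
stays in `[0, 1]`. -/
def stayLength (b : ℝ) {p : ℕ} (y : Fin p → ℝ) : ℝ :=
  ∫ x in Set.Icc (0 : ℝ) 1, ∏ j, chi (x + b * ∑ i ∈ Iic j, y i)

open Classical in
lemma prod_chi {T : Type*} [Fintype T] (x : T → ℝ) :
    ∏ j, chi (x j) = if ∀ j, x j ∈ Set.Icc (0 : ℝ) 1 then 1 else 0 := by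
  split_ifs with h
  · exact prod_eq_one fun j _ => by rw [chi, Set.indicator_of_mem (h j), Pi.one_apply]
  · obtain ⟨j, hj⟩ := not_forall.1 h
    exact prod_eq_zero (mem_univ j) (by rw [chi, Set.indicator_of_notMem hj])

/-- Away from the endpoints, the half-open discrete condition and the closed interval of `chi` agree
in the limit. -/
lemma eventually_mem_iff {m : ℕ → ℤ} {a : ℝ} (hm : Tendsto (fun n : ℕ => (m n : ℝ) / n) atTop (𝓝 a))
    (h0 : a ≠ 0) (h1 : a ≠ 1) :
    ∀ᶠ n : ℕ in atTop, (0 ≤ m n ∧ m n < n ↔ a ∈ Set.Icc (0 : ℝ) 1) := by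
  have hcast : ∀ n : ℕ, 1 ≤ n →
      ((0 ≤ m n ↔ 0 ≤ (m n : ℝ) / n) ∧ (m n < n ↔ (m n : ℝ) / n < 1)) := by
    intro n hn
    have hn0 : (0 : ℝ) < n := by exact_mod_cast hn
    rw [le_div_iff₀ hn0, div_lt_iff₀ hn0, zero_mul, one_mul]
    exact ⟨by exact_mod_cast Iff.rfl, by exact_mod_cast Iff.rfl⟩
  rcases lt_or_gt_of_ne h0 with h | h
  · filter_upwards [hm.eventually_lt_const h, eventually_ge_atTop 1] with n hn hn1
    rw [(hcast n hn1).1]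
    exact ⟨fun h' => absurd h'.1 (not_le.2 hn), fun h' => absurd h'.1 (not_le.2 h)⟩
  rcases lt_or_gt_of_ne h1 with h' | h'
  · filter_upwards [hm.eventually_lt_const h', hm.eventually_const_lt h, eventually_ge_atTop 1]
      with n hn hn' hn1
    rw [(hcast n hn1).1, (hcast n hn1).2]
    exact ⟨fun _ => ⟨h.le, h'.le⟩, fun _ => ⟨hn'.le, hn⟩⟩
  · filter_upwards [hm.eventually_const_lt h', eventually_ge_atTop 1] with n hn hn1
    rw [(hcast n hn1).2]
    exact ⟨fun h2 => absurd h2.2 (not_lt.2 hn.le), fun h2 => absurd h2.2 (not_le.2 h')⟩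

lemma stayCount_eq_sum (n : ℕ) {p : ℕ} (J : Fin p → ℤ) :
    (stayCount n J : ℝ) = ∑ z ∈ Ico (0 : ℤ) n, if StaysIn n z J then 1 else 0 := by
  rw [stayCount, card_filter]
  push_cast
  refine sum_bij (fun i _ => ((i : ℕ) : ℤ)) ?_ ?_ ?_ ?_
  · intro i _; simp
  · intro i _ j _ h; ext; simpa using h
  · intro z hz
    rw [mem_Ico] at hz
    exact ⟨⟨z.toNat, by omega⟩, mem_univ _, by simp; omega⟩
  · intro i _; rfl

/-- The proportion of the starting points from which a walk stays in `[0, n)` converges. -/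
lemma tendsto_stayCount {w : ℕ → ℕ} (hw : Tendsto w atTop atTop) {b : ℝ}
    (hb : Tendsto (fun n => (w n : ℝ) / n) atTop (𝓝 b)) {p : ℕ} {J : ℕ → Fin p → ℤ} {y : Fin p → ℝ}
    (hJ : ∀ i, Tendsto (fun n => (J n i : ℝ) / w n) atTop (𝓝 (y i))) :
    Tendsto (fun n => (stayCount n (J n) : ℝ) / n) atTop (𝓝 (stayLength b y)) := by
  classical
  let f : ℕ → ℤ → ℝ := fun n z => if z ∈ Ico (0 : ℤ) n ∧ StaysIn n z (J n) then 1 else 0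
  have hint : ∀ n : ℕ, 1 ≤ n → Integrable (fun x : ℝ => f n ⌊(n : ℝ) * x⌋) ∧
      ∫ x : ℝ, f n ⌊(n : ℝ) * x⌋ = (stayCount n (J n) : ℝ) / n := by
    intro n hn
    have hn0 : (0 : ℝ) < n := by exact_mod_cast hn
    obtain ⟨h1, h2⟩ := integral_comp_eq_sum volume (fun x : ℝ => ⌊(n : ℝ) * x⌋) (Ico (0 : ℤ) n) (f n)
      (fun z _ => by rw [preimage_floor_mul hn]; exact measurableSet_Ico)
      (fun z _ => by rw [preimage_floor_mul hn, Real.volume_Ico]; exact ENNReal.ofReal_ne_top)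
      (fun z hz => if_neg fun h => hz h.1)
    refine ⟨h1, h2.trans ?_⟩
    rw [stayCount_eq_sum, sum_div]
    refine sum_congr rfl fun z hz => ?_
    have hz' : ((z : ℝ) + 1) / n - z / n = (n : ℝ)⁻¹ := by field_simp; ring
    rw [preimage_floor_mul hn, measureReal_def, Real.volume_Ico, hz',
      ENNReal.toReal_ofReal (by positivity), div_eq_mul_inv]
    simp only [f, hz, true_and]
  have hev : ∀ᶠ n : ℕ in atTop, 1 ≤ n := eventually_ge_atTop 1
  have key : Tendsto (fun n : ℕ => ∫ x : ℝ, f n ⌊(n : ℝ) * x⌋) atTop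
      (𝓝 (∫ x : ℝ, (Set.Icc (0 : ℝ) 1).indicator
        (fun x => ∏ j, chi (x + b * ∑ i ∈ Iic j, y i)) x)) := by
    refine tendsto_integral_filter_of_dominated_convergence
      ((Set.Icc (0 : ℝ) 1).indicator fun _ => 1) ?_ ?_ ?_ ?_
    · filter_upwards [hev] with n hn
      exact (hint n hn).1.aestronglyMeasurable
    · filter_upwards [hev] with n hn
      have hn0 : (0 : ℝ) < n := by exact_mod_cast hn
      refine ae_of_all _ fun x => ?_
      simp only [f, Real.norm_eq_abs]
      split_ifs with h
      · rw [Set.indicator_of_mem, abs_one]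
        rw [mem_Ico, Int.le_floor, Int.floor_lt] at h
        push_cast at h
        constructor <;> nlinarith [h.1.1, h.1.2]
      · rw [abs_zero]
        exact Set.indicator_nonneg (fun _ _ => zero_le_one) _
    · exact (integrable_indicator_iff measurableSet_Icc).2
        (integrableOn_const isCompact_Icc.measure_lt_top.ne)
    · have hne : ∀ c : ℝ, ∀ᵐ x : ℝ, x ≠ c := fun c => by simp [ae_iff]
      -- Only finitely many starting points make the limiting walk hit an endpoint; they are
      -- discarded so that `eventually_mem_iff` applies at every step.
      have hall : ∀ᵐ x : ℝ, ∀ j : Fin p, x + b * ∑ i ∈ Iic j, y i ≠ 0 ∧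
          x + b * ∑ i ∈ Iic j, y i ≠ 1 := by
        rw [ae_all_iff]
        intro j
        filter_upwards [hne (-(b * ∑ i ∈ Iic j, y i)), hne (1 - b * ∑ i ∈ Iic j, y i)] with x h1 h2
        exact ⟨fun h => h1 (by linarith), fun h => h2 (by linarith)⟩
      filter_upwards [hall, hne 0, hne 1] with x hx hx0 hx1
      have ht : Tendsto (fun n : ℕ => (⌊(n : ℝ) * x⌋ : ℝ) / n) atTop (𝓝 x) :=
        tendsto_floor_mul_div tendsto_id x
      have e0 := eventually_mem_iff ht hx0 hx1
      have ej : ∀ᶠ n : ℕ in atTop, ∀ j : Fin p,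
          (0 ≤ ⌊(n : ℝ) * x⌋ + ∑ l ∈ Iic j, J n l ∧ ⌊(n : ℝ) * x⌋ + ∑ l ∈ Iic j, J n l < n ↔
            x + b * ∑ i ∈ Iic j, y i ∈ Set.Icc (0 : ℝ) 1) := by
        rw [eventually_all]
        intro j
        refine eventually_mem_iff ?_ (hx j).1 (hx j).2
        have h1 : Tendsto (fun n => (w n : ℝ) / n * ∑ l ∈ Iic j, (J n l : ℝ) / w n) atTop
            (𝓝 (b * ∑ i ∈ Iic j, y i)) := hb.mul (tendsto_finsetSum _ fun l _ => hJ l)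
        refine (ht.add h1).congr' ?_
        filter_upwards [hw.eventually_ge_atTop 1] with n hn
        have hn0 : (w n : ℝ) ≠ 0 := by
          have : (0 : ℝ) < w n := by exact_mod_cast hn
          exact this.ne'
        push_cast
        rw [add_div, ← sum_div]
        field_simp
      refine tendsto_const_nhds.congr' ?_
      filter_upwards [e0, ej] with n h0 hj
      simp only [Set.indicator_apply, prod_chi, f, StaysIn, hj, mem_Ico, h0, ← ite_and]
      congr
  rw [integral_indicator measurableSet_Icc] at key
  refine key.congr' ?_
  filter_upwards [hev] with n hn
  exact (hint n hn).2

end Riemann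

end ToeplitzBand

end

noncomputable section

namespace ToeplitzBand

set_option linter.unusedSectionVars false

/-! ### Generic values of integer linear forms, and elimination of one linear relation. -/

section LinearForms

open Finset

variable {β ι : Type*} [Fintype β] [DecidableEq β] [Fintype ι] [DecidableEq ι]

/-- The values at `z` of linear forms with integer coefficients. -/
def linForms {R : Type*} [CommRing R] (M : β → ι → ℤ) (z : ι → R) (V : β) : R :=
  ∑ k, (M V k : R) * z k

/-- The linear forms are non-zero and no two of them agree up to sign. -/
structure Separated (M : β → ι → ℤ) : Prop where
  ne_zero : ∀ V, M V ≠ 0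
  ne : ∀ V W, V ≠ W → M V ≠ M W
  ne_neg : ∀ V W, V ≠ W → M V ≠ -M W

lemma tendsto_linForms_floor {w : ℕ → ℕ} (hw : Tendsto w atTop atTop) (M : β → ι → ℤ) (u : ι → ℝ)
    (V : β) : Tendsto (fun n => ((linForms M (fun k => ⌊(w n : ℝ) * u k⌋) V : ℤ) : ℝ) / w n) atTop
      (𝓝 (linForms M u V)) := by
  have h : ∀ n, ((linForms M (fun k => ⌊(w n : ℝ) * u k⌋) V : ℤ) : ℝ) / w n
      = ∑ k, (M V k : ℝ) * (⌊(w n : ℝ) * u k⌋ / w n) := by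
    intro n
    simp only [linForms, Int.cast_sum, Int.cast_mul, sum_div, mul_div_assoc, Int.cast_id]
  simp_rw [h]
  exact tendsto_finsetSum _ fun k _ => (tendsto_floor_mul_div hw (u k)).const_mul _

/-- Each excluded coincidence is a level set of a non-zero form: a single form, or a sum or
difference of two, which `Separated` keeps non-zero. The values `±1` are excluded because they lie
on the boundary of the cube. -/
lemma Separated.ae_linForms {M : β → ι → ℤ} (hM : Separated M) : ∀ᵐ u : ι → ℝ,
    (∀ V, linForms M u V ≠ 0 ∧ linForms M u V ≠ 1 ∧ linForms M u V ≠ -1) ∧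
      ∀ V W, V ≠ W → linForms M u V ≠ linForms M u W ∧ linForms M u V ≠ -linForms M u W := by
  have hcast : ∀ m : ι → ℤ, m ≠ 0 → (fun k => (m k : ℝ)) ≠ 0 := fun m hm h =>
    hm (funext fun k => by simpa using congrFun h k)
  have h1 : ∀ᵐ u : ι → ℝ, ∀ V,
      linForms M u V ≠ 0 ∧ linForms M u V ≠ 1 ∧ linForms M u V ≠ -1 := by
    rw [ae_all_iff]
    intro V
    have := ae_sum_mul_ne (hcast _ (hM.ne_zero V))
    filter_upwards [this 0, this 1, this (-1)] with u h0 h1 h2 using ⟨h0, h1, h2⟩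
  have h2 : ∀ᵐ u : ι → ℝ, ∀ V W, V ≠ W →
      linForms M u V ≠ linForms M u W ∧ linForms M u V ≠ -linForms M u W := by
    rw [ae_all_iff]; intro V
    rw [ae_all_iff]; intro W
    by_cases hVW : V = W
    · exact ae_of_all _ fun u h => absurd hVW h
    have h3 := ae_sum_mul_ne (hcast (M V - M W) (sub_ne_zero.2 (hM.ne V W hVW))) 0
    have h4 := ae_sum_mul_ne (hcast (M V + M W)
      (fun h => hM.ne_neg V W hVW (eq_neg_of_add_eq_zero_left h))) 0
    filter_upwards [h3, h4] with u h5 h6 _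
    refine ⟨fun h => h5 ?_, fun h => h6 ?_⟩
    · simpa [linForms, sub_mul, sub_eq_zero] using h
    · simpa [linForms, add_mul, sum_add_distrib, ← eq_neg_iff_add_eq_zero] using h
  filter_upwards [h1, h2] with u h3 h4 using ⟨h3, h4⟩

section Words

variable {p q : ℕ}

/-- The proportion of the pairs of starting points from which both halves of the word `K` stay in
`[0, n)`. -/
def stayWeight (n : ℕ) (K : Fin (p + q) → ℤ) : ℝ :=
  (stayCount n (fun i => K (Fin.castAdd q i)) : ℝ) / n *
    ((stayCount n (fun j => K (Fin.natAdd p j)) : ℝ) / n)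

/-- The limit of `stayWeight`. -/
def stayWeightLimit (b : ℝ) (y : Fin (p + q) → ℝ) : ℝ :=
  stayLength b (fun i => y (Fin.castAdd q i)) * stayLength b (fun j => y (Fin.natAdd p j))

/-- The real version of `assemble`. -/
def assembleReal (π : Partition (p + q)) (sgn : Fin (p + q) → ℤ) (s : ℤ) (x : π.parts → ℝ)
    (i : Fin (p + q)) : ℝ :=
  sideSign p q s i * (sgn i * x (blockOf π i))

lemma stayWeight_mem (n : ℕ) (K : Fin (p + q) → ℤ) : |stayWeight n K| ≤ 1 := by
  have h : ∀ {m : ℕ} (J : Fin m → ℤ), |(stayCount n J : ℝ) / n| ≤ 1 := by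
    intro m J
    rw [abs_of_nonneg (by positivity)]
    exact div_le_one_of_le₀ (by exact_mod_cast stayCount_le n J) (Nat.cast_nonneg _)
  rw [stayWeight, abs_mul]
  exact mul_le_one₀ (h _) (abs_nonneg _) (h _)

open Classical in
-- For almost every `u` the rescaled lattice point is eventually generic, and it eventually lies in
-- the box exactly when the limiting forms lie in the cube. Genericity therefore costs nothing in
-- the limit.
lemma tendsto_sum_generic {w : ℕ → ℕ} (hw : Tendsto w atTop atTop) {b : ℝ}
    (hb : Tendsto (fun n => (w n : ℝ) / n) atTop (𝓝 b)) (π : Partition (p + q))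
    (sgn : Fin (p + q) → ℤ) (s : ℤ) {M : π.parts → ι → ℤ} (hM : Separated M) :
    Tendsto (fun n => (w n : ℝ)⁻¹ ^ Fintype.card ι * ∑ z ∈ boxWords ι (w n),
      if linForms M z ∈ boxWords π.parts (w n) ∧ IsGeneric (linForms M z) then
        stayWeight n (assemble π sgn s (linForms M z)) else 0) atTop
      (𝓝 (∫ u in Set.Icc (-1 : ι → ℝ) 1, (Set.Icc (-1 : π.parts → ℝ) 1).indicator
        (fun x => stayWeightLimit b (assembleReal π sgn s x)) (linForms M u))) := by
  refine tendsto_sum_boxWords hw (fun n z => if linForms M z ∈ boxWords π.parts (w n) ∧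
    IsGeneric (linForms M z) then stayWeight n (assemble π sgn s (linForms M z)) else 0) _ 1 ?_ ?_
  · intro n z
    split_ifs
    · exact stayWeight_mem _ _
    · simp
  filter_upwards [hM.ae_linForms] with u hu _
  have ht := tendsto_linForms_floor hw M u
  have hw1 : ∀ᶠ n in atTop, 1 ≤ w n := hw.eventually_ge_atTop 1
  have hgen : ∀ᶠ n in atTop, IsGeneric (linForms M fun k => ⌊(w n : ℝ) * u k⌋) := by
    have h1 : ∀ᶠ n in atTop, ∀ V, linForms M (fun k => ⌊(w n : ℝ) * u k⌋) V ≠ 0 := by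
      rw [eventually_all]
      intro V
      filter_upwards [(ht V).eventually_ne (hu.1 V).1] with n hn h
      exact hn (by simp [h])
    have h2 : ∀ᶠ n in atTop, ∀ V W, V ≠ W →
        (linForms M (fun k => ⌊(w n : ℝ) * u k⌋) V).natAbs
          ≠ (linForms M (fun k => ⌊(w n : ℝ) * u k⌋) W).natAbs := by
      rw [eventually_all]; intro V
      rw [eventually_all]; intro W
      by_cases hVW : V = W
      · exact Eventually.of_forall fun _ h => absurd hVW h
      have h3 := ((ht V).sub (ht W)).eventually_ne (sub_ne_zero.2 (hu.2 V W hVW).1)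
      have h4 := ((ht V).add (ht W)).eventually_ne
        (fun h => (hu.2 V W hVW).2 (eq_neg_of_add_eq_zero_left h))
      filter_upwards [h3, h4] with n h5 h6 _ h7
      rcases Int.natAbs_eq_natAbs_iff.1 h7 with h8 | h8
      · exact h5 (by rw [h8, sub_self])
      · exact h6 (by rw [h8]; push_cast; ring)
    filter_upwards [h1, h2] with n h3 h4 using ⟨h3, h4⟩
  by_cases hmem : linForms M u ∈ Set.Icc (-1 : π.parts → ℝ) 1
  · rw [Set.indicator_of_mem hmem]
    have hbox : ∀ᶠ n in atTop,
        (linForms M fun k => ⌊(w n : ℝ) * u k⌋) ∈ boxWords π.parts (w n) := by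
      have h1 : ∀ᶠ n in atTop, ∀ V, ((linForms M (fun k => ⌊(w n : ℝ) * u k⌋) V : ℤ) : ℝ) / w n < 1 ∧
          -1 < ((linForms M (fun k => ⌊(w n : ℝ) * u k⌋) V : ℤ) : ℝ) / w n := by
        rw [eventually_all]
        intro V
        have h2 : linForms M u V < 1 := lt_of_le_of_ne (hmem.2 V) (hu.1 V).2.1
        have h3 : -1 < linForms M u V := lt_of_le_of_ne (hmem.1 V) (hu.1 V).2.2.symm
        exact ((ht V).eventually_lt_const h2).and ((ht V).eventually_const_lt h3)
      filter_upwards [h1, hw1] with n hn hn1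
      have hn0 : (0 : ℝ) < w n := by exact_mod_cast hn1
      simp only [boxWords, Fintype.mem_piFinset, mem_Icc]
      intro V
      have h2 := hn V
      rw [div_lt_iff₀ hn0, lt_div_iff₀ hn0, one_mul, neg_one_mul] at h2
      exact ⟨by exact_mod_cast h2.2.le, by exact_mod_cast h2.1.le⟩
    have hy : ∀ i, Tendsto (fun n => ((assemble π sgn s
        (linForms M fun k => ⌊(w n : ℝ) * u k⌋) i : ℤ) : ℝ) / w n) atTop
        (𝓝 (assembleReal π sgn s (linForms M u) i)) := by
      intro i
      simp only [assemble, assembleReal]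
      push_cast
      simp only [mul_div_assoc]
      exact ((ht _).const_mul _).const_mul _
    refine ((tendsto_stayCount hw hb fun i => hy (Fin.castAdd q i)).mul
      (tendsto_stayCount hw hb fun i => hy (Fin.natAdd p i))).congr' ?_
    filter_upwards [hgen, hbox] with n h1 h2
    rw [if_pos ⟨h2, h1⟩]
    rfl
  · rw [Set.indicator_of_notMem hmem]
    have h3 : ∃ V, linForms M u V < -1 ∨ 1 < linForms M u V := by
      by_contra! h3
      exact hmem ⟨fun k => (h3 k).1, fun k => (h3 k).2⟩
    obtain ⟨V, hV⟩ := h3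
    have h5 : ∀ᶠ n in atTop, ((linForms M (fun k => ⌊(w n : ℝ) * u k⌋) V : ℤ) : ℝ) / w n < -1 ∨
        1 < ((linForms M (fun k => ⌊(w n : ℝ) * u k⌋) V : ℤ) : ℝ) / w n := by
      rcases hV with hk | hk
      · exact ((ht V).eventually_lt_const hk).mono fun _ h => Or.inl h
      · exact ((ht V).eventually_const_lt hk).mono fun _ h => Or.inr h
    refine tendsto_const_nhds.congr' ?_
    filter_upwards [h5, hw1] with n hn hn1
    have hn0 : (0 : ℝ) < w n := by exact_mod_cast hn1
    refine (if_neg fun hbox => ?_).symm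
    have h6 := hbox.1
    simp only [boxWords, Fintype.mem_piFinset, mem_Icc] at h6
    obtain ⟨h7, h8⟩ := h6 V
    have h7' : (-(w n : ℝ)) ≤ (linForms M (fun k => ⌊(w n : ℝ) * u k⌋) V : ℤ) := by exact_mod_cast h7
    have h8' : ((linForms M (fun k => ⌊(w n : ℝ) * u k⌋) V : ℤ) : ℝ) ≤ w n := by exact_mod_cast h8
    rw [div_lt_iff₀ hn0, lt_div_iff₀ hn0] at hn
    rcases hn with hn | hn <;> linarith

end Words

section Solve

/-- The linear forms that give all the coordinates of the solution of `∑ c_w x_w = 0` in terms of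
the coordinates other than `x_v`, where `c_v = 1`. -/
def solveForms (c : β → ℤ) (v : β) (V : β) (k : {w : β // w ≠ v}) : ℤ :=
  if V = v then -c k else if V = k then 1 else 0

lemma linForms_solveForms_self {R : Type*} [CommRing R] (c : β → ℤ) (v : β)
    (z : {w : β // w ≠ v} → R) :
    linForms (solveForms c v) z v = -∑ k : {w : β // w ≠ v}, (c k : R) * z k := by
  simp [linForms, solveForms]

lemma linForms_solveForms_of_ne {R : Type*} [CommRing R] (c : β → ℤ) (v : β)
    (z : {w : β // w ≠ v} → R) {V : β} (hV : V ≠ v) :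
    linForms (solveForms c v) z V = z ⟨V, hV⟩ := by
  rw [linForms, sum_eq_single ⟨V, hV⟩]
  · simp [solveForms, hV]
  · rintro ⟨W, hW⟩ _ hne
    have : V ≠ W := fun h => hne (by simp [h])
    simp [solveForms, hV, this]
  · simp

/-- The solved coordinate involves at least two free ones, so it is not plus or minus a free
coordinate. This is where three crossing pairs are needed: with two, generic block values could not
satisfy the relation. -/
lemma separated_solveForms {c : β → ℤ} {v a a' : β} (ha : c a ≠ 0) (ha' : c a' ≠ 0) (hav : a ≠ v)
    (hav' : a' ≠ v) (haa : a ≠ a') : Separated (solveForms c v) := by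
  have hunit : ∀ W (hW : W ≠ v) k, solveForms c v W k = if W = k then 1 else 0 := by
    intro W hW k; simp [solveForms, hW]
  have hv : ∀ k, solveForms c v v k = -c k := by intro k; simp [solveForms]
  have hmix : ∀ (e : ℤ) W, W ≠ v → solveForms c v v ≠ e • solveForms c v W := by
    intro e W hW h
    have h1 := congrFun h ⟨a, hav⟩
    have h2 := congrFun h ⟨a', hav'⟩
    rw [Pi.smul_apply, hv, hunit W hW] at h1 h2
    by_cases hWa : W = a
    · have : W ≠ a' := fun h => haa (hWa.symm.trans h)
      simp [this] at h2
      exact ha' h2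
    · simp [hWa] at h1
      exact ha h1
  have hself : ∀ (e : ℤ) V W (hV : V ≠ v), W ≠ v → V ≠ W →
      solveForms c v V ≠ e • solveForms c v W := by
    intro e V W hV hW hVW h
    have h1 := congrFun h ⟨V, hV⟩
    rw [Pi.smul_apply, hunit V hV, hunit W hW] at h1
    simp [hVW.symm] at h1
  have hmix' : ∀ (e : ℤ) W, W ≠ v → e * e = 1 → solveForms c v W ≠ e • solveForms c v v := by
    intro e W hW he h
    refine hmix e W hW ?_
    rw [h, smul_smul, he, one_smul]
  have key : ∀ (e : ℤ), e * e = 1 → ∀ V W, V ≠ W →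
      solveForms c v V ≠ e • solveForms c v W := by
    intro e he V W hVW
    by_cases hV : V = v
    · subst hV; exact hmix e W hVW.symm
    · by_cases hW : W = v
      · subst hW; exact hmix' e V hV he
      · exact hself e V W hV hW hVW
  refine ⟨fun V h => ?_, fun V W hVW h => key 1 (by norm_num) V W hVW (by simpa using h),
    fun V W hVW h => key (-1) (by norm_num) V W hVW (by simpa using h)⟩
  by_cases hV : V = v
  · subst hV
    exact hmix 0 a hav (by simpa using h)
  · have := congrFun h ⟨V, hV⟩
    rw [hunit V hV] at this
    simp at this

/-- Summation over the integer points of a hyperplane in a box. -/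
lemma sum_boxWords_hyperplane {c : β → ℤ} {v : β} (hv : c v = 1) (w : ℕ) (F : (β → ℤ) → ℝ) :
    ∑ x ∈ boxWords β w, (if ∑ V, c V * x V = 0 then F x else 0)
      = ∑ z ∈ boxWords {W : β // W ≠ v} w, if linForms (solveForms c v) z ∈ boxWords β w then
        F (linForms (solveForms c v) z) else 0 := by
  have hsplit : ∀ x : β → ℤ, ∑ V, c V * x V = x v + ∑ k : {W : β // W ≠ v}, c k * x k := by
    intro x
    rw [Fintype.sum_eq_add_sum_subtype_ne _ v, hv, one_mul]
  -- As `c v = 1`, the relation is solved over the integers without any divisibility condition.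
  have hsolve : ∀ x : β → ℤ, ∑ V, c V * x V = 0 →
      linForms (solveForms c v) (fun k : {W : β // W ≠ v} => x k) = x := by
    intro x hx
    rw [hsplit] at hx
    funext V
    by_cases hV : V = v
    · subst hV
      rw [linForms_solveForms_self]
      simp only [Int.cast_id]
      linarith
    · rw [linForms_solveForms_of_ne _ _ _ hV]
  rw [← sum_filter, ← sum_filter]
  refine sum_nbij' (fun x k => x k) (fun z => linForms (solveForms c v) z) ?_ ?_ ?_ ?_ ?_
  · intro x hx
    rw [mem_filter] at hx ⊢
    rw [hsolve x hx.2]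
    refine ⟨?_, hx.1⟩
    have := hx.1
    simp only [boxWords, Fintype.mem_piFinset] at this ⊢
    exact fun k => this k
  · intro z hz
    rw [mem_filter] at hz ⊢
    refine ⟨hz.2, ?_⟩
    rw [hsplit, linForms_solveForms_self]
    simp only [Int.cast_id]
    have h1 : ∀ k : {W : β // W ≠ v}, linForms (solveForms c v) z k = z k := fun k =>
      linForms_solveForms_of_ne c v z k.2
    simp only [h1, neg_add_cancel]
  · intro x hx
    exact hsolve x (mem_filter.1 hx).2
  · intro z _
    funext k
    exact linForms_solveForms_of_ne c v z k.2
  · intro x hx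
    rw [hsolve x (mem_filter.1 hx).2]

end Solve

end LinearForms

end ToeplitzBand

end

noncomputable section

namespace ToeplitzBand

set_option linter.unusedSectionVars false

/-! ### Coefficients of assembled words, and the limit integrals in product form. -/

section Words

open Finset

variable {p q : ℕ}

lemma exists_mem_block {m : ℕ} {π : Partition m} (V : π.parts) : ∃ i, blockOf π i = V := by
  obtain ⟨i, hi⟩ := π.nonempty_of_mem_parts V.2
  exact ⟨i, Subtype.ext (π.part_eq_of_mem V.2 hi)⟩

lemma blockOf_eq_iff_mem {m : ℕ} {π : Partition m} {V : π.parts} {i : Fin m} :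
    blockOf π i = V ↔ i ∈ (V : Finset (Fin m)) := by
  constructor
  · rintro rfl; exact mem_part_self' π i
  · exact fun hi => Subtype.ext (π.part_eq_of_mem V.2 hi)

section Assemble

variable {π : Partition (p + q)} {sgn : Fin (p + q) → ℤ} {s : ℤ}
  (hsgn : ∀ i, sgn i = 1 ∨ sgn i = -1) (hs : s = 1 ∨ s = -1)
include hsgn hs

lemma assemble_injective : Function.Injective (assemble π sgn s) := by
  intro x x' h
  funext V
  obtain ⟨i, rfl⟩ := exists_mem_block V
  have h1 := congrFun h i
  simp only [assemble] at h1
  have h2 : sgn i ≠ 0 := by rcases hsgn i with h | h <;> simp [h]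
  have h3 : sideSign p q s i ≠ 0 := by
    simp only [sideSign]; rcases hs with rfl | rfl <;> split_ifs <;> simp
  exact mul_left_cancel₀ h2 (mul_left_cancel₀ h3 h1)

lemma assemble_mem_boxWords {w : ℕ} {x : π.parts → ℤ} :
    assemble π sgn s x ∈ boxWords (Fin (p + q)) w ↔ x ∈ boxWords π.parts w := by
  have h : ∀ y : ℤ, y ∈ Icc (-(w : ℤ)) w ↔ y.natAbs ≤ w := fun y => by rw [mem_Icc]; omega
  simp only [boxWords, Fintype.mem_piFinset, h, natAbs_assemble hsgn hs]
  constructor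
  · intro h1 V
    obtain ⟨i, rfl⟩ := exists_mem_block V
    exact h1 i
  · exact fun h1 i => h1 _

open Classical in
lemma sum_genericWords (w : ℕ) (F : (Fin (p + q) → ℤ) → ℝ) :
    ∑ K ∈ boxWords (Fin (p + q)) w, F K * (if K ∈ genericWords π sgn s then 1 else 0)
      = ∑ x ∈ boxWords π.parts w, if IsGeneric x then F (assemble π sgn s x) else 0 := by
  simp only [mul_ite, mul_one, mul_zero]
  rw [← sum_filter, ← sum_filter]
  symm
  refine sum_nbij (assemble π sgn s) ?_ ((assemble_injective hsgn hs).injOn) ?_ (fun _ _ => rfl)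
  · intro x hx
    rw [mem_filter] at hx ⊢
    exact ⟨(assemble_mem_boxWords hsgn hs).2 hx.1, x, hx.2, rfl⟩
  · intro K hK
    rw [mem_coe, mem_filter] at hK
    obtain ⟨hb, x, hx, rfl⟩ := hK
    exact ⟨x, mem_coe.2 (mem_filter.2 ⟨(assemble_mem_boxWords hsgn hs).1 hb, hx⟩), rfl⟩

end Assemble

/-- The coefficient of the value of the block `V` in the sum over one half of the word. -/
def sideCoeff (π : Partition (p + q)) (sgn : Fin (p + q) → ℤ) (h : Bool) (V : π.parts) : ℤ :=
  ∑ i ∈ (V : Finset (Fin (p + q))), if side p q i = h then sgn i else 0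

lemma sum_side_eq (π : Partition (p + q)) (sgn : Fin (p + q) → ℤ) (h : Bool) (x : π.parts → ℤ) :
    ∑ i with side p q i = h, sgn i * x (blockOf π i) = ∑ V, sideCoeff π sgn h V * x V := by
  rw [← sum_fiberwise_of_maps_to (g := blockOf π) (t := univ) (fun _ _ => mem_univ _)]
  refine sum_congr rfl fun V _ => ?_
  rw [sideCoeff, sum_mul, filter_filter, sum_filter, sum_congr rfl fun i _ => ite_mul _ _ _ _,
    ← sum_subset (subset_univ (V : Finset (Fin (p + q)))) fun i _ hi => if_neg fun h' => hi
      (blockOf_eq_iff_mem.1 h'.2)]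
  refine sum_congr rfl fun i hi => ?_
  rw [blockOf_eq_iff_mem.2 hi]
  simp

lemma sum_castAdd_assemble (π : Partition (p + q)) (sgn : Fin (p + q) → ℤ) (s : ℤ)
    (x : π.parts → ℤ) :
    ∑ i : Fin p, assemble π sgn s x (Fin.castAdd q i) = ∑ V, sideCoeff π sgn false V * x V := by
  rw [← sum_side_eq, sum_filter, Fin.sum_univ_add]
  simp [assemble, sideSign]

lemma sum_natAdd_assemble (π : Partition (p + q)) (sgn : Fin (p + q) → ℤ) (s : ℤ)
    (x : π.parts → ℤ) :
    ∑ j : Fin q, assemble π sgn s x (Fin.natAdd p j) = s * ∑ V, sideCoeff π sgn true V * x V := by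
  rw [← sum_side_eq, sum_filter, Fin.sum_univ_add]
  simp [assemble, sideSign, mul_sum]

lemma sideCoeff_false_cast (π : Partition (p + q)) (sgn : Fin (p + q) → ℤ) (V : π.parts) :
    (sideCoeff π sgn false V : ℝ) = halfSumCoeff π (fun i => (sgn i : ℝ)) V := by
  have h1 : sideCoeff π sgn false V
      = ∑ i, if i ∈ (V : Finset (Fin (p + q))) then
          (if side p q i = false then sgn i else 0) else 0 := by
    rw [sum_ite_mem, univ_inter, sideCoeff]
  rw [h1, Fin.sum_univ_add, halfSumCoeff]
  simp only [side_castAdd, side_natAdd, if_true, Bool.true_eq_false, if_false, ite_self,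
    sum_const_zero, add_zero, Int.cast_sum, Int.cast_ite, Int.cast_zero, blockOf_eq_iff_mem]

lemma isCrossing_iff_side {V : Finset (Fin (p + q))} : IsCrossing p q V ↔
    (∃ i ∈ V, side p q i = false) ∧ ∃ i ∈ V, side p q i = true := by
  constructor
  · rintro ⟨⟨i, hi⟩, ⟨j, hj⟩⟩
    exact ⟨⟨_, hi, side_castAdd i⟩, ⟨_, hj, side_natAdd j⟩⟩
  · rintro ⟨⟨i, hi, hi'⟩, ⟨j, hj, hj'⟩⟩
    obtain ⟨i, rfl⟩ := eq_castAdd_of_side hi'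
    obtain ⟨j, rfl⟩ := eq_natAdd_of_side hj'
    exact ⟨⟨i, hi⟩, ⟨j, hj⟩⟩

section Pair

variable {π : Partition (p + q)} {sgn : Fin (p + q) → ℤ} {V : π.parts}
  (hV : #(V : Finset (Fin (p + q))) = 2)
  (hsgn : ∀ i ∈ (V : Finset (Fin (p + q))), sgn i = if i = blockMin π i then 1 else -1)
include hV hsgn

lemma exists_pair_sideCoeff : ∃ a b, a < b ∧ (V : Finset (Fin (p + q))) = {a, b} ∧
    ∀ h, sideCoeff π sgn h V
      = (if side p q a = h then 1 else 0) + if side p q b = h then -1 else 0 := by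
  obtain ⟨a, b, hab, he⟩ : ∃ a b, a < b ∧ (V : Finset (Fin (p + q))) = {a, b} := by
    obtain ⟨a, b, hab, he⟩ := card_eq_two.1 hV
    rcases lt_or_gt_of_ne hab with h | h
    · exact ⟨a, b, h, he⟩
    · exact ⟨b, a, h, by rw [he, pair_comm]⟩
  have ha : a ∈ (V : Finset (Fin (p + q))) := by simp [he]
  have hb : b ∈ (V : Finset (Fin (p + q))) := by simp [he]
  have hpa : π.part a = {a, b} := by rw [← he]; exact π.part_eq_of_mem V.2 ha
  have hpb : π.part b = {a, b} := by rw [← he]; exact π.part_eq_of_mem V.2 hb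
  have hma : a = blockMin π a := by
    refine isMin_iff.1 fun j hj => ?_
    rw [hpa, mem_insert, mem_singleton] at hj
    rcases hj with rfl | rfl
    · exact le_rfl
    · exact hab.le
  have hmb : b ≠ blockMin π b := by
    intro h
    exact absurd (isMin_iff.2 h a (by simp [hpb])) (not_le.2 hab)
  refine ⟨a, b, hab, he, fun h => ?_⟩
  rw [sideCoeff, he, sum_pair hab.ne, hsgn a ha, hsgn b hb, if_pos hma, if_neg hmb]

/-- The two signs of a pair cancel. The zero-sum conditions of the two halves therefore coincide,
and only one Dirac function appears in the limit. -/
lemma sideCoeff_true_of_pair : sideCoeff π sgn true V = -sideCoeff π sgn false V := by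
  obtain ⟨a, b, -, -, hc⟩ := exists_pair_sideCoeff hV hsgn
  rw [hc, hc]
  cases side p q a <;> cases side p q b <;> simp

/-- The first half precedes the second, so it contains the smaller element of the pair, whose sign
is `1`. -/
lemma sideCoeff_of_crossing (hc : IsCrossing p q V) : sideCoeff π sgn false V = 1 := by
  obtain ⟨a, b, hab, he, hco⟩ := exists_pair_sideCoeff hV hsgn
  rw [hco]
  rw [isCrossing_iff_side, he] at hc
  simp only [mem_insert, mem_singleton, exists_eq_or_imp, exists_eq_left] at hc
  cases ha : side p q a <;> cases hb : side p q b <;> simp [ha, hb] at hc ⊢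
  exact absurd (lt_of_side hb ha) (not_lt.2 hab.le)

lemma sideCoeff_of_not_crossing (hc : ¬ IsCrossing p q V) (h : Bool) : sideCoeff π sgn h V = 0 := by
  obtain ⟨a, b, hab, he, hco⟩ := exists_pair_sideCoeff hV hsgn
  rw [hco]
  rw [isCrossing_iff_side, he] at hc
  simp only [mem_insert, mem_singleton, exists_eq_or_imp, exists_eq_left] at hc
  cases ha : side p q a <;> cases hb : side p q b <;> cases h <;> simp [ha, hb] at hc ⊢

end Pair

lemma card_filter_side_false (V : Finset (Fin (p + q))) :
    #{i ∈ V | side p q i = false} = #{i : Fin p | Fin.castAdd q i ∈ V} := by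
  rw [card_eq_add_halves]
  simp

lemma card_filter_side_true (V : Finset (Fin (p + q))) :
    #{i ∈ V | side p q i = true} = #{i : Fin q | Fin.natAdd p i ∈ V} := by
  rw [card_eq_add_halves]
  simp

/-- In increasing order the signs are `+, -, -, +`, and each half contains two consecutive elements.
-/
lemma sideCoeff_of_four {π : Partition (p + q)} {V : π.parts}
    (hf : #{i : Fin p | Fin.castAdd q i ∈ (V : Finset (Fin (p + q)))} = 2)
    (ht : #{i : Fin q | Fin.natAdd p i ∈ (V : Finset (Fin (p + q)))} = 2) (h : Bool) :
    sideCoeff π (tauInt π) h V = 0 := by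
  have hcard : #(V : Finset (Fin (p + q))) = 4 := by rw [card_eq_add_halves, hf, ht]
  rw [← card_filter_side_false] at hf
  rw [← card_filter_side_true] at ht
  have hpair : ∀ F : Finset (Fin (p + q)), #F = 2 → ∃ a b, a < b ∧ F = {a, b} := by
    intro F hF
    obtain ⟨a, b, hab, he⟩ := card_eq_two.1 hF
    rcases lt_or_gt_of_ne hab with h | h
    · exact ⟨a, b, h, he⟩
    · exact ⟨b, a, h, by rw [he, pair_comm]⟩
  obtain ⟨i₁, i₂, h12, e12⟩ := hpair _ hf
  obtain ⟨i₃, i₄, h34, e34⟩ := hpair _ ht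
  have hmem12 : ∀ i, i ∈ (V : Finset (Fin (p + q))) ∧ side p q i = false ↔ i = i₁ ∨ i = i₂ :=
    fun i => by have := Finset.ext_iff.1 e12 i; simpa using this
  have hmem34 : ∀ i, i ∈ (V : Finset (Fin (p + q))) ∧ side p q i = true ↔ i = i₃ ∨ i = i₄ :=
    fun i => by have := Finset.ext_iff.1 e34 i; simpa using this
  obtain ⟨k1, s1⟩ := (hmem12 i₁).2 (Or.inl rfl)
  obtain ⟨k2, s2⟩ := (hmem12 i₂).2 (Or.inr rfl)
  obtain ⟨k3, s3⟩ := (hmem34 i₃).2 (Or.inl rfl)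
  obtain ⟨k4, s4⟩ := (hmem34 i₄).2 (Or.inr rfl)
  have h23 := lt_of_side s2 s3
  have hall : ∀ i ∈ (V : Finset (Fin (p + q))), i = i₁ ∨ i = i₂ ∨ i = i₃ ∨ i = i₄ := by
    intro i hi
    cases hsi : side p q i with
    | false => rcases (hmem12 i).1 ⟨hi, hsi⟩ with h | h <;> simp [h]
    | true => rcases (hmem34 i).1 ⟨hi, hsi⟩ with h | h <;> simp [h]
  have hpart : ∀ {i}, i ∈ (V : Finset (Fin (p + q))) → π.part i = V := fun hi =>
    π.part_eq_of_mem V.2 hi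
  have t1 : tauInt π i₁ = 1 := by
    refine if_pos (Or.inl fun j hj => ?_)
    rw [hpart k1] at hj
    rcases hall j hj with h6 | h6 | h6 | h6 <;> rw [h6]
    · exact h12.le
    · exact (h12.trans h23).le
    · exact (h12.trans (h23.trans h34)).le
  have t4 : tauInt π i₄ = 1 := by
    refine if_pos (Or.inr ⟨by rw [hpart k4, hcard], fun j hj => ?_⟩)
    rw [hpart k4] at hj
    rcases hall j hj with h6 | h6 | h6 | h6 <;> rw [h6]
    · exact (h12.trans (h23.trans h34)).le
    · exact (h23.trans h34).le
    · exact h34.le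
  have t2 : tauInt π i₂ = -1 := by
    refine if_neg ?_
    rw [hpart k2]
    rintro (h6 | ⟨-, h6⟩)
    · exact absurd (h6 _ k1) (not_le.2 h12)
    · exact absurd (h6 _ k4) (not_le.2 (h23.trans h34))
  have t3 : tauInt π i₃ = -1 := by
    refine if_neg ?_
    rw [hpart k3]
    rintro (h6 | ⟨-, h6⟩)
    · exact absurd (h6 _ k1) (not_le.2 (h12.trans h23))
    · exact absurd (h6 _ k4) (not_le.2 h34)
  rw [sideCoeff, ← sum_filter]
  cases h
  · rw [e12, sum_pair h12.ne, t1, t2]; rfl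
  · rw [e34, sum_pair h34.ne, t3, t4]; rfl

/-- The two prefactors `√w` give `w`, and the matrix scaling gives `w^{-(p+q)/2}`; what is left is
the Riemann normalisation in `d` free variables. -/
lemma pairCoeff_eq {n w d : ℕ} (hw : 1 ≤ w) (hd : p + q = 2 * d + 2) (K : Fin (p + q) → ℤ) :
    pairCoeff n w K = if ∑ i : Fin p, K (Fin.castAdd q i) = 0 ∧ ∑ j : Fin q, K (Fin.natAdd p j) = 0
      then (w : ℝ)⁻¹ ^ d * stayWeight n K else 0 := by
  have hw0 : (0 : ℝ) < w := by exact_mod_cast hw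
  have hs0 : 0 < √(w : ℝ) := Real.sqrt_pos.2 hw0
  have h1 : √(w : ℝ) * √(w : ℝ) * ((√(w : ℝ))⁻¹ ^ p * (√(w : ℝ))⁻¹ ^ q) = (w : ℝ)⁻¹ ^ d := by
    rw [← pow_add, hd, pow_add, pow_mul, inv_pow, Real.sq_sqrt hw0.le]
    field_simp
    exact Real.sq_sqrt hw0.le
  simp only [pairCoeff, fluctCoeff, bandCoeff, stayWeight]
  by_cases h2 : ∑ i : Fin p, K (Fin.castAdd q i) = 0 <;>
    by_cases h3 : ∑ j : Fin q, K (Fin.natAdd p j) = 0 <;> simp only [h2, h3, if_true, if_false,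
      and_true, and_false, mul_zero, zero_mul]
  rw [← h1]
  ring

lemma chi_measurable : Measurable chi := measurable_one.indicator measurableSet_Icc

lemma chi_nonneg (t : ℝ) : 0 ≤ chi t := Set.indicator_nonneg (fun _ _ => zero_le_one) _

lemma chi_le_one (t : ℝ) : chi t ≤ 1 := Set.indicator_le_self' (fun _ _ => zero_le_one) t

lemma abs_walkIndicator_le (b s : ℝ) (y : Fin (p + q) → ℝ) (x₀ y₀ : ℝ) :
    |walkIndicator p q b s y x₀ y₀| ≤ 1 := by
  rw [walkIndicator, abs_of_nonneg (mul_nonneg (prod_nonneg fun _ _ => chi_nonneg _)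
    (prod_nonneg fun _ _ => chi_nonneg _))]
  exact mul_le_one₀ (prod_le_one (fun _ _ => chi_nonneg _) fun _ _ => chi_le_one _)
    (prod_nonneg fun _ _ => chi_nonneg _) (prod_le_one (fun _ _ => chi_nonneg _)
    fun _ _ => chi_le_one _)

lemma setIntegral_walkIndicator (b : ℝ) (π : Partition (p + q)) (sgn : Fin (p + q) → ℤ) (s : ℤ)
    (x : π.parts → ℝ) :
    ∫ t in Set.Icc (0 : ℝ) 1 ×ˢ Set.Icc (0 : ℝ) 1,
        walkIndicator p q b s (unknowns π (fun i => (sgn i : ℝ)) x) t.1 t.2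
      = stayWeightLimit b (assembleReal π sgn s x) := by
  rw [Measure.volume_eq_prod]
  simp only [walkIndicator]
  rw [setIntegral_prod_mul (fun t : ℝ => ∏ j : Fin p, chi (t + b * ∑ i ∈ Iic j,
    unknowns π (fun i => (sgn i : ℝ)) x (Fin.castAdd q i))) (fun t : ℝ => ∏ j : Fin q,
    chi (t + s * b * ∑ i ∈ Iic j, unknowns π (fun i => (sgn i : ℝ)) x (Fin.natAdd p i)))]
  simp only [stayWeightLimit, stayLength, assembleReal, sideSign, unknowns, side_castAdd,
    side_natAdd, if_true, Bool.false_eq_true, if_false, Int.cast_one, one_mul, ← mul_sum,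
    mul_comm (s : ℝ) b, mul_assoc]

/-- The definitions integrate over the starting points last, the lattice sums produce that integral
first; the bounded integrand allows the exchange. -/
lemma setIntegral_setIntegral_walkIndicator {ι : Type*} [Fintype ι] (b : ℝ) (π : Partition (p + q))
    (sgn : Fin (p + q) → ℤ) (s : ℤ) {Φ : (ι → ℝ) → π.parts → ℝ} (hΦ : Measurable Φ) :
    ∫ t in Set.Icc (0 : ℝ) 1 ×ˢ Set.Icc (0 : ℝ) 1, ∫ z in Set.Icc (-1 : ι → ℝ) 1,
        (Set.Icc (-1 : π.parts → ℝ) 1).indicator (fun x =>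
          walkIndicator p q b s (unknowns π (fun i => (sgn i : ℝ)) x) t.1 t.2) (Φ z)
      = ∫ z in Set.Icc (-1 : ι → ℝ) 1, (Set.Icc (-1 : π.parts → ℝ) 1).indicator
          (fun x => stayWeightLimit b (assembleReal π sgn s x)) (Φ z) := by
  have : IsFiniteMeasure ((volume : Measure (ℝ × ℝ)).restrict
      (Set.Icc (0 : ℝ) 1 ×ˢ Set.Icc (0 : ℝ) 1)) :=
    ⟨by rw [Measure.restrict_apply_univ]; exact (isCompact_Icc.prod isCompact_Icc).measure_lt_top⟩
  have : IsFiniteMeasure ((volume : Measure (ι → ℝ)).restrict (Set.Icc (-1 : ι → ℝ) 1)) :=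
    ⟨by rw [Measure.restrict_apply_univ]; exact isCompact_Icc.measure_lt_top⟩
  rw [integral_integral_swap]
  · refine integral_congr_ae (ae_of_all _ fun z => ?_)
    by_cases hz : Φ z ∈ Set.Icc (-1 : π.parts → ℝ) 1
    · simp only [Set.indicator_of_mem hz, setIntegral_walkIndicator]
    · simp only [Set.indicator_of_notMem hz, integral_zero]
  · refine Integrable.of_bound (C := 1) ?_ ?_
    · refine Measurable.aestronglyMeasurable ?_
      have hm : Measurable fun a : (ℝ × ℝ) × (ι → ℝ) =>
          walkIndicator p q b s (unknowns π (fun i => (sgn i : ℝ)) (Φ a.2)) a.1.1 a.1.2 := by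
        simp only [walkIndicator, unknowns]
        have h1 : ∀ V, Measurable fun a : (ℝ × ℝ) × (ι → ℝ) => Φ a.2 V := fun V =>
          (measurable_pi_apply V).comp (hΦ.comp measurable_snd)
        refine Measurable.mul ?_ ?_
        · refine Finset.measurable_fun_prod _ fun j _ => chi_measurable.comp ?_
          exact (measurable_fst.comp measurable_fst).add
            ((Finset.measurable_fun_sum _ fun i _ => (h1 _).const_mul _).const_mul _)
        · refine Finset.measurable_fun_prod _ fun j _ => chi_measurable.comp ?_
          exact (measurable_snd.comp measurable_fst).add
            ((Finset.measurable_fun_sum _ fun i _ => (h1 _).const_mul _).const_mul _)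
      have hset : MeasurableSet {a : (ℝ × ℝ) × (ι → ℝ) | Φ a.2 ∈ Set.Icc (-1 : π.parts → ℝ) 1} :=
        (hΦ.comp measurable_snd) measurableSet_Icc
      exact hm.indicator hset
    · refine ae_of_all _ fun a => ?_
      simp only [Function.uncurry, Real.norm_eq_abs]
      by_cases hz : Φ a.2 ∈ Set.Icc (-1 : π.parts → ℝ) 1
      · rw [Set.indicator_of_mem hz]
        exact abs_walkIndicator_le _ _ _ _ _
      · rw [Set.indicator_of_notMem hz, abs_zero]
        exact zero_le_one

lemma measurable_linForms {β ι : Type*} [Fintype ι] (M : β → ι → ℤ) :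
    Measurable (linForms M : (ι → ℝ) → β → ℝ) := by
  unfold linForms
  fun_prop

end Words

end ToeplitzBand

end

noncomputable section

namespace ToeplitzBand

set_option linter.unusedSectionVars false

/-! ### Lattice sums converge to the integrals of types I and II. -/

section Limits

open Finset

/-- The coordinate chosen in `deltaIntegral` has coefficient `1`, so there is no Jacobian factor. It
is exported so that the lattice sum can be solved for the same coordinate. -/
lemma exists_deltaIntegral_eq {β : Type*} [Fintype β] [DecidableEq β] {c : β → ℤ}
    (hc : ∀ V, c V = 0 ∨ c V = 1) (h : ∃ V, c V ≠ 0) : ∃ v, c v = 1 ∧ ∀ G : (β → ℝ) → ℝ,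
      deltaIntegral (fun V => (c V : ℝ)) G = ∫ z in Set.Icc (-1 : {w : β // w ≠ v} → ℝ) 1,
        (Set.Icc (-1 : β → ℝ) 1).indicator G (linForms (solveForms c v) z) := by
  have h' : ∃ V, (c V : ℝ) ≠ 0 := by
    obtain ⟨V, hV⟩ := h
    exact ⟨V, by exact_mod_cast hV⟩
  have hv : c h'.choose = 1 := by
    rcases hc h'.choose with h1 | h1
    · exact absurd (by rw [h1, Int.cast_zero]) h'.choose_spec
    · exact h1
  refine ⟨h'.choose, hv, fun G => ?_⟩
  have hpt : ∀ z : {w : β // w ≠ h'.choose} → ℝ,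
      hyperplanePoint (fun V => (c V : ℝ)) h'.choose z = linForms (solveForms c h'.choose) z := by
    intro z
    funext V
    by_cases hV : V = h'.choose
    · subst hV
      rw [linForms_solveForms_self]
      simp only [hyperplanePoint, dif_pos, hv, Int.cast_one, div_one]
      congr!
    · rw [linForms_solveForms_of_ne _ _ _ hV]
      simp only [hyperplanePoint, dif_neg hV]
  rw [deltaIntegral, dif_pos h']
  simp only [hv, Int.cast_one, abs_one, inv_one, one_mul]
  rw [← funext hpt]
  congr!

variable {p q : ℕ} {w : ℕ → ℕ} (hw : Tendsto w atTop atTop) {b : ℝ}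
  (hb : Tendsto (fun n => (w n : ℝ) / n) atTop (𝓝 b)) {π : Partition (p + q)} {s : ℤ}
  (hs : s = 1 ∨ s = -1)

lemma two_mul_card_of_mem_pairPartitions (hπ : π ∈ pairPartitions p q) :
    p + q = 2 * Fintype.card π.parts := by
  have h := π.sum_card_parts
  rw [sum_congr rfl fun V hV => card_of_mem_pairPartitions hπ hV] at h
  simpa [mul_comm] using h.symm

lemma two_mul_card_of_mem_pairFourPartitions (hπ : π ∈ pairFourPartitions p q) :
    p + q = 2 * Fintype.card π.parts + 2 := by
  obtain ⟨V, hV, h1, h2, h3⟩ := exists_block_of_mem_pairFourPartitions hπ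
  have h := π.sum_card_parts
  rw [← add_sum_erase _ _ hV, sum_congr rfl fun W hW =>
    (h3 W (mem_of_mem_erase hW) (ne_of_mem_erase hW)).1, card_eq_add_halves V, h1, h2] at h
  have h4 := card_erase_add_one hV
  simp only [sum_const, smul_eq_mul, card_univ, Fintype.card_fin] at h
  rw [Fintype.card_coe]
  omega

open Classical in
include hw hb hs in
lemma tendsto_pairCoeff_typeOne (hπ : π ∈ pairPartitions p q) :
    Tendsto (fun n => ∑ K ∈ boxWords (Fin (p + q)) (w n),
      pairCoeff n (w n) K * (if K ∈ genericWords π (epsInt π) s then 1 else 0)) atTop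
      (𝓝 (typeOne p q b s π)) := by
  set c : π.parts → ℤ := sideCoeff π (epsInt π) false with hcdef
  have hpair : ∀ V : π.parts, #(V : Finset (Fin (p + q))) = 2 := fun V =>
    card_of_mem_pairPartitions hπ V.2
  have hsg : ∀ V : π.parts, ∀ i ∈ (V : Finset (Fin (p + q))),
      epsInt π i = if i = blockMin π i then 1 else -1 := fun V i _ => epsInt_eq π i
  have hcross : ∀ V : π.parts, IsCrossing p q V → c V = 1 := fun V hV =>
    sideCoeff_of_crossing (hpair V) (hsg V) hV
  have hc : ∀ V, c V = 0 ∨ c V = 1 := by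
    intro V
    by_cases hV : IsCrossing p q V
    · exact Or.inr (hcross V hV)
    · exact Or.inl (sideCoeff_of_not_crossing (hpair V) (hsg V) hV false)
  have hex : ∃ V, c V ≠ 0 := by
    obtain ⟨V, hV, hVc⟩ := exists_crossing_of_mem_pairPartitions hπ
    exact ⟨⟨V, hV⟩, by rw [hcross ⟨V, hV⟩ hVc]; exact one_ne_zero⟩
  obtain ⟨v, hv, hdelta⟩ := exists_deltaIntegral_eq hc hex
  -- Removing `v` from at least three crossing pairs leaves two more, as `separated_solveForms`
  -- requires.
  obtain ⟨a, a', ha, ha', hav, hav', haa⟩ : ∃ a a', c a ≠ 0 ∧ c a' ≠ 0 ∧ a ≠ v ∧ a' ≠ v ∧ a ≠ a' := by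
    have h3 : 3 ≤ #(π.parts.filter fun V => IsCrossing p q V) := by
      rw [pairPartitions, mem_filter] at hπ
      exact hπ.2.2
    have h2 : 1 < #((π.parts.filter fun V => IsCrossing p q V).erase v) := by
      have := pred_card_le_card_erase (s := π.parts.filter fun V => IsCrossing p q V)
        (a := (v : Finset (Fin (p + q))))
      omega
    obtain ⟨a, ha, a', ha', hne⟩ := one_lt_card.1 h2
    rw [mem_erase, mem_filter] at ha ha'
    refine ⟨⟨a, ha.2.1⟩, ⟨a', ha'.2.1⟩, ?_, ?_, ?_, ?_, ?_⟩
    · rw [hcross _ ha.2.2]; exact one_ne_zero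
    · rw [hcross _ ha'.2.2]; exact one_ne_zero
    · exact fun h => ha.1 (congrArg Subtype.val h)
    · exact fun h => ha'.1 (congrArg Subtype.val h)
    · exact fun h => hne (congrArg Subtype.val h)
  have hM := separated_solveForms ha ha' hav hav' haa
  have hcard : Fintype.card π.parts = Fintype.card {W : π.parts // W ≠ v} + 1 := by
    rw [Fintype.card_subtype_compl, Fintype.card_subtype_eq]
    have : 0 < Fintype.card π.parts := Fintype.card_pos_iff.2 ⟨v⟩
    omega
  -- There are `(p + q) / 2` blocks, and one of them is solved for.
  have hdim : p + q = 2 * Fintype.card {W : π.parts // W ≠ v} + 2 := by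
    have := two_mul_card_of_mem_pairPartitions hπ
    omega
  have hlim : typeOne p q b s π = ∫ z in Set.Icc (-1 : {W : π.parts // W ≠ v} → ℝ) 1,
      (Set.Icc (-1 : π.parts → ℝ) 1).indicator
        (fun x => stayWeightLimit b (assembleReal π (epsInt π) s x))
          (linForms (solveForms c v) z) := by
    rw [← setIntegral_setIntegral_walkIndicator b π (epsInt π) s (measurable_linForms _), typeOne]
    have heps : epsSign π = fun i => (epsInt π i : ℝ) := funext fun i => (epsInt_cast π i).symm
    have hhalf : halfSumCoeff π (epsSign π) = fun V => (c V : ℝ) := by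
      funext V
      rw [hcdef, sideCoeff_false_cast, heps]
    simp only [hhalf, hdelta]
    rw [heps]
  rw [hlim]
  refine (tendsto_sum_generic hw hb π (epsInt π) s hM).congr' ?_
  filter_upwards [hw.eventually_ge_atTop 1] with n hn
  rw [sum_genericWords (epsInt_eq_or π) hs, mul_sum]
  have hco : ∀ x : π.parts → ℤ,
      (if IsGeneric x then pairCoeff n (w n) (assemble π (epsInt π) s x) else 0)
        = if ∑ V, c V * x V = 0 then (if IsGeneric x then (w n : ℝ)⁻¹ ^
          Fintype.card {W : π.parts // W ≠ v} * stayWeight n (assemble π (epsInt π) s x) else 0)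
          else 0 := by
    intro x
    have hneg : ∑ V, sideCoeff π (epsInt π) true V * x V = -∑ V, c V * x V := by
      rw [← sum_neg_distrib]
      exact sum_congr rfl fun V _ => by rw [sideCoeff_true_of_pair (hpair V) (hsg V), neg_mul]
    rw [pairCoeff_eq hn hdim, sum_castAdd_assemble, sum_natAdd_assemble, hneg, ← hcdef]
    by_cases h0 : ∑ V, c V * x V = 0 <;>
      simp only [h0, mul_zero, neg_zero, and_self, if_true, false_and, if_false, ite_self]
  rw [sum_congr rfl fun x _ => hco x, sum_boxWords_hyperplane hv]
  refine sum_congr rfl fun z _ => ?_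
  rw [ite_and, mul_ite, mul_ite, mul_zero]

open Classical in
include hw hb hs in
lemma tendsto_pairCoeff_typeTwo (hπ : π ∈ pairFourPartitions p q) :
    Tendsto (fun n => ∑ K ∈ boxWords (Fin (p + q)) (w n),
      pairCoeff n (w n) K * (if K ∈ genericWords π (tauInt π) s then 1 else 0)) atTop
      (𝓝 (typeTwo p q b s π)) := by
  have hcoef : ∀ (h : Bool) (V : π.parts), sideCoeff π (tauInt π) h V = 0 := by
    intro h V
    obtain ⟨W, hW, h1, h2, h3⟩ := exists_block_of_mem_pairFourPartitions hπ
    by_cases hVW : (V : Finset (Fin (p + q))) = W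
    · subst hVW
      exact sideCoeff_of_four h1 h2 h
    · obtain ⟨h4, h5⟩ := h3 V V.2 hVW
      refine sideCoeff_of_not_crossing h4 (fun i hi => tauInt_eq_of_card ?_) h5 h
      rw [π.part_eq_of_mem V.2 hi, h4]
  -- No relation constrains the block values, so the forms are the coordinates themselves and all
  -- blocks are free variables.
  let M : π.parts → π.parts → ℤ := fun V k => if V = k then 1 else 0
  have hid : ∀ {R : Type} [CommRing R] (z : π.parts → R), linForms M z = z := by
    intro R _ z
    funext V
    simp [linForms, M]
  have hM : Separated M := by
    refine ⟨fun V h => ?_, fun V W hVW h => ?_, fun V W hVW h => ?_⟩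
    · simpa [M] using congrFun h V
    · simpa [M, hVW.symm] using congrFun h V
    · simpa [M, hVW.symm] using congrFun h V
  have hlim : typeTwo p q b s π = ∫ z in Set.Icc (-1 : π.parts → ℝ) 1,
      (Set.Icc (-1 : π.parts → ℝ) 1).indicator
        (fun x => stayWeightLimit b (assembleReal π (tauInt π) s x)) (linForms M z) := by
    rw [← setIntegral_setIntegral_walkIndicator b π (tauInt π) s (measurable_linForms _), typeTwo]
    have htau : tauSign π = fun i => (tauInt π i : ℝ) := funext fun i => (tauInt_cast π i).symm
    rw [htau]
    refine integral_congr_ae (ae_of_all _ fun t => ?_)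
    refine setIntegral_congr_fun measurableSet_Icc fun z hz => ?_
    simp only [hid]
    rw [Set.indicator_of_mem hz]
  rw [hlim]
  refine (tendsto_sum_generic hw hb π (tauInt π) s hM).congr' ?_
  filter_upwards [hw.eventually_ge_atTop 1] with n hn
  rw [sum_genericWords (tauInt_eq_or π) hs, mul_sum]
  refine sum_congr rfl fun x hx => ?_
  rw [hid, pairCoeff_eq hn (two_mul_card_of_mem_pairFourPartitions hπ), sum_castAdd_assemble,
    sum_natAdd_assemble]
  simp [hcoef, hx]

variable {Ω : Type*} [MeasurableSpace Ω] {P : Measure Ω} [IsProbabilityMeasure P]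
  {A : ℕ → Ω → ℝ} (hA : Noise P A) {κ : ℝ}
  (hvar : ∀ v, 1 ≤ v → ∫ ω, A v ω ^ 2 ∂P = 1) (hfourth : ∀ v, 1 ≤ v → ∫ ω, A v ω ^ 4 ∂P = κ)

include hw hb in
variable (p q) in
lemma tendsto_sum_limitWeight (κ : ℝ) :
    Tendsto (fun n => ∑ K ∈ boxWords (Fin (p + q)) (w n), pairCoeff n (w n) K * limitWeight κ K)
      atTop (𝓝 (sigma κ b p q)) := by
  classical
  have hcount : ∀ (S : Finset (Partition (p + q))) (sgn : Partition (p + q) → Fin (p + q) → ℤ)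
      (f : ℝ → Partition (p + q) → ℝ), (∀ π ∈ S, ∀ s : ℤ, s = 1 ∨ s = -1 →
        Tendsto (fun n => ∑ K ∈ boxWords (Fin (p + q)) (w n),
          pairCoeff n (w n) K * (if K ∈ genericWords π (sgn π) s then 1 else 0)) atTop
          (𝓝 (f s π))) →
      Tendsto (fun n => ∑ K ∈ boxWords (Fin (p + q)) (w n),
        pairCoeff n (w n) K * genericCount S sgn K) atTop (𝓝 (∑ π ∈ S, (f 1 π + f (-1) π))) := by
    intro S sgn f hf
    have h1 : ∀ n, ∑ K ∈ boxWords (Fin (p + q)) (w n), pairCoeff n (w n) K * genericCount S sgn K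
        = ∑ π ∈ S, ((∑ K ∈ boxWords (Fin (p + q)) (w n),
            pairCoeff n (w n) K * (if K ∈ genericWords π (sgn π) 1 then 1 else 0)) +
          ∑ K ∈ boxWords (Fin (p + q)) (w n),
            pairCoeff n (w n) K * (if K ∈ genericWords π (sgn π) (-1) then 1 else 0)) := by
      intro n
      simp only [← sum_add_distrib]
      rw [sum_comm]
      refine sum_congr rfl fun K _ => ?_
      rw [genericCount, mul_sum]
      refine sum_congr rfl fun π _ => ?_
      rw [sum_pair (by norm_num), mul_add]
    simp_rw [h1]
    refine tendsto_finsetSum _ fun π hπ => ?_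
    have h2 := hf π hπ 1 (Or.inl rfl)
    have h3 := hf π hπ (-1) (Or.inr rfl)
    simp only [Int.cast_one, Int.cast_neg] at h2 h3
    exact h2.add h3
  have h1 := hcount (pairPartitions p q) epsInt (fun s π => typeOne p q b s π)
    fun π hπ s hs => tendsto_pairCoeff_typeOne hw hb hs hπ
  have h2 := hcount (pairFourPartitions p q) tauInt (fun s π => typeTwo p q b s π)
    fun π hπ s hs => tendsto_pairCoeff_typeTwo hw hb hs hπ
  refine (h1.add (h2.const_mul (κ - 1))).congr fun n => ?_
  rw [mul_sum, ← sum_add_distrib]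
  refine sum_congr rfl fun K _ => ?_
  rw [limitWeight]
  ring

include hA hvar hfourth hw hb in
variable (p q) in
lemma Noise.tendsto_covariance :
    Tendsto (fun n => ∫ ω, wordSum P A (w n) (fluctCoeff n (w n) p) ω *
      wordSum P A (w n) (fluctCoeff n (w n) q) ω ∂P) atTop (𝓝 (sigma κ b p q)) := by
  obtain ⟨C, hC⟩ := hA.exists_covariance_bound p q hvar hfourth
  have hwr : Tendsto (fun n => √(w n : ℝ)) atTop atTop :=
    Real.tendsto_sqrt_atTop.comp (tendsto_natCast_atTop_atTop.comp hw)
  have h0 : Tendsto (fun n => ∫ ω, wordSum P A (w n) (fluctCoeff n (w n) p) ω *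
      wordSum P A (w n) (fluctCoeff n (w n) q) ω ∂P - ∑ K ∈ boxWords (Fin (p + q)) (w n),
        pairCoeff n (w n) K * limitWeight κ K) atTop (𝓝 0) := by
    refine squeeze_zero_norm' ?_ (hwr.const_div_atTop C)
    filter_upwards [eventually_ge_atTop 1, hw.eventually_ge_atTop 1] with n hn hn1
    rw [le_div_iff₀ (Real.sqrt_pos.2 (by exact_mod_cast hn1)), Real.norm_eq_abs]
    exact hC n (w n) hn hn1
  simpa using h0.add (tendsto_sum_limitWeight p q hw hb κ)

end Limits

end ToeplitzBand

end

noncomputable section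

namespace ToeplitzBand

set_option linter.unusedSectionVars false

/-! ### The theorem for polynomials, and monomials as a special case. -/

section Assembly

open Finset

lemma testPoly_ite {p : ℕ} (hp : 2 ≤ p) :
    testPoly p (fun j => if j = p then 1 else 0) = Polynomial.X ^ p := by
  rw [testPoly, sum_eq_single_of_mem p (mem_Icc.2 ⟨hp, le_rfl⟩)]
  · simp
  · intro j _ hj
    simp [hj]

lemma sigmaPoly_ite {p : ℕ} (hp : 2 ≤ p) (κ b : ℝ) :
    sigmaPoly κ b p (fun j => if j = p then 1 else 0) = sigma κ b p p := by
  have hmem : p ∈ Icc 2 p := mem_Icc.2 ⟨hp, le_rfl⟩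
  rw [sigmaPoly, sum_eq_single_of_mem p hmem fun i _ hi => by simp [hi],
    sum_eq_single_of_mem p hmem fun i _ hi => by simp [hi]]
  simp

/-- The central limit theorem for the traces of polynomials of Toeplitz band matrices. -/
theorem tendstoInDistribution_trace_aeval {Ω : Type*} [MeasurableSpace Ω] {P : Measure Ω}
    [IsProbabilityMeasure P] {a : ℤ → Ω → ℝ} (hA : Noise P fun v : ℕ => a (v : ℤ))
    (hsymm : ∀ j, a (-j) = a j) {κ : ℝ} (hvar : ∀ v : ℕ, 1 ≤ v → ∫ ω, a v ω ^ 2 ∂P = 1)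
    (hfourth : ∀ v : ℕ, 1 ≤ v → ∫ ω, a v ω ^ 4 ∂P = κ) {bw : ℕ → ℕ}
    (hbw : Tendsto bw atTop atTop) {b : ℝ}
    (hb : Tendsto (fun n => (bw n : ℝ) / n) atTop (𝓝 b)) (p : ℕ) (c : ℕ → ℝ) :
    0 ≤ sigmaPoly κ b p c ∧ TendstoInDistribution (fun n => fluctuation P bw n
        fun ω => (Polynomial.aeval (scaledToeplitz a bw n ω) (testPoly p c)).trace)
      atTop (id : ℝ → ℝ) (fun _ => P) (gaussianReal 0 (sigmaPoly κ b p c).toNNReal) := by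
  have h := hA.tendstoInDistribution_polySum (Icc 2 p) c hbw
    (c := fun n => fluctCoeff n (bw n)) (fun n hn k => admissible_fluctCoeff hn (bw n) k)
    (s := sigma κ b) fun i _ j _ => hA.tendsto_covariance i j hbw hb hvar hfourth
  refine ⟨h.1, ?_⟩
  have heq : (fun n => fluctuation P bw n
      fun ω => (Polynomial.aeval (scaledToeplitz a bw n ω) (testPoly p c)).trace)
      = fun n => polySum P (fun v : ℕ => a (v : ℤ)) (bw n) (Icc 2 p) c (fluctCoeff n (bw n)) :=
    funext fun n => funext fun ω => fluctuation_trace_aeval hA hsymm bw n p c ω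
  rw [heq]
  exact h.2

end Assembly

end ToeplitzBand

end

theorem theorem1p1 {Ω : Type*} [MeasurableSpace Ω] (P : Measure Ω) [IsProbabilityMeasure P]
    (a : ℤ → Ω → ℝ) (κ : ℝ) (bw : ℕ → ℕ) (b : ℝ)
    (hmeas : ∀ j, Measurable (a j))
    (hsymm : ∀ j, a (-j) = a j)
    (hzero : ∀ ω, a 0 ω = 0)
    (hindep : iIndepFun (fun j : ℕ => a ((j : ℤ) + 1)) P)
    (hmean : ∀ j : ℤ, 1 ≤ j → ∫ ω, a j ω ∂P = 0)
    (hvar : ∀ j : ℤ, 1 ≤ j → ∫ ω, |a j ω| ^ 2 ∂P = 1)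
    (hfourth : ∀ j : ℤ, 1 ≤ j → ∫ ω, |a j ω| ^ 4 ∂P = κ)
    (hbdd : ∀ k : ℕ, 3 ≤ k → ∃ C : ℝ, ∀ j : ℤ, 1 ≤ j →
      Integrable (fun ω => |a j ω| ^ k) P ∧ ∫ ω, |a j ω| ^ k ∂P ≤ C)
    (hbw_lt : ∀ n : ℕ, 1 ≤ n → bw n < n)
    (hbw_top : Tendsto bw atTop atTop)
    (hb : b ∈ Set.Icc (0 : ℝ) 1)
    (hbw_lim : Tendsto (fun n : ℕ => (bw n : ℝ) / (n : ℝ)) atTop (𝓝 b)) :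
    (∀ p : ℕ, 2 ≤ p →
      (∀ n, Integrable (fun ω => (ToeplitzBand.scaledToeplitz a bw n ω ^ p).trace) P) ∧
      0 ≤ ToeplitzBand.sigma κ b p p ∧
      TendstoInDistribution
        (fun n : ℕ => ToeplitzBand.fluctuation P bw n
          fun ω => (ToeplitzBand.scaledToeplitz a bw n ω ^ p).trace)
        atTop (id : ℝ → ℝ) (fun _ => P)
        (gaussianReal 0 (ToeplitzBand.sigma κ b p p).toNNReal)) ∧
    (∀ (p : ℕ) (c : ℕ → ℝ), 2 ≤ p →
      (∀ n, Integrable (fun ω => (Polynomial.aeval (ToeplitzBand.scaledToeplitz a bw n ω)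
        (ToeplitzBand.testPoly p c)).trace) P) ∧
      0 ≤ ToeplitzBand.sigmaPoly κ b p c ∧
      TendstoInDistribution
        (fun n : ℕ => ToeplitzBand.fluctuation P bw n
          fun ω => (Polynomial.aeval (ToeplitzBand.scaledToeplitz a bw n ω)
            (ToeplitzBand.testPoly p c)).trace)
        atTop (id : ℝ → ℝ) (fun _ => P)
        (gaussianReal 0 (ToeplitzBand.sigmaPoly κ b p c).toNNReal)) := by
  have hA := ToeplitzBand.noise_of_hypotheses hmeas hzero hindep hmean hbdd
  have hvar' : ∀ v : ℕ, 1 ≤ v → ∫ ω, a v ω ^ 2 ∂P = 1 := fun v hv => by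
    simpa only [sq_abs] using hvar v (by exact_mod_cast hv)
  have hfourth' : ∀ v : ℕ, 1 ≤ v → ∫ ω, a v ω ^ 4 ∂P = κ := fun v hv => by
    have h4 : ∀ x : ℝ, |x| ^ 4 = x ^ 4 := fun x => (by decide : Even 4).pow_abs x
    simpa only [h4] using hfourth v (by exact_mod_cast hv)
  have main := ToeplitzBand.tendstoInDistribution_trace_aeval hA hsymm hvar' hfourth' hbw_top hbw_lim
  refine ⟨fun p hp => ?_, fun p c _ =>
    ⟨fun n => ToeplitzBand.integrable_trace_aeval hA hsymm bw n p c, main p c⟩⟩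
  -- The first part is the second one for a polynomial with a single non-zero coefficient.
  have hint := fun n => ToeplitzBand.integrable_trace_aeval hA hsymm bw n p
    fun j => if j = p then 1 else 0
  have hlim := main p fun j => if j = p then 1 else 0
  simp only [ToeplitzBand.testPoly_ite hp, ToeplitzBand.sigmaPoly_ite hp, map_pow,
    Polynomial.aeval_X] at hint hlim
  exact ⟨hint, hlim⟩
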